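/- **Setting.** Let $\Gamma\subset\mathbb R^d$ be an oriented network with finitely many vertices $x_i$ ($i\in I$) and arcs $e_j$ ($j\in J$), which meet only at vertices. Each arc has a smooth injective parametrization $\pi_j$, compatible with the orientation, defined on $[0,L_j]$ with $0<L_j<\infty$, or on $[0,\infty)$ (unbounded arc originating from the vertex $\pi_j(0)$), or on $(-\infty,0]$ (unbounded arc terminating in the vertex $\pi_j(0)$; then put $L_j:=0$). Functions and measures on an arc are written in its coordinate. $\mathrm{Inc}(x_i)$ and $\mathrm{Out}(x_i)$ are the sets of arcs terminating in and originating from $x_i$; $e_k\to e_j$ means that $e_j$ originates from the vertex in which $e_k$ terminates. Every vertex has an outgoing arc (no sinks). $\mathcal S$ is the set of sources (vertices without incoming arcs); each source has exactly one outgoing arc. Let $T>0$. *Data.* (a) On each arc a function $v_j\ge 0$, bounded and Lipschitz (no continuity across vertices); write $v=(v_j)$. (b) Functions $p_{kj}\in BV([0,T];[0,1])$ with $p_{kj}=0$ unless $e_k\to e_j$, and $\sum_j p_{kj}(t)=1$ for every $t\in[0,T]$ and every arc $e_k$ that terminates in a vertex. (c) Finite positive measures $m_0=\sum_j m_0^j$,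 with $m_0^j$ on $e_j$, such that $m_0^j(\{\pi_j(L_j)\})=0$ whenever $e_j$ terminates in a vertex and $v_j(L_j)=0$. (d) For each $x_i\in\mathcal S$ a finite positive measure $\sigma_0^i$ on $[0,T]$. *Solution.* A solution of $\partial_t m+\partial_x(vm)=0$ on $\Gamma\times[0,T]$ with these data is a finite measure $m=m_t\otimes dt$, with finite positive measures $m_t=\sum_j m_t^j$ ($m_t^j$ on $e_j$, $t\in[0,T]$), such that for all continuous, compactly supported $f$ on $\Gamma\times[0,T]$ that are $C^1$ on each closed $e_j\times[0,T]$, $$\int_\Gamma f(\cdot,T)\,dm_T-\int_\Gamma f(\cdot,0)\,dm_0-\sum_{x_i\in\mathcal S}\int_{[0,T]}f(x_i,t)\,d\sigma_0^i(t)=\int_0^T\!\!\int_\Gamma(\partial_tf+v\,\partial_xf)\,dm_t\,dt,$$ and such that there are finite positive measures $m^j_{x=\pi_j(0)}$, $m^j_{x=\pi_j(L_j)}$ on $[0,T]$ (the traces of $m$ at the end vertices of $e_j$, each present only if the corresponding vertex exists) with, for every $j$ and every compactly supported $C^1$ function $f$ on $e_j\times[0,T]$, $$\int f(\cdot,T)\,dm^j_T-\int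 f(\cdot,0)\,dm^j_0-\int f(0,t)\,dm^j_{x=\pi_j(0)}(t)+\int f(L_j,t)\,dm^j_{x=\pi_j(L_j)}(t)=\int_0^T\!\!\int(\partial_tf+v_j\partial_xf)\,dm^j_t\,dt$$ ($m_0^j$ is the initial datum), and, for every vertex $x_i\notin\mathcal S$ and $e_j\in\mathrm{Out}(x_i)$, $m^j_{x=x_i}=\sum_{e_k\in\mathrm{Inc}(x_i)}p_{kj}\,m^k_{x=x_i}$. *Paths.* Let a particle be at the point with coordinate $x$ of the arc $e_{j_0}$ at time $s$. For a finite sequence $\gamma=(e_{j_0},\dots,e_{j_n})$ with $e_{j_k}\to e_{j_{k+1}}$, the flow map $\Phi^\gamma_t(x,s)$ moves the particle by $\dot c=v_{j_0}(c)$ on $e_{j_0}$ from time $s$ until its exit time $\theta^\gamma_0(x,s)$ (the first time $\ge s$ at which it is at the terminal vertex of $e_{j_0}$), then by $\dot c=v_{j_1}(c)$ on $e_{j_1}$ from the coordinate $0$ until its exit time $\theta^\gamma_1(x,s)$, and so on. The exit time is infinite if the terminal vertex does not exist or is never reached. Let $\mathcal A_t(x,s)$ be the (finite) set of the *admissible paths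 up to time $t$*, i.e. of those $\gamma$ with $\theta^\gamma_{n-1}(x,s)\le t<\theta^\gamma_n(x,s)$ (only $t<\theta^\gamma_0$ if $n=0$), and for these let $$p_\gamma(x,s):=\prod_{k=0}^{n-1}p_{j_kj_{k+1}}(\theta^\gamma_k(x,s)).$$ A mass belonging to $m_0^j$ starts on $j_0=j$; a mass entering at a source starts at coordinate $0$ of its outgoing arc. **Theorem.** Let $m$ be a solution. For $t\in[0,T]$ define the measure on $\Gamma$ $$F_t:=\int_\Gamma\ \sum_{\gamma\in\mathcal A_t(x,0)}p_\gamma(x,0)\,\delta_{\Phi^\gamma_t(x,0)}\,dm_0(x)+\sum_{x_i\in\mathcal S}\int_{[0,t]}\ \sum_{\gamma\in\mathcal A_t(x_i,s)}p_\gamma(x_i,s)\,\delta_{\Phi^\gamma_t(x_i,s)}\,d\sigma_0^i(s).$$ Then $m_t=F_t$ as measures on $\Gamma$ at every time $t\in[0,T]$, in the following sense: $m_t=F_t$ for almost every $t\in[0,T]$; for every $t\in[0,T)$ the measure $F_t$ is finite and is the trace of $m$ at time $t$, that is, $\frac1h\int_t^{t+h}m_s\,ds\to F_t$ as $h\to0^+$,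 tested on continuous functions with compact support; and $m_T=F_T$. -/

import Mathlib

open MeasureTheory Set Filter Topology
open scoped ContDiff

/-- The possible kinds of oriented arcs of a network with vertex set `V`: a bounded arc from `a`
to `b` of length `L`, an unbounded arc originating from `a`, an unbounded arc terminating in `b`. -/
inductive ArcShape (V : Type*) where
  | bounded (a b : V) (L : ℝ)
  | outRay (a : V)
  | inRay (b : V)

namespace ArcShape

variable {V : Type*}

/-- The vertex from which the arc originates, if there is one (its coordinate is always `0`). -/
def origin : ArcShape V → Option V
  | bounded a _ _ => some a
  | outRay a => some a
  | inRay _ => none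

/-- The vertex in which the arc terminates, if there is one. -/
def terminus : ArcShape V → Option V
  | bounded _ b _ => some b
  | outRay _ => none
  | inRay b => some b

/-- The parameter interval: `[0, L]`, `[0, ∞)` or `(-∞, 0]`. -/
def dom : ArcShape V → Set ℝ
  | bounded _ _ L => Icc 0 L
  | outRay _ => Ici 0
  | inRay _ => Iic 0

/-- The coordinate of the terminal vertex: `L` for a bounded arc and `0` for an unbounded arc
that terminates in a vertex (not used for the arcs without terminal vertex). -/
def endCoord : ArcShape V → ℝ
  | bounded _ _ L => L
  | outRay _ => 0
  | inRay _ => 0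

/-- The nearest point projection of `ℝ` onto the parameter interval. -/
noncomputable def clamp : ArcShape V → ℝ → ℝ
  | bounded _ _ L, x => max 0 (min x L)
  | outRay _, x => max 0 x
  | inRay _, x => min x 0

end ArcShape

/-- An oriented network in `ℝ^d`, without sinks, with vertices `V` and arcs `J`. -/
structure Network (V J : Type*) (d : ℕ) where
  /-- the position of the vertices -/
  pos : V → EuclideanSpace ℝ (Fin d)
  /-- the kind and the end vertices of the arcs -/
  arc : J → ArcShape V
  /-- the parametrizations of the arcs -/
  param : J → ℝ → EuclideanSpace ℝ (Fin d)
  pos_injective : Function.Injective pos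
  length_pos : ∀ j a b L, arc j = ArcShape.bounded a b L → 0 < L
  param_smooth : ∀ j, ContDiffOn ℝ ∞ (param j) (arc j).dom
  param_injOn : ∀ j, InjOn (param j) (arc j).dom
  param_origin : ∀ j i, (arc j).origin = some i → param j 0 = pos i
  param_terminus : ∀ j i, (arc j).terminus = some i → param j (arc j).endCoord = pos i
  /-- a vertex lies on an arc only as one of its endpoints -/
  vertex_on_arc : ∀ j i, ∀ x ∈ (arc j).dom, param j x = pos i →
    ((arc j).origin = some i ∧ x = 0) ∨ ((arc j).terminus = some i ∧ x = (arc j).endCoord)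
  /-- different arcs meet only at vertices -/
  arcs_meet : ∀ j k, j ≠ k → ∀ x ∈ (arc j).dom, ∀ y ∈ (arc k).dom, param j x = param k y →
    ∃ i, param j x = pos i
  /-- there are no sinks -/
  no_sink : ∀ i, ∃ j, (arc j).origin = some i
  /-- a source has a unique outgoing arc -/
  source_unique : ∀ i, (∀ k, (arc k).terminus ≠ some i) →
    ∀ j j', (arc j).origin = some i → (arc j').origin = some i → j = j'

namespace Network

variable {V J : Type*} {d : ℕ} (N : Network V J d)

/-- `x_i` is a source: it has no incoming arc. -/
def IsSource (i : V) : Prop := ∀ k, (N.arc k).terminus ≠ some i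

/-- `e_k → e_j`: the arc `e_j` originates from the vertex in which `e_k` terminates. -/
def Follows (k j : J) : Prop := ∃ i, (N.arc k).terminus = some i ∧ (N.arc j).origin = some i

/-- The measure on `Γ ⊆ ℝ^d` whose part on the arc `e_j` is `μ j` in the coordinate of `e_j`. -/
noncomputable def toNetwork [Fintype J] (μ : J → Measure ℝ) :
    Measure (EuclideanSpace ℝ (Fin d)) :=
  ∑ j, (μ j).map (N.param j)

/-! ### The data of the problem -/

/-- The velocity field, given on each arc in the coordinate of the arc: nonnegative, bounded, and
Lipschitz continuous on each arc (no continuity is required across the vertices). -/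
structure IsVelocity (v : J → ℝ → ℝ) : Prop where
  nonneg : ∀ j, ∀ x ∈ (N.arc j).dom, 0 ≤ v j x
  bounded : ∃ Vmax > 0, ∀ j, ∀ x ∈ (N.arc j).dom, v j x ≤ Vmax
  lipschitz : ∃ K, ∀ j, LipschitzOnWith K (v j) (N.arc j).dom

/-- `p t k j` is the fraction of the mass which flows at time `t` from `e_k` to `e_j`. -/
structure IsDistribution [Fintype J] (T : ℝ) (p : ℝ → J → J → ℝ) : Prop where
  nonneg : ∀ t ∈ Icc 0 T, ∀ k j, 0 ≤ p t k j
  le_one : ∀ t ∈ Icc 0 T, ∀ k j, p t k j ≤ 1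
  eq_zero : ∀ t ∈ Icc 0 T, ∀ k j, ¬ N.Follows k j → p t k j = 0
  sum_eq_one : ∀ t ∈ Icc 0 T, ∀ k i, (N.arc k).terminus = some i → ∑ j, p t k j = 1
  bv : ∀ k j, BoundedVariationOn (fun t => p t k j) (Icc 0 T)

/-- A finite measure on `Γ`, given by its parts on the arcs. -/
structure IsArcMeasure (μ : J → Measure ℝ) : Prop where
  finite : ∀ j, IsFiniteMeasure (μ j)
  supported : ∀ j, μ j (N.arc j).domᶜ = 0

/-- The boundary data: a finite measure on `[0, T]` for each source. -/
structure IsBoundaryData (T : ℝ) (σ : V → Measure ℝ) : Prop where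
  finite : ∀ i, N.IsSource i → IsFiniteMeasure (σ i)
  supported : ∀ i, N.IsSource i → σ i (Icc 0 T)ᶜ = 0

/-! ### Solutions of the linear transport problem -/

/-- Test functions on a single closed arc (in coordinates `x`, `t`): restrictions of
compactly supported `C^1` functions of the plane. -/
def IsArcTest (f : ℝ → ℝ → ℝ) : Prop :=
  ContDiff ℝ 1 (fun q : ℝ × ℝ => f q.1 q.2) ∧
    HasCompactSupport (fun q : ℝ × ℝ => f q.1 q.2)

/-- Test functions on `Γ × [0, T]`: `C^1` on each closed arc and continuous on `Γ`, where
`g i t` is the value at the vertex `x_i` at time `t`. -/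
structure IsTest (f : J → ℝ → ℝ → ℝ) (g : V → ℝ → ℝ) : Prop where
  arc_test : ∀ j, IsArcTest (f j)
  origin : ∀ j i, (N.arc j).origin = some i → ∀ t, f j 0 t = g i t
  terminus : ∀ j i, (N.arc j).terminus = some i → ∀ t, f j (N.arc j).endCoord t = g i t

/-- `∂_t f + v ∂_x f` on the arc `e_j`. -/
noncomputable def transportOp (v : J → ℝ → ℝ) (j : J) (f : ℝ → ℝ → ℝ) (x t : ℝ) : ℝ :=
  deriv (fun s => f x s) t + v j x * deriv (fun y => f y t) x

/-- `νin j` and `νout j` are the traces of `m^j` on `{π_j(0)} × [0, T]` and on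
`{π_j(L_j)} × [0, T]`: on each arc the integration by parts formula holds with these boundary
terms (only those which belong to a vertex of the arc are present). -/
structure AreVertexTraces (T : ℝ) (v : J → ℝ → ℝ) (m₀ : J → Measure ℝ)
    (m : ℝ → J → Measure ℝ) (νin νout : J → Measure ℝ) : Prop where
  in_finite : ∀ j, IsFiniteMeasure (νin j)
  out_finite : ∀ j, IsFiniteMeasure (νout j)
  in_supported : ∀ j, νin j (Icc 0 T)ᶜ = 0
  out_supported : ∀ j, νout j (Icc 0 T)ᶜ = 0
  in_eq_zero : ∀ j, (N.arc j).origin = none → νin j = 0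
  out_eq_zero : ∀ j, (N.arc j).terminus = none → νout j = 0
  balance : ∀ j f, IsArcTest f →
    ∫ x, f x T ∂(m T j) - ∫ x, f x 0 ∂(m₀ j)
      - ∫ t, f 0 t ∂(νin j) + ∫ t, f (N.arc j).endCoord t ∂(νout j)
      = ∫ t in Icc 0 T, ∫ x, transportOp v j f x t ∂(m t j)

open Classical in
/-- `m = m_t ⊗ dt` is a measure-valued solution of
`∂_t m + ∂_x (v m) = 0` on `Γ × [0, T]` with initial measure `m₀`, boundary measures `σ i` at the
sources and transmission conditions given by `p`. Here `m t j` is the part of `m_t` on `e_j`. -/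
structure IsSolution [Fintype V] [Fintype J] (T : ℝ) (v : J → ℝ → ℝ) (p : ℝ → J → J → ℝ)
    (m₀ : J → Measure ℝ) (σ : V → Measure ℝ) (m : ℝ → J → Measure ℝ) : Prop where
  arcMeasure : ∀ t ∈ Icc 0 T, N.IsArcMeasure (m t)
  measurable : ∀ j, AEMeasurable (fun t => m t j) (volume.restrict (Icc 0 T))
  finite : ∀ j, ∫⁻ t in Icc 0 T, m t j univ < ⊤
  /-- the weak formulation on the whole network -/
  balance : ∀ f g, N.IsTest f g →
    ∑ j, ∫ x, f j x T ∂(m T j) - ∑ j, ∫ x, f j x 0 ∂(m₀ j)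
      - ∑ i with N.IsSource i, ∫ t, g i t ∂(σ i)
      = ∫ t in Icc 0 T, ∑ j, ∫ x, transportOp v j (f j) x t ∂(m t j)
  /-- the transmission conditions at the vertices which are not sources -/
  transmission : ∃ νin νout : J → Measure ℝ, N.AreVertexTraces T v m₀ m νin νout ∧
    ∀ i, ¬ N.IsSource i → ∀ j, (N.arc j).origin = some i → ∀ f : ℝ → ℝ, Continuous f →
      ∫ t, f t ∂(νin j)
        = ∑ k with (N.arc k).terminus = some i, ∫ t, p t k j * f t ∂(νout k)

/-- `μ` is the trace on `Γ × {t}`, from the right, of the measure `m = m_s ⊗ ds`: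
`h⁻¹ ∫_t^{t+h} m_s ds` converges to `μ` as `h → 0+`, tested on continuous functions with
compact support. -/
def IsTimeTrace [Fintype J] (m : ℝ → J → Measure ℝ) (t : ℝ)
    (μ : Measure (EuclideanSpace ℝ (Fin d))) : Prop :=
  IsFiniteMeasure μ ∧
  ∀ φ : EuclideanSpace ℝ (Fin d) → ℝ, Continuous φ → HasCompactSupport φ →
    Tendsto (fun h : ℝ => h⁻¹ * ∫ s in Icc t (t + h), ∫ y, φ y ∂(N.toNetwork (m s)))
      (𝓝[>] 0) (𝓝 (∫ y, φ y ∂μ))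

/-! ### Flow maps, exit times and weights along the paths -/

/-- The velocity on `e_j`, extended to `ℝ` by its values at the endpoints. -/
noncomputable def extVelocity (v : J → ℝ → ℝ) (j : J) (x : ℝ) : ℝ := v j ((N.arc j).clamp x)

/-- `c` solves `c' = u(c)` on `[0, τ]` with `c(0) = x`. -/
def IsCurve (u : ℝ → ℝ) (x τ : ℝ) (c : ℝ → ℝ) : Prop :=
  c 0 = x ∧ ∀ r ∈ Icc 0 τ, HasDerivWithinAt c (u (c r)) (Icc 0 τ) r

/-- The position on `e_j` at time `t` of the particle that is at `x` at time `s ≤ t`: the value at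
`t - s` of the solution of `c' = v_j(c)`, `c(0) = x` (beyond the end of the arc, where the value
is not used, the velocity is continued by a constant). -/
noncomputable def arcFlow (v : J → ℝ → ℝ) (j : J) (x s t : ℝ) : ℝ :=
  Classical.epsilon fun y => ∃ c, IsCurve (N.extVelocity v j) x (t - s) c ∧ c (t - s) = y

/-- The times at which the particle that starts at `x` at time `s` is at the terminal vertex
of `e_j`. -/
def exitSet (v : J → ℝ → ℝ) (j : J) (x s : ℝ) : Set ℝ :=
  {r | s ≤ r ∧ (N.arc j).terminus ≠ none ∧ N.arcFlow v j x s r = (N.arc j).endCoord}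

/-- The exit time from `e_j` (meaningful when the particle does reach the end of the arc). -/
noncomputable def exitTime (v : J → ℝ → ℝ) (j : J) (x s : ℝ) : ℝ := sInf (N.exitSet v j x s)

/-- The particle that starts at `x` at time `s` reaches the end of `e_j` by time `t`. -/
def ExitsBy (v : J → ℝ → ℝ) (j : J) (x s t : ℝ) : Prop := ∃ r ∈ N.exitSet v j x s, r ≤ t

/-- The sequence of arcs `γ = (e_j, l)` is the path followed up to time `t` by a particle
that is at the point `x` of `e_j` at time `s`: consecutive arcs follow each other, all the arcs but
the last one are left by time `t`, and the last one is not. -/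
def IsPathUpTo (v : J → ℝ → ℝ) : J → ℝ → ℝ → List J → ℝ → Prop
  | j, x, s, [], t => ¬ N.ExitsBy v j x s t
  | j, x, s, k :: l, t =>
      N.ExitsBy v j x s t ∧ N.Follows j k ∧ IsPathUpTo v k 0 (N.exitTime v j x s) l t

/-- The flow map `Φ^γ_t(x, s)` along the path `γ = (e_j, l)`, as a point of `Γ`, for the times `t`
spent in the last arc of `γ`. -/
noncomputable def pathFlow (v : J → ℝ → ℝ) :
    J → ℝ → ℝ → List J → ℝ → EuclideanSpace ℝ (Fin d)
  | j, x, s, [], t => N.param j (N.arcFlow v j x s t)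
  | j, x, s, k :: l, t => pathFlow v k 0 (N.exitTime v j x s) l t

/-- The weight `p_γ(x, s)`: the product of the distribution coefficients of the junctions of
`γ = (e_j, l)`, evaluated at the successive exit times. -/
noncomputable def pathWeight (v : J → ℝ → ℝ) (p : ℝ → J → J → ℝ) :
    J → ℝ → ℝ → List J → ℝ
  | _, _, _, [] => 1
  | j, x, s, k :: l =>
      p (N.exitTime v j x s) j k * pathWeight v p k 0 (N.exitTime v j x s) l

open Classical in
/-- `∑_γ p_γ(x, s) δ_{Φ^γ_t(x, s)}`, the sum being over the paths up to time `t` from the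
point `x` of `e_j` at time `s`. -/
noncomputable def pathSum (v : J → ℝ → ℝ) (p : ℝ → J → J → ℝ) (j : J) (x s t : ℝ) :
    Measure (EuclideanSpace ℝ (Fin d)) :=
  Measure.sum fun l : List J =>
    if N.IsPathUpTo v j x s l t then
      ENNReal.ofReal (N.pathWeight v p j x s l) • Measure.dirac (N.pathFlow v j x s l t)
    else 0

open Classical in
/-- The push-forward at time `t` of the initial and boundary data along the paths:
`∫_Γ ∑_γ p_γ(x,0) δ_{Φ^γ_t(x,0)} dm₀(x) + ∑_{x_i ∈ S} ∫_{[0,t]} ∑_γ p_γ(x_i,s) δ_{Φ^γ_t(x_i,s)} dσ^i(s)`.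
-/
noncomputable def pushForward [Fintype V] [Fintype J] (v : J → ℝ → ℝ) (p : ℝ → J → J → ℝ)
    (m₀ : J → Measure ℝ) (σ : V → Measure ℝ) (t : ℝ) : Measure (EuclideanSpace ℝ (Fin d)) :=
  ∑ j, (m₀ j).bind (fun x => N.pathSum v p j x 0 t)
    + ∑ i with N.IsSource i, ∑ j with (N.arc j).origin = some i,
        ((σ i).restrict (Icc 0 t)).bind (fun s => N.pathSum v p j 0 s t)

end Network

namespace ArcShape

variable {V : Type*}

theorem clamp_mem (a : ArcShape V) (h : ∀ i k L, a = bounded i k L → 0 < L) (x : ℝ) :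
    a.clamp x ∈ a.dom := by
  cases a with
  | bounded i k L =>
    have hL := h i k L rfl
    exact ⟨le_max_left _ _, max_le hL.le (min_le_right _ _)⟩
  | outRay i => exact le_max_left (0 : ℝ) x
  | inRay i => exact min_le_right x (0 : ℝ)

theorem abs_clamp_sub_le (a : ArcShape V) (x y : ℝ) : |a.clamp x - a.clamp y| ≤ |x - y| := by
  cases a with
  | bounded i k L =>
    calc |max 0 (min x L) - max 0 (min y L)| ≤ |min x L - min y L| := by
          simpa using abs_max_sub_max_le_max 0 (min x L) 0 (min y L)
      _ ≤ |x - y| := by simpa using abs_min_sub_min_le_max x L y L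
  | outRay i => simpa [clamp] using abs_max_sub_max_le_max 0 x 0 y
  | inRay i => simpa [clamp] using abs_min_sub_min_le_max x 0 y 0

end ArcShape

namespace Network

variable {V J : Type*} {d : ℕ} {N : Network V J d} {v : J → ℝ → ℝ}

theorem IsVelocity.exists_isCurve (hv : N.IsVelocity v) (j : J) (x : ℝ) {τ : ℝ} (hτ : 0 ≤ τ) :
    ∃ c, IsCurve (N.extVelocity v j) x τ c := by
  obtain ⟨M, hM, hb⟩ := hv.bounded
  obtain ⟨K, hK⟩ := hv.lipschitz
  have hmem : ∀ y, (N.arc j).clamp y ∈ (N.arc j).dom :=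
    (N.arc j).clamp_mem (N.length_pos j)
  have hP : IsPicardLindelof (fun _ : ℝ => N.extVelocity v j)
      (⟨0, left_mem_Icc.2 hτ⟩ : Icc (0 : ℝ) τ) x (M.toNNReal * τ.toNNReal) 0 M.toNNReal K := by
    refine ⟨fun t _ => ?_, fun y _ => continuousOn_const, fun t _ y _ => ?_, ?_⟩
    · refine LipschitzOnWith.of_dist_le_mul fun y _ z _ => ?_
      refine ((hK j).dist_le_mul _ (hmem y) _ (hmem z)).trans ?_
      rw [Real.dist_eq, Real.dist_eq]
      exact mul_le_mul_of_nonneg_left ((N.arc j).abs_clamp_sub_le y z) K.coe_nonneg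
    · have h0 : 0 ≤ N.extVelocity v j y := hv.nonneg j _ (hmem y)
      rw [Real.norm_of_nonneg h0, Real.coe_toNNReal _ hM.le]
      exact hb j _ (hmem y)
    · simp [hM.le, hτ]
  obtain ⟨c, hc, hc'⟩ := hP.exists_eq_forall_mem_Icc_hasDerivWithinAt₀
  exact ⟨c, hc, hc'⟩

/-- The flow map on an arc is given by a solution of the differential equation. -/
theorem IsVelocity.arcFlow_spec (hv : N.IsVelocity v) (j : J) (x : ℝ) {s t : ℝ} (hst : s ≤ t) :
    ∃ c, IsCurve (N.extVelocity v j) x (t - s) c ∧ c (t - s) = N.arcFlow v j x s t := by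
  obtain ⟨c, hc⟩ := hv.exists_isCurve j x (sub_nonneg.2 hst)
  exact Classical.epsilon_spec
    (p := fun y => ∃ c, IsCurve (N.extVelocity v j) x (t - s) c ∧ c (t - s) = y) ⟨_, c, hc, rfl⟩

end Network

/-! The analysis takes place on one arc at a time. Extended past the ends of the arc by constants,
the velocity generates a semiflow `Φ` on the line. The mass on the arc at time `t`, together with
the mass that has left it and is carried on from the end `L` by the extended field, is the image
under `Φ` of everything that has entered by time `t`, initially or through the trace at `0`
(`ae_representation`, and `representation` at time `T`). This is proved by duality, testing with
`η(t) φ(Φ_{T-t}(x))`. For a Lipschitz field this function need not be `C^1`, so the field `u` is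
replaced by `u + ε`. Its flow is a translation in the travel time coordinate, and its spatial
derivative is bounded uniformly in `ε`, so the error is `O(ε)` (`exists_dual_approx`).

Restricted to the left of `L`, the representation gives the mass still on the arc (`stay`). On `[L,
∞)` the motion is uniform, so the position reveals the time at which `L` was crossed, and the
outgoing trace is the law of the exit times up to an atom at time `T` (`out_add_dirac_eq_exitLaw`).
If the velocity vanishes at `L`, no mass gets there, by backward uniqueness and the assumption on
`m₀`.

On the network, fix `t` and a Borel set `B`. The function `(x, s) ↦ pathSum j x s t B` is at most
`1` and satisfies a recursion at the first junction. Its integral over the entries of an arc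
therefore splits into the mass of `B` still on that arc and integrals over the following arcs
against the exit law (`lintegral_pathSum_split`). After summation over the arcs, the transmission
conditions turn the latter into the integrals over the traces entering at the inner vertices. These
are finite, occur on both sides and cancel, which leaves the initial and source data against `stay`
(`pushForward_apply_eq`). There is no induction in time, and no bound on the number of junctions is
used. The network-wide balance serves only to identify the entering traces at the sources with the
data.

Finally `stay` is right continuous in time, which gives the traces for `t < T`. The possible atom at
time `T` is harmless, since it sits at a vertex whichever arc it is attributed to. -/

/-! ### Semiflows of Lipschitz fields on the line -/

/-- A nonnegative, bounded, Lipschitz continuous vector field on the line. -/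
structure IsLineField (u : ℝ → ℝ) (K : NNReal) (M : ℝ) : Prop where
  lipschitz : LipschitzWith K u
  nonneg : ∀ x, 0 ≤ u x
  le : ∀ x, u x ≤ M

/-- `Φ r x` is the value at time `r ≥ 0` of the solution of `c' = u(c)`, `c(0) = x`; it is
continued by `Φ r x = x` to negative times. -/
structure IsSemiflow (u : ℝ → ℝ) (Φ : ℝ → ℝ → ℝ) : Prop where
  of_nonpos : ∀ r ≤ 0, ∀ x, Φ r x = x
  deriv : ∀ x, ∀ r, 0 ≤ r → HasDerivWithinAt (fun r => Φ r x) (u (Φ r x)) (Ici 0) r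

namespace IsSemiflow

variable {u : ℝ → ℝ} {K : NNReal} {M : ℝ} {Φ : ℝ → ℝ → ℝ}

theorem zero (hΦ : IsSemiflow u Φ) (x : ℝ) : Φ 0 x = x := hΦ.of_nonpos 0 le_rfl x

theorem continuousOn (hΦ : IsSemiflow u Φ) (x : ℝ) : ContinuousOn (fun r => Φ r x) (Ici 0) :=
  fun r hr => (hΦ.deriv x r hr).continuousWithinAt

theorem deriv_right (hΦ : IsSemiflow u Φ) (x : ℝ) {r : ℝ} (hr : 0 ≤ r) :
    HasDerivWithinAt (fun r => Φ r x) (u (Φ r x)) (Ici r) r :=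
  (hΦ.deriv x r hr).mono (Ici_subset_Ici.2 hr)

theorem deriv_left (hΦ : IsSemiflow u Φ) (x : ℝ) {r : ℝ} (hr : 0 < r) :
    HasDerivWithinAt (fun r => Φ r x) (u (Φ r x)) (Iic r) r :=
  ((hΦ.deriv x r hr.le).hasDerivAt (Ici_mem_nhds hr)).hasDerivWithinAt

theorem monotoneOn (hu : IsLineField u K M) (hΦ : IsSemiflow u Φ) (x : ℝ) :
    MonotoneOn (fun r => Φ r x) (Ici 0) := by
  refine monotoneOn_of_hasDerivWithinAt_nonneg (f' := fun r => u (Φ r x)) (convex_Ici 0)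
    (hΦ.continuousOn x) ?_ fun r _ => hu.nonneg _
  intro r hr
  rw [interior_Ici] at hr ⊢
  exact (hΦ.deriv x r (le_of_lt hr)).mono Ioi_subset_Ici_self

theorem dist_time_le (hu : IsLineField u K M) (hΦ : IsSemiflow u Φ) (x : ℝ) {r r' : ℝ}
    (hr : 0 ≤ r) (hr' : 0 ≤ r') : |Φ r' x - Φ r x| ≤ M * |r' - r| := by
  refine Convex.norm_image_sub_le_of_norm_hasDerivWithin_le (s := Ici (0 : ℝ))
    (f := fun r => Φ r x) (f' := fun r => u (Φ r x)) (fun r hr => hΦ.deriv x r hr)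
    (fun r _ => ?_) (convex_Ici 0) hr hr'
  rw [Real.norm_of_nonneg (hu.nonneg _)]
  exact hu.le _

theorem dist_le (hu : IsLineField u K M) (hΦ : IsSemiflow u Φ) (x y : ℝ) {r : ℝ} (hr : 0 ≤ r) :
    dist (Φ r x) (Φ r y) ≤ dist x y * Real.exp (K * r) := by
  have := dist_le_of_trajectories_ODE (v := fun _ => u) (K := K) (a := 0) (b := r)
    (f := fun r => Φ r x) (g := fun r => Φ r y) (δ := dist x y) (fun _ => hu.lipschitz)
    ((hΦ.continuousOn x).mono Icc_subset_Ici_self) (fun t ht => hΦ.deriv_right x ht.1)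
    ((hΦ.continuousOn y).mono Icc_subset_Ici_self) (fun t ht => hΦ.deriv_right y ht.1)
    (by simp [hΦ.zero]) r ⟨hr, le_rfl⟩
  simpa using this

/-- Uniqueness, in the form that serves both the semigroup law (with `c` a restarted trajectory) and
the explicit motion where the field is constant. -/
theorem eqOn_of_hasDerivWithinAt (hu : IsLineField u K M) (hΦ : IsSemiflow u Φ) {x a τ : ℝ}
    (ha : 0 ≤ a) {c : ℝ → ℝ} (hc0 : c 0 = Φ a x)
    (hc : ∀ r ∈ Icc 0 τ, HasDerivWithinAt c (u (c r)) (Icc 0 τ) r) :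
    ∀ r ∈ Icc 0 τ, c r = Φ (r + a) x := by
  have h2 : ∀ r, 0 ≤ r →
      HasDerivWithinAt (fun r => Φ (r + a) x) (u (Φ (r + a) x)) (Ici 0) r := by
    intro r hr
    have h := (hΦ.deriv x (r + a) (by linarith)).scomp (h' := 1) (h := fun r => r + a)
      (s := Ici 0) r ((hasDerivAt_id r).add_const a).hasDerivWithinAt
      (fun z (hz : 0 ≤ z) => by simp only [mem_Ici]; linarith)
    simpa [Function.comp_def] using h
  refine ODE_solution_unique_of_mem_Icc_right (v := fun _ => u) (s := fun _ => univ)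
    (fun _ _ => hu.lipschitz.lipschitzOnWith) (fun r hr => (hc r hr).continuousWithinAt)
    (fun r hr => ?_) (fun _ _ => trivial)
    (fun r hr => ((h2 r hr.1).continuousWithinAt.mono Icc_subset_Ici_self))
    (fun r hr => (h2 r hr.1).mono (Ici_subset_Ici.2 hr.1)) (fun _ _ => trivial) (by simp [hc0])
  refine (hc r ⟨hr.1, hr.2.le⟩).mono_of_mem_nhdsWithin ?_
  exact mem_of_superset (Icc_mem_nhdsGE hr.2) (Icc_subset_Icc_left hr.1)

theorem add (hu : IsLineField u K M) (hΦ : IsSemiflow u Φ) {a b : ℝ} (ha : 0 ≤ a) (hb : 0 ≤ b)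
    (x : ℝ) : Φ (b + a) x = Φ b (Φ a x) :=
  (hΦ.eqOn_of_hasDerivWithinAt hu ha (τ := b) (c := fun r => Φ r (Φ a x)) (hΦ.zero _)
    (fun r hr => (hΦ.deriv _ r hr.1).mono Icc_subset_Ici_self) b ⟨hb, le_rfl⟩).symm

/-- Uniqueness backward in time. It makes `Φ r` a measurable embedding, so that push-forwards along
it can be undone, and it shows that a rest point is not reached from elsewhere. -/
theorem injective (hu : IsLineField u K M) (hΦ : IsSemiflow u Φ) (r : ℝ) :
    Function.Injective (Φ r) := by
  intro x y hxy
  rcases le_total r 0 with hr | hr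
  · simpa [hΦ.of_nonpos r hr] using hxy
  have := ODE_solution_unique_of_mem_Icc_left (v := fun _ => u) (s := fun _ => univ)
    (f := fun r => Φ r x) (g := fun r => Φ r y) (a := 0) (b := r)
    (fun _ _ => hu.lipschitz.lipschitzOnWith)
    ((hΦ.continuousOn x).mono Icc_subset_Ici_self) (fun t ht => hΦ.deriv_left x ht.1)
    (fun _ _ => trivial)
    ((hΦ.continuousOn y).mono Icc_subset_Ici_self) (fun t ht => hΦ.deriv_left y ht.1)
    (fun _ _ => trivial) hxy ⟨le_rfl, hr⟩
  simpa [hΦ.zero] using this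

theorem continuous_uncurry (hu : IsLineField u K M) (hΦ : IsSemiflow u Φ) :
    Continuous (fun q : ℝ × ℝ => Φ q.1 q.2) := by
  have hmax : ∀ r x, Φ r x = Φ (max r 0) x := by
    intro r x
    rcases le_total r 0 with hr | hr
    · rw [max_eq_right hr, hΦ.of_nonpos r hr, hΦ.zero]
    · rw [max_eq_left hr]
  rw [continuous_iff_continuousAt]
  rintro ⟨r, x⟩
  refine tendsto_iff_dist_tendsto_zero.2 ?_
  have hlim : Tendsto (fun q : ℝ × ℝ => dist q.2 x * Real.exp (K * max q.1 0)
      + M * |max q.1 0 - max r 0|) (𝓝 (r, x)) (𝓝 0) := by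
    have : Continuous (fun q : ℝ × ℝ => dist q.2 x * Real.exp (K * max q.1 0)
      + M * |max q.1 0 - max r 0|) := by fun_prop
    simpa using this.tendsto (r, x)
  refine squeeze_zero (fun _ => dist_nonneg) (fun q => ?_) hlim
  simp only
  rw [hmax q.1, hmax r]
  refine (dist_triangle _ (Φ (max q.1 0) x) _).trans (add_le_add ?_ ?_)
  · exact hΦ.dist_le hu _ _ (le_max_right _ _)
  · exact hΦ.dist_time_le hu x (le_max_right _ _) (le_max_right _ _)

/-- Grönwall's inequality with defect `ε`. Applied to the flow of `u + ε`, it gives convergence to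
`Φ` as `ε → 0`. -/
theorem dist_approx_le (hu : IsLineField u K M) (hΦ : IsSemiflow u Φ) {ε r : ℝ} {u' : ℝ → ℝ}
    (hu' : ∀ x, |u' x - u x| ≤ ε) {x : ℝ} {c : ℝ → ℝ} (hc0 : c 0 = x) (hr : 0 ≤ r)
    (hc : ∀ r, HasDerivAt c (u' (c r)) r) :
    dist (c r) (Φ r x) ≤ gronwallBound 0 K ε r := by
  have := dist_le_of_approx_trajectories_ODE (v := fun _ => u) (K := K) (a := 0) (b := r)
    (f := c) (g := fun r => Φ r x) (f' := fun r => u' (c r)) (g' := fun r => u (Φ r x))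
    (δ := 0) (εf := ε) (εg := 0) (fun _ => hu.lipschitz)
    (fun r _ => (hc r).continuousAt.continuousWithinAt) (fun r _ => (hc r).hasDerivWithinAt)
    (fun r _ => by rw [Real.dist_eq]; exact hu' _)
    ((hΦ.continuousOn x).mono Icc_subset_Ici_self) (fun t ht => hΦ.deriv_right x ht.1)
    (fun r _ => by simp)
    (by simp [hΦ.zero, hc0]) r ⟨hr, le_rfl⟩
  simpa using this

/-- Along a half-line on which the field is constant the motion is uniform. -/
theorem eq_add_of_const (hu : IsLineField u K M) (hΦ : IsSemiflow u Φ) {L : ℝ}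
    (hL : ∀ y, L ≤ y → u y = u L) {r : ℝ} (hr : 0 ≤ r) : Φ r L = L + r * u L := by
  have := hΦ.eqOn_of_hasDerivWithinAt hu (x := L) (a := 0) (τ := r) le_rfl
    (c := fun r => L + r * u L) (by simp [hΦ.zero]) (fun q hq => ?_) r ⟨hr, le_rfl⟩
  · simpa using this.symm
  · rw [hL (L + q * u L) (by nlinarith [hu.nonneg L, hq.1])]
    have := ((hasDerivAt_id q).mul_const (u L)).const_add L
    simpa using this.hasDerivWithinAt

end IsSemiflow

/-! ### Hitting times -/

/-- The first time at which the semiflow is at `L`, when started at `x` (`0` if it never is). -/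
noncomputable def hitTime (Φ : ℝ → ℝ → ℝ) (L x : ℝ) : ℝ := sInf {r | 0 ≤ r ∧ Φ r x = L}

namespace IsSemiflow

variable {u : ℝ → ℝ} {K : NNReal} {M : ℝ} {Φ : ℝ → ℝ → ℝ} {L : ℝ}

theorem continuous_time (hu : IsLineField u K M) (hΦ : IsSemiflow u Φ) (x : ℝ) :
    Continuous (fun r => Φ r x) :=
  (hΦ.continuous_uncurry hu).comp (by fun_prop : Continuous fun r : ℝ => (r, x))

theorem continuous_pos (hu : IsLineField u K M) (hΦ : IsSemiflow u Φ) (r : ℝ) :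
    Continuous (Φ r) :=
  (hΦ.continuous_uncurry hu).comp (by fun_prop : Continuous fun x : ℝ => (r, x))

theorem self_le (hu : IsLineField u K M) (hΦ : IsSemiflow u Φ) (r x : ℝ) : x ≤ Φ r x := by
  rcases le_total r 0 with hr | hr
  · rw [hΦ.of_nonpos r hr]
  · simpa [hΦ.zero] using hΦ.monotoneOn hu x (mem_Ici.2 (le_refl 0)) hr hr

/-- Trajectories are continuous and nondecreasing. By the intermediate value theorem, reaching `L`
by time `t` depends only on the positions at times `0` and `t`, which makes the condition
measurable. -/
theorem exists_hit_iff (hu : IsLineField u K M) (hΦ : IsSemiflow u Φ) {t x : ℝ} :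
    (∃ r, (0 ≤ r ∧ Φ r x = L) ∧ r ≤ t) ↔ 0 ≤ t ∧ x ≤ L ∧ L ≤ Φ t x := by
  constructor
  · rintro ⟨r, ⟨hr, h⟩, hrt⟩
    exact ⟨hr.trans hrt, h ▸ hΦ.self_le hu r x, h ▸ hΦ.monotoneOn hu x hr (hr.trans hrt) hrt⟩
  · rintro ⟨ht, hx, hL⟩
    obtain ⟨r, hr, h⟩ := intermediate_value_Icc ht (hΦ.continuous_time hu x).continuousOn
      (show L ∈ Icc (Φ 0 x) (Φ t x) from ⟨by rwa [hΦ.zero], hL⟩)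
    exact ⟨r, ⟨hr.1, h⟩, hr.2⟩

theorem hitTime_nonneg (Φ : ℝ → ℝ → ℝ) (L x : ℝ) : 0 ≤ hitTime Φ L x :=
  Real.sInf_nonneg fun _ h => h.1

theorem hitTime_le {r x : ℝ} (hr : 0 ≤ r) (h : Φ r x = L) : hitTime Φ L x ≤ r :=
  csInf_le ⟨0, fun _ h => h.1⟩ ⟨hr, h⟩

theorem flow_hitTime (hu : IsLineField u K M) (hΦ : IsSemiflow u Φ) {r x : ℝ}
    (hr : 0 ≤ r) (h : Φ r x = L) : Φ (hitTime Φ L x) x = L := by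
  have hcl : IsClosed {r | 0 ≤ r ∧ Φ r x = L} :=
    (isClosed_le continuous_const continuous_id).inter
      (isClosed_eq (hΦ.continuous_time hu x) continuous_const)
  exact (hcl.csInf_mem ⟨r, hr, h⟩ ⟨0, fun _ h => h.1⟩).2

theorem hit_by_iff (hu : IsLineField u K M) (hΦ : IsSemiflow u Φ) {t x : ℝ} (hx : x ≤ L)
    (ht : 0 ≤ t) : L ≤ Φ t x ↔ hitTime Φ L x ≤ t ∧ Φ (hitTime Φ L x) x = L := by
  constructor
  · intro h
    obtain ⟨r, ⟨hr, h⟩, hrt⟩ := (hΦ.exists_hit_iff hu).2 ⟨ht, hx, h⟩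
    exact ⟨(hitTime_le hr h).trans hrt, hΦ.flow_hitTime hu hr h⟩
  · rintro ⟨h1, h2⟩
    exact ((hΦ.exists_hit_iff hu).1 ⟨_, ⟨hitTime_nonneg _ _ _, h2⟩, h1⟩).2.2

/-- Past `L` the motion is uniform. If `u L > 0`, the position at a later time therefore determines
the hitting time. -/
theorem flow_after_hit (hu : IsLineField u K M) (hΦ : IsSemiflow u Φ)
    (hL : ∀ y, L ≤ y → u y = u L) {t x : ℝ} (h : hitTime Φ L x ≤ t)
    (h' : Φ (hitTime Φ L x) x = L) : Φ t x = L + (t - hitTime Φ L x) * u L := by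
  have := hΦ.add hu (hitTime_nonneg Φ L x) (sub_nonneg.2 h) x
  rw [sub_add_cancel] at this
  rw [this, h', hΦ.eq_add_of_const hu hL (sub_nonneg.2 h)]

/-- A zero of the field at `L` is a rest point, and by injectivity of the flow only the trajectory
at rest meets it. -/
theorem eq_of_flow_eq (hu : IsLineField u K M) (hΦ : IsSemiflow u Φ)
    (hL : ∀ y, L ≤ y → u y = u L) (h0 : u L = 0) {r x : ℝ} (h : Φ r x = L) : x = L := by
  refine hΦ.injective hu r ?_
  rw [h]
  rcases le_total r 0 with hr | hr
  · rw [hΦ.of_nonpos r hr]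
  · simp [hΦ.eq_add_of_const hu hL hr, h0]

theorem measurable_hitTime (hu : IsLineField u K M) (hΦ : IsSemiflow u Φ) :
    Measurable (hitTime Φ L) := by
  refine measurable_of_Iic fun c => ?_
  have hm : ∀ c, MeasurableSet {x | x ≤ L ∧ L ≤ Φ c x} := fun c =>
    measurableSet_Iic.inter (measurableSet_le measurable_const (hΦ.continuous_pos hu c).measurable)
  rcases lt_or_ge c 0 with hc | hc
  · convert MeasurableSet.empty
    ext x
    simp only [mem_preimage, mem_Iic, mem_empty_iff_false, iff_false, not_le]
    exact hc.trans_le (hitTime_nonneg _ _ _)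
  -- Points that never hit have `hitTime` equal to `sInf ∅ = 0`, so they belong to every sublevel
  -- set with `c ≥ 0`. They are the complement of the union over the integer times.
  · have : hitTime Φ L ⁻¹' Iic c
        = {x | x ≤ L ∧ L ≤ Φ c x} ∪ (⋃ n : ℕ, {x | x ≤ L ∧ L ≤ Φ n x})ᶜ := by
      ext x
      simp only [mem_preimage, mem_Iic, mem_union, mem_ofPred_eq, mem_compl_iff, mem_iUnion]
      by_cases hx : ∃ r, 0 ≤ r ∧ Φ r x = L
      · obtain ⟨r, hr, h⟩ := hx
        have hxL : x ≤ L := h ▸ hΦ.self_le hu r x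
        have hn : ∃ n : ℕ, x ≤ L ∧ L ≤ Φ n x := by
          obtain ⟨n, hn⟩ := exists_nat_ge r
          exact ⟨n, ((hΦ.exists_hit_iff hu).1 ⟨r, ⟨hr, h⟩, hn⟩).2⟩
        simp only [hn, not_true, or_false]
        rw [hΦ.hit_by_iff hu hxL hc]
        simp [hxL, hΦ.flow_hitTime hu hr h]
      · have h1 : ¬ ∃ n : ℕ, x ≤ L ∧ L ≤ Φ n x := by
          rintro ⟨n, h1, h2⟩
          obtain ⟨r, h, -⟩ := (hΦ.exists_hit_iff hu).2 ⟨n.cast_nonneg, h1, h2⟩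
          exact hx ⟨r, h⟩
        have h2 : hitTime Φ L x = 0 := by
          have : {r | 0 ≤ r ∧ Φ r x = L} = ∅ := by
            ext r
            simpa using fun h => fun h' => hx ⟨r, h, h'⟩
          simp [hitTime, this]
        simp [h1, h2, hc]
    rw [this]
    exact (hm c).union (MeasurableSet.iUnion fun n : ℕ => hm (n : ℝ)).compl

end IsSemiflow

/-! ### Regularized flows -/

namespace IsLineField

variable {u : ℝ → ℝ} {K : NNReal} {M : ℝ} {Φ : ℝ → ℝ → ℝ}

/-- The flow of the positive field `u + ε` is of class `C^1`, being a translation in the travel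
time coordinate `∫ dx / (u + ε)`. -/
theorem exists_regular_flow (hu : IsLineField u K M) {ε : ℝ} (hε : 0 < ε) :
    ∃ Ψ : ℝ → ℝ → ℝ, ContDiff ℝ 1 (fun q : ℝ × ℝ => Ψ q.1 q.2) ∧ (∀ x, Ψ 0 x = x) ∧
      (∀ r x, HasDerivAt (fun r => Ψ r x) (u (Ψ r x) + ε) r) ∧
      ∀ r x, HasDerivAt (fun x => Ψ r x) ((u (Ψ r x) + ε) / (u x + ε)) x := by
  have hpos : ∀ x, 0 < u x + ε := fun x => by linarith [hu.nonneg x]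
  have hcont : Continuous fun x => (u x + ε)⁻¹ :=
    (hu.lipschitz.continuous.add continuous_const).inv₀ fun x => (hpos x).ne'
  have hM : 0 ≤ M := (hu.nonneg 0).trans (hu.le 0)
  set G : ℝ → ℝ := fun x => ∫ y in (0 : ℝ)..x, (u y + ε)⁻¹ with hG
  have hGd : ∀ x, HasDerivAt G (u x + ε)⁻¹ x := fun x =>
    (hcont.integral_hasStrictDerivAt 0 x).hasDerivAt
  have hGmono : StrictMono G := strictMono_of_hasDerivAt_pos hGd fun x => inv_pos.2 (hpos x)
  have hGc : Continuous G := continuous_iff_continuousAt.2 fun x => (hGd x).continuousAt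
  -- Since `G' ≥ (M + ε)⁻¹`, the function `G` grows at least linearly and covers the line.
  have hmono : Monotone fun x => G x - x * (M + ε)⁻¹ := by
    refine monotone_of_hasDerivAt_nonneg (f' := fun x => (u x + ε)⁻¹ - (M + ε)⁻¹)
      (fun x => ?_) fun x => ?_
    · simpa using (hGd x).fun_sub ((hasDerivAt_id x).mul_const (M + ε)⁻¹)
    · exact sub_nonneg.2 (inv_anti₀ (hpos x) (by linarith [hu.le x]))
  have hG0 : G 0 = 0 := by simp [hG]
  have hMε : 0 < (M + ε)⁻¹ := by positivity
  have hsurj : Function.Surjective G := by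
    refine hGc.surjective ?_ ?_
    · refine tendsto_atTop_mono' atTop ?_ (tendsto_id.atTop_mul_const hMε)
      filter_upwards [eventually_ge_atTop 0] with x hx
      have := hmono hx
      simp only [hG0] at this
      simp only [id]
      linarith
    · refine tendsto_atBot_mono' atBot ?_ (tendsto_id.atBot_mul_const hMε)
      filter_upwards [eventually_le_atBot 0] with x hx
      have := hmono hx
      simp only [hG0] at this
      simp only [id]
      linarith
  set e : ℝ ≃ₜ ℝ := (hGmono.orderIsoOfSurjective G hsurj).toHomeomorph with he
  have heG : ⇑e = G := by ext x; rfl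
  have hG1 : ContDiff ℝ 1 G := by
    rw [contDiff_one_iff_deriv]
    refine ⟨fun x => (hGd x).differentiableAt, ?_⟩
    rwa [show deriv G = fun x => (u x + ε)⁻¹ from funext fun x => (hGd x).deriv]
  have heD : ∀ x, HasDerivAt e (u x + ε)⁻¹ x := fun x => by rw [heG]; exact hGd x
  have hH1 : ContDiff ℝ 1 e.symm :=
    e.contDiff_symm_deriv (fun x => (inv_pos.2 (hpos x)).ne') heD (by rw [heG]; exact hG1)
  have hHd : ∀ y, HasDerivAt e.symm (u (e.symm y) + ε) y := by
    intro y
    have := HasDerivAt.of_local_left_inverse (f := e) (g := e.symm) (a := y)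
      e.symm.continuous.continuousAt (heD (e.symm y)) (inv_pos.2 (hpos _)).ne'
      (Eventually.of_forall fun z => e.apply_symm_apply z)
    simpa using this
  refine ⟨fun r x => e.symm (e x + r), ?_, fun x => by simp, fun r x => ?_, fun r x => ?_⟩
  · have : ContDiff ℝ 1 e := by rw [heG]; exact hG1
    exact hH1.comp ((this.comp contDiff_snd).add contDiff_fst)
  · exact ((hHd (e x + r)).comp_const_add (e x) r)
  · have := (hHd (e x + r)).comp x ((heD x).add_const r)
    simpa [Function.comp_def, div_eq_mul_inv] using this

/-- Finite speed of propagation, which keeps the supports of the dual test functions compact. -/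
theorem abs_flow_sub_le (hu : IsLineField u K M) {ε : ℝ} (hε : 0 < ε) {Ψ : ℝ → ℝ → ℝ}
    (h0 : ∀ x, Ψ 0 x = x) (ht : ∀ r x, HasDerivAt (fun r => Ψ r x) (u (Ψ r x) + ε) r) (r x : ℝ) :
    |Ψ r x - x| ≤ (M + ε) * |r| := by
  have := Convex.norm_image_sub_le_of_norm_hasDerivWithin_le (s := univ)
    (f := fun r => Ψ r x) (f' := fun r => u (Ψ r x) + ε) (C := M + ε)
    (fun r _ => (ht r x).hasDerivWithinAt) (fun r _ => ?_) convex_univ (mem_univ 0) (mem_univ r)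
  · simpa [h0] using this
  · rw [Real.norm_of_nonneg (by linarith [hu.nonneg (Ψ r x)])]
    linarith [hu.le (Ψ r x)]

/-- The quotient is the spatial derivative of `Ψ r`, and by Grönwall's inequality `Ψ r` has a
Lipschitz constant that does not involve `ε`. The formula alone would not show this near the zeros
of `u`. -/
theorem deriv_flow_le (hu : IsLineField u K M) {ε : ℝ} {Ψ : ℝ → ℝ → ℝ}
    (h0 : ∀ x, Ψ 0 x = x) (ht : ∀ r x, HasDerivAt (fun r => Ψ r x) (u (Ψ r x) + ε) r)
    (hx : ∀ r x, HasDerivAt (fun x => Ψ r x) ((u (Ψ r x) + ε) / (u x + ε)) x)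
    {r : ℝ} (hr : 0 ≤ r) (x : ℝ) :
    |(u (Ψ r x) + ε) / (u x + ε)| ≤ Real.exp (K * r) := by
  have hlip : ∀ y, dist (Ψ r y) (Ψ r x) ≤ dist y x * Real.exp (K * r) := by
    intro y
    have := dist_le_of_trajectories_ODE (v := fun _ x => u x + ε) (K := K) (a := 0) (b := r)
      (f := fun r => Ψ r y) (g := fun r => Ψ r x) (δ := dist y x)
      (fun _ => by simpa using hu.lipschitz.add (LipschitzWith.const ε))
      (fun r _ => (ht r y).continuousAt.continuousWithinAt)
      (fun r _ => (ht r y).hasDerivWithinAt)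
      (fun r _ => (ht r x).continuousAt.continuousWithinAt)
      (fun r _ => (ht r x).hasDerivWithinAt) (by simp [h0]) r ⟨hr, le_rfl⟩
    simpa using this
  rw [← Real.norm_eq_abs]
  refine (hx r x).le_of_lip' (Real.exp_nonneg _) (Eventually.of_forall fun y => ?_)
  have := hlip y
  rwa [dist_eq_norm, dist_eq_norm, mul_comm] at this

end IsLineField

/-! ### A countable family of test functions determining finite measures -/

/-- Smooth bump functions supported in `[a, b]`, which converge to the indicator of `(a, b)` as
`n → ∞`. -/
noncomputable def intervalBump (a b : ℝ) (n : ℕ) (x : ℝ) : ℝ :=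
  if h : a < b then
    -- With `n + 2` the inner radius is positive already for `n = 0`.
    (⟨(b - a) / 2 * (1 - 1 / (n + 2)), (b - a) / 2, by
      have h1 : (0 : ℝ) < 1 - 1 / (n + 2) := by
        rw [sub_pos, div_lt_one (by positivity)]; linarith [n.cast_nonneg (α := ℝ)]
      have : 0 < b - a := sub_pos.2 h
      positivity, by
      have h1 : (0 : ℝ) < 1 / (n + 2) := by positivity
      nlinarith [sub_pos.2 h]⟩ : ContDiffBump ((a + b) / 2)) x
  else 0

theorem contDiff_intervalBump (a b : ℝ) (n : ℕ) {k : ℕ∞} : ContDiff ℝ k (intervalBump a b n) := by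
  unfold intervalBump
  split_ifs
  · exact ContDiffBump.contDiff _
  · exact contDiff_const

theorem hasCompactSupport_intervalBump (a b : ℝ) (n : ℕ) :
    HasCompactSupport (intervalBump a b n) := by
  unfold intervalBump
  split_ifs
  · exact ContDiffBump.hasCompactSupport _
  · exact HasCompactSupport.zero

theorem abs_intervalBump_le (a b : ℝ) (n : ℕ) (x : ℝ) : |intervalBump a b n x| ≤ 1 := by
  unfold intervalBump
  split_ifs
  · rw [abs_of_nonneg (ContDiffBump.nonneg _)]
    exact ContDiffBump.le_one _
  · simp

theorem tendsto_intervalBump (a b x : ℝ) :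
    Tendsto (fun n => intervalBump a b n x) atTop (𝓝 ((Ioo a b).indicator (fun _ => 1) x)) := by
  by_cases h : a < b
  swap
  · simp [intervalBump, h]
  have hlim : Tendsto (fun n : ℕ => (b - a) / 2 * (1 - 1 / ((n : ℝ) + 2))) atTop
      (𝓝 ((b - a) / 2 * (1 - 0))) := by
    refine (tendsto_const_nhds.sub ?_).const_mul _
    refine tendsto_const_nhds.div_atTop ?_
    exact tendsto_atTop_add_const_right _ _ tendsto_natCast_atTop_atTop
  rw [sub_zero, mul_one] at hlim
  have hball : Metric.ball ((a + b) / 2) ((b - a) / 2) = Ioo a b := by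
    rw [Real.ball_eq_Ioo]; congr 1 <;> ring
  by_cases hx : x ∈ Ioo a b
  · rw [indicator_of_mem hx]
    refine tendsto_const_nhds.congr' ?_
    rw [← hball, Metric.mem_ball] at hx
    filter_upwards [hlim.eventually (lt_mem_nhds hx)] with n hn
    simp only [intervalBump, h, dif_pos]
    exact (ContDiffBump.one_of_mem_closedBall _ (Metric.mem_closedBall.2 (le_of_lt hn))).symm
  · rw [indicator_of_notMem hx]
    refine tendsto_const_nhds.congr fun n => ?_
    simp only [intervalBump, h, dif_pos]
    rw [← hball, Metric.mem_ball, not_lt] at hx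
    exact (ContDiffBump.zero_of_le_dist _ hx).symm

theorem tendsto_integral_intervalBump (μ : Measure ℝ) [IsFiniteMeasure μ] (a b : ℝ) :
    Tendsto (fun n => ∫ x, intervalBump a b n x ∂μ) atTop (𝓝 (μ.real (Ioo a b))) := by
  have : μ.real (Ioo a b) = ∫ x, (Ioo a b).indicator (fun _ => (1 : ℝ)) x ∂μ := by
    rw [integral_indicator measurableSet_Ioo]; simp
  rw [this]
  refine tendsto_integral_of_dominated_convergence (fun _ => 1) (fun n => ?_)
    (integrable_const 1) (fun n => Eventually.of_forall fun x => ?_)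
    (Eventually.of_forall fun x => tendsto_intervalBump a b x)
  · exact (contDiff_intervalBump a b n (k := 0)).continuous.aestronglyMeasurable
  · exact abs_intervalBump_le a b n x

/-- Finite measures on the line are determined by countably many smooth test functions. -/
theorem measure_ext_intervalBump {μ ν : Measure ℝ} [IsFiniteMeasure μ] [IsFiniteMeasure ν]
    (h : ∀ (a b : ℚ) (n : ℕ), ∫ x, intervalBump a b n x ∂μ = ∫ x, intervalBump a b n x ∂ν) :
    μ = ν := by
  refine Real.measure_ext_Ioo_rat fun a b => ?_
  have h1 := tendsto_integral_intervalBump μ a b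
  simp only [h a b] at h1
  exact (measureReal_eq_measureReal_iff).1
    (tendsto_nhds_unique h1 (tendsto_integral_intervalBump ν a b))

theorem measure_ext_of_contDiff {μ ν : Measure ℝ} [IsFiniteMeasure μ] [IsFiniteMeasure ν]
    (h : ∀ φ : ℝ → ℝ, ContDiff ℝ 1 φ → HasCompactSupport φ → ∫ x, φ x ∂μ = ∫ x, φ x ∂ν) :
    μ = ν :=
  measure_ext_intervalBump fun a b n =>
    h _ (contDiff_intervalBump a b n) (hasCompactSupport_intervalBump a b n)

/-! ### Measurability in time of integrals against `m t` -/

/-- Integrals of bounded continuous functions depend measurably on the measure and on a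
parameter. -/
theorem measurable_integral_param {F : ℝ → ℝ → ℝ} (hF : Continuous (fun q : ℝ × ℝ => F q.1 q.2))
    {C : ℝ} (hC : ∀ x t, |F x t| ≤ C) :
    Measurable (fun q : ℝ × Measure ℝ =>
      if q.2 univ < ⊤ then ∫ x, F x q.1 ∂q.2 else 0) := by
  have := measurable_uncurry_of_continuous_of_measurable (m := Measure.instMeasurableSpace)
    (u := fun (t : ℝ) (μ : Measure ℝ) => if μ univ < ⊤ then ∫ x, F x t ∂μ else 0) ?_ ?_
  · exact this
  · intro μ
    by_cases hμ : μ univ < ⊤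
    · have : IsFiniteMeasure μ := ⟨hμ⟩
      simp only [hμ, if_true]
      refine continuous_of_dominated (bound := fun _ => C) (fun t => ?_)
        (fun t => Eventually.of_forall fun x => hC x t) (integrable_const C)
        (Eventually.of_forall fun x => ?_)
      · exact (hF.comp (by fun_prop : Continuous fun x : ℝ => (x, t))).aestronglyMeasurable
      · exact hF.comp (by fun_prop : Continuous fun t : ℝ => (x, t))
    · simp only [hμ, if_false]
      exact continuous_const
  · intro t
    have hFt : Continuous fun x => F x t :=
      hF.comp (by fun_prop : Continuous fun x : ℝ => (x, t))
    -- Adding `C` makes the integrand nonnegative, so that the integral becomes a lower Lebesgue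
    -- integral, which is measurable in the measure.
    have heq : (fun μ : Measure ℝ => if μ univ < ⊤ then ∫ x, F x t ∂μ else 0)
        = fun μ => if μ univ < ⊤ then
          (∫⁻ x, ENNReal.ofReal (F x t + C) ∂μ).toReal - C * (μ univ).toReal else 0 := by
      ext μ
      split_ifs with hμ
      · have : IsFiniteMeasure μ := ⟨hμ⟩
        have hint : Integrable (fun x => F x t) μ :=
          Integrable.of_bound hFt.aestronglyMeasurable C (Eventually.of_forall fun x => hC x t)
        rw [← integral_eq_lintegral_of_nonneg_ae (f := fun x => F x t + C)
          (Eventually.of_forall fun x => by simp only [Pi.zero_apply]; linarith [abs_le.1 (hC x t)])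
          (hFt.add continuous_const).aestronglyMeasurable,
          integral_add hint (integrable_const C), integral_const, smul_eq_mul, Measure.real]
        ring
      · rfl
    rw [heq]
    refine Measurable.ite ?_ ?_ measurable_const
    · exact measurableSet_lt (Measure.measurable_coe MeasurableSet.univ) measurable_const
    · refine Measurable.sub ?_ ?_
      · exact (Measure.measurable_lintegral
          (hFt.add continuous_const).measurable.ennreal_ofReal).ennreal_toReal
      · exact ((Measure.measurable_coe MeasurableSet.univ).ennreal_toReal).const_mul C

section

variable {T : ℝ} {m : ℝ → Measure ℝ}

theorem aestronglyMeasurable_integral_param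
    (hm : AEMeasurable m (volume.restrict (Icc 0 T)))
    (hfin : ∀ t ∈ Icc 0 T, IsFiniteMeasure (m t))
    {F : ℝ → ℝ → ℝ} (hF : Continuous (fun q : ℝ × ℝ => F q.1 q.2))
    {C : ℝ} (hC : ∀ x t, |F x t| ≤ C) :
    AEStronglyMeasurable (fun t => ∫ x, F x t ∂(m t)) (volume.restrict (Icc 0 T)) := by
  have h1 := (measurable_integral_param hF hC).comp_aemeasurable (aemeasurable_id.prodMk hm)
  refine h1.aestronglyMeasurable.congr ?_
  filter_upwards [ae_restrict_mem measurableSet_Icc] with t ht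
  have := hfin t ht
  simp [measure_lt_top]

theorem integrable_mass (hm : AEMeasurable m (volume.restrict (Icc 0 T)))
    (hmass : ∫⁻ t in Icc 0 T, m t univ < ⊤) :
    Integrable (fun t => (m t).real univ) (volume.restrict (Icc 0 T)) :=
  integrable_toReal_of_lintegral_ne_top
    ((Measure.measurable_coe MeasurableSet.univ).comp_aemeasurable hm) hmass.ne

theorem abs_integral_le_mass {μ : Measure ℝ} [IsFiniteMeasure μ] {f : ℝ → ℝ} {C : ℝ}
    (hC : ∀ᵐ x ∂μ, |f x| ≤ C) : |∫ x, f x ∂μ| ≤ C * μ.real univ := by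
  rw [← Real.norm_eq_abs]
  exact norm_integral_le_of_norm_le_const (by simpa only [Real.norm_eq_abs] using hC)

theorem integrable_integral_param
    (hm : AEMeasurable m (volume.restrict (Icc 0 T)))
    (hfin : ∀ t ∈ Icc 0 T, IsFiniteMeasure (m t)) (hmass : ∫⁻ t in Icc 0 T, m t univ < ⊤)
    {F : ℝ → ℝ → ℝ} (hF : Continuous (fun q : ℝ × ℝ => F q.1 q.2))
    {C : ℝ} (hC : ∀ x t, |F x t| ≤ C) :
    Integrable (fun t => ∫ x, F x t ∂(m t)) (volume.restrict (Icc 0 T)) := by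
  refine ((integrable_mass hm hmass).const_mul C).mono'
    (aestronglyMeasurable_integral_param hm hfin hF hC) ?_
  filter_upwards [ae_restrict_mem measurableSet_Icc] with t ht
  have := hfin t ht
  exact abs_integral_le_mass (Eventually.of_forall fun x => hC x t)

end

/-! ### Solutions on the line and the dual problem -/

/-- A measure-valued solution of `∂_t m + ∂_x (u m) = 0` on a piece of the line, where mass enters
at `0` according to `νin` and leaves at `L` according to `νout`. -/
structure IsLineSolution (T : ℝ) (u : ℝ → ℝ) (L : ℝ) (m : ℝ → Measure ℝ)
    (m₀ νin νout : Measure ℝ) : Prop where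
  init_finite : IsFiniteMeasure m₀
  in_finite : IsFiniteMeasure νin
  out_finite : IsFiniteMeasure νout
  in_supported : νin (Icc 0 T)ᶜ = 0
  out_supported : νout (Icc 0 T)ᶜ = 0
  finite : ∀ t ∈ Icc 0 T, IsFiniteMeasure (m t)
  measurable : AEMeasurable m (volume.restrict (Icc 0 T))
  mass : ∫⁻ t in Icc 0 T, m t univ < ⊤
  balance : ∀ f : ℝ → ℝ → ℝ, ContDiff ℝ 1 (fun q : ℝ × ℝ => f q.1 q.2) →
    HasCompactSupport (fun q : ℝ × ℝ => f q.1 q.2) →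
    ∫ x, f x T ∂(m T) - ∫ x, f x 0 ∂m₀ - ∫ t, f 0 t ∂νin + ∫ t, f L t ∂νout
      = ∫ t in Icc 0 T, ∫ x, (deriv (fun s => f x s) t + u x * deriv (fun y => f y t) x) ∂(m t)

theorem exists_bound_of_hasCompactSupport {φ : ℝ → ℝ} (hφ : Continuous φ)
    (hc : HasCompactSupport φ) : ∃ C, 0 ≤ C ∧ ∀ x, |φ x| ≤ C := by
  obtain ⟨C, hC⟩ := hc.exists_bound_of_continuous hφ
  exact ⟨C, (norm_nonneg _).trans (hC 0), hC⟩

namespace IsLineField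

variable {u : ℝ → ℝ} {K : NNReal} {M : ℝ} {Φ : ℝ → ℝ → ℝ}

/-- Approximate solutions of the dual problem: `C^1` functions that approximate
`η(t) φ(Φ_{T-t}(x))`, and whose derivative along the flow approximates `η'(t) φ(Φ_{T-t}(x))`. -/
theorem exists_dual_approx (hu : IsLineField u K M) (hΦ : IsSemiflow u Φ) (T : ℝ)
    {φ η : ℝ → ℝ} (hφ : ContDiff ℝ 1 φ) (hφc : HasCompactSupport φ) (hη : ContDiff ℝ 1 η)
    (hηc : HasCompactSupport η) :
    ∃ (C : ℝ) (f : ℕ → ℝ → ℝ → ℝ), (∀ n, ContDiff ℝ 1 (fun q : ℝ × ℝ => f n q.1 q.2)) ∧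
      (∀ n, HasCompactSupport (fun q : ℝ × ℝ => f n q.1 q.2)) ∧
      (∀ n x t, |f n x t| ≤ C) ∧
      (∀ x, ∀ t ∈ Icc 0 T, Tendsto (fun n => f n x t) atTop (𝓝 (η t * φ (Φ (T - t) x)))) ∧
      (∀ n x, ∀ t ∈ Icc 0 T,
        |deriv (fun s => f n x s) t + u x * deriv (fun y => f n y t) x| ≤ C) ∧
      ∀ x, ∀ t ∈ Icc 0 T,
        Tendsto (fun n => deriv (fun s => f n x s) t + u x * deriv (fun y => f n y t) x) atTop
          (𝓝 (deriv η t * φ (Φ (T - t) x))) := by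
  have hM : 0 ≤ M := (hu.nonneg 0).trans (hu.le 0)
  obtain ⟨Cφ, hCφ0, hCφ⟩ := exists_bound_of_hasCompactSupport hφ.continuous hφc
  obtain ⟨Cη, hCη0, hCη⟩ := exists_bound_of_hasCompactSupport hη.continuous hηc
  obtain ⟨Dφ, hDφ0, hDφ⟩ := exists_bound_of_hasCompactSupport
    (hφ.continuous_deriv le_rfl) hφc.deriv
  obtain ⟨Dη, hDη0, hDη⟩ := exists_bound_of_hasCompactSupport
    (hη.continuous_deriv le_rfl) hηc.deriv
  set ε : ℕ → ℝ := fun n => 1 / ((n : ℝ) + 1) with hε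
  have hεpos : ∀ n, 0 < ε n := fun n => Nat.one_div_pos_of_nat
  have hε1 : ∀ n, ε n ≤ 1 := fun n => by
    rw [hε]; simp only; rw [div_le_one (by positivity)]; linarith [n.cast_nonneg (α := ℝ)]
  have hεlim : Tendsto ε atTop (𝓝 0) := tendsto_one_div_add_atTop_nhds_zero_nat
  choose Ψ hΨ1 hΨ0 hΨt hΨx using fun n => hu.exists_regular_flow (hεpos n)
  set f : ℕ → ℝ → ℝ → ℝ := fun n x t => η t * φ (Ψ n (T - t) x) with hf
  have hdt : ∀ n x t, HasDerivAt (fun s => f n x s)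
      (deriv η t * φ (Ψ n (T - t) x)
        + η t * (deriv φ (Ψ n (T - t) x) * (-(u (Ψ n (T - t) x) + ε n)))) t := by
    intro n x t
    have h1 : HasDerivAt (fun s => Ψ n (T - s) x) (-(u (Ψ n (T - t) x) + ε n)) t :=
      (hΨt n (T - t) x).comp_const_sub T t
    have h2 := ((hφ.differentiable one_ne_zero (Ψ n (T - t) x)).hasDerivAt).comp t h1
    exact ((hη.differentiable one_ne_zero t).hasDerivAt).mul h2
  have hdx : ∀ n x t, HasDerivAt (fun y => f n y t)
      (η t * (deriv φ (Ψ n (T - t) x) * ((u (Ψ n (T - t) x) + ε n) / (u x + ε n)))) x := by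
    intro n x t
    exact (((hφ.differentiable one_ne_zero (Ψ n (T - t) x)).hasDerivAt).comp x
      (hΨx n (T - t) x)).const_mul (η t)
  -- The function `f n` is transported exactly by `u + ε n`. With `u` in its place, the term `-ε n *
  -- ∂_x f n` remains.
  have hop : ∀ n x t, deriv (fun s => f n x s) t + u x * deriv (fun y => f n y t) x
      = deriv η t * φ (Ψ n (T - t) x) - ε n * (η t * (deriv φ (Ψ n (T - t) x)
        * ((u (Ψ n (T - t) x) + ε n) / (u x + ε n)))) := by
    intro n x t
    rw [(hdt n x t).deriv, (hdx n x t).deriv]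
    have : u x + ε n ≠ 0 := by linarith [hu.nonneg x, hεpos n]
    field_simp
    ring
  have herr : ∀ n x, ∀ t ∈ Icc 0 T, |η t * (deriv φ (Ψ n (T - t) x)
      * ((u (Ψ n (T - t) x) + ε n) / (u x + ε n)))| ≤ Cη * (Dφ * Real.exp (K * T)) := by
    intro n x t ht
    rw [abs_mul, abs_mul]
    have h1 := hu.deriv_flow_le (hΨ0 n) (hΨt n) (hΨx n) (sub_nonneg.2 ht.2) x
    have h2 : Real.exp (K * (T - t)) ≤ Real.exp (K * T) :=
      Real.exp_le_exp.2 (mul_le_mul_of_nonneg_left (by linarith [ht.1]) K.coe_nonneg)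
    gcongr
    · exact hCη t
    · exact hDφ _
    · exact h1.trans h2
  have hlimΨ : ∀ x, ∀ t ∈ Icc 0 T,
      Tendsto (fun n => φ (Ψ n (T - t) x)) atTop (𝓝 (φ (Φ (T - t) x))) := by
    intro x t ht
    refine (hφ.continuous.tendsto _).comp (tendsto_iff_dist_tendsto_zero.2 ?_)
    have hg : Tendsto (fun n => gronwallBound 0 K (ε n) (T - t)) atTop (𝓝 0) := by
      have := ((gronwallBound_continuous_ε 0 K (T - t)).tendsto 0).comp hεlim
      rwa [gronwallBound_ε0_δ0] at this
    refine squeeze_zero (fun _ => dist_nonneg) (fun n => ?_) hg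
    exact hΦ.dist_approx_le hu (u' := fun y => u y + ε n) (c := fun r => Ψ n r x)
      (fun y => by simp [abs_of_pos (hεpos n)]) (hΨ0 n x) (sub_nonneg.2 ht.2)
      (fun r => hΨt n r x)
  refine ⟨max (Cη * Cφ) (Dη * Cφ + Cη * (Dφ * Real.exp (K * T))), f, fun n => ?_, fun n => ?_,
    fun n x t => ?_, fun x t ht => ?_, fun n x t ht => ?_, fun x t ht => ?_⟩
  · refine (hη.comp contDiff_snd).mul (hφ.comp ?_)
    exact (hΨ1 n).comp ((contDiff_const.sub contDiff_snd).prodMk contDiff_fst)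
  -- On the support `|t| ≤ R`, so the regularized flow runs for a time at most `|T| + R`, at speed
  -- at most `M + ε n`, and ends in the support of `φ`.
  · obtain ⟨R, hR⟩ := hηc.isCompact.isBounded.subset_closedBall 0
    obtain ⟨S, hS⟩ := hφc.isCompact.isBounded.subset_closedBall 0
    refine HasCompactSupport.of_support_subset_isCompact
      ((isCompact_closedBall (0 : ℝ) (S + (M + ε n) * (|T| + R))).prod
        (isCompact_closedBall (0 : ℝ) R)) ?_
    rintro ⟨x, t⟩ hq
    simp only [hf, Function.mem_support, ne_eq, mul_eq_zero, not_or] at hq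
    have h1 : |t| ≤ R := by simpa using hR (subset_tsupport η hq.1)
    have h2 : |Ψ n (T - t) x| ≤ S := by simpa using hS (subset_tsupport φ hq.2)
    have h3 := hu.abs_flow_sub_le (hεpos n) (hΨ0 n) (hΨt n) (T - t) x
    have h4 : (M + ε n) * |T - t| ≤ (M + ε n) * (|T| + R) :=
      mul_le_mul_of_nonneg_left ((abs_sub _ _).trans (by linarith)) (by linarith [hεpos n])
    have h5 : |x| ≤ |Ψ n (T - t) x| + |Ψ n (T - t) x - x| := by
      have := abs_sub (Ψ n (T - t) x) (Ψ n (T - t) x - x)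
      simpa using this
    refine ⟨?_, ?_⟩
    · simp only [mem_closedBall_zero_iff, Real.norm_eq_abs]; linarith
    · simpa using h1
  · refine le_max_of_le_left ?_
    simp only [hf, abs_mul]
    gcongr
    · exact hCη t
    · exact hCφ _
  · exact (hlimΨ x t ht).const_mul _
  · refine le_max_of_le_right ?_
    rw [hop]
    refine (abs_sub _ _).trans (add_le_add ?_ ?_)
    · rw [abs_mul]
      gcongr
      · exact hDη t
      · exact hCφ _
    · rw [abs_mul, abs_of_pos (hεpos n)]
      calc ε n * _ ≤ 1 * (Cη * (Dφ * Real.exp (K * T))) := by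
            gcongr
            · exact hε1 n
            · exact herr n x t ht
        _ = _ := one_mul _
  · simp only [hop]
    have h1 := (hlimΨ x t ht).const_mul (deriv η t)
    have h2 : Tendsto (fun n => ε n * (η t * (deriv φ (Ψ n (T - t) x)
        * ((u (Ψ n (T - t) x) + ε n) / (u x + ε n))))) atTop (𝓝 0) := by
      refine squeeze_zero_norm (fun n => ?_)
        (by simpa using hεlim.mul_const (Cη * (Dφ * Real.exp (K * T))))
      rw [norm_mul, Real.norm_of_nonneg (hεpos n).le, Real.norm_eq_abs]
      exact mul_le_mul_of_nonneg_left (herr n x t ht) (hεpos n).le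
    simpa using h1.sub h2

end IsLineField

theorem continuous_transport {f : ℝ → ℝ → ℝ} (hf : ContDiff ℝ 1 (fun q : ℝ × ℝ => f q.1 q.2))
    {u : ℝ → ℝ} (hu : Continuous u) :
    Continuous (fun q : ℝ × ℝ =>
      deriv (fun s => f q.1 s) q.2 + u q.1 * deriv (fun y => f y q.2) q.1) := by
  have hfd := hf.differentiable one_ne_zero
  have hc : Continuous (fderiv ℝ (fun q : ℝ × ℝ => f q.1 q.2)) := hf.continuous_fderiv one_ne_zero
  have h1 : ∀ q : ℝ × ℝ, deriv (fun s => f q.1 s) q.2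
      = fderiv ℝ (fun q : ℝ × ℝ => f q.1 q.2) q (0, 1) := by
    intro q
    have h := (hfd q).hasFDerivAt.comp_hasDerivAt (f := fun s => (q.1, s)) q.2
      ((hasDerivAt_const q.2 q.1).prodMk (hasDerivAt_id q.2))
    exact h.deriv
  have h2 : ∀ q : ℝ × ℝ, deriv (fun y => f y q.2) q.1
      = fderiv ℝ (fun q : ℝ × ℝ => f q.1 q.2) q (1, 0) := by
    intro q
    have h := (hfd q).hasFDerivAt.comp_hasDerivAt (f := fun y => (y, q.2)) q.1
      ((hasDerivAt_id q.1).prodMk (hasDerivAt_const q.1 q.2))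
    exact h.deriv
  simp only [h1, h2]
  exact (hc.clm_apply continuous_const).add
    ((hu.comp continuous_fst).mul (hc.clm_apply continuous_const))

namespace IsLineSolution

variable {u : ℝ → ℝ} {K : NNReal} {M : ℝ} {Φ : ℝ → ℝ → ℝ} {T L : ℝ} {m : ℝ → Measure ℝ}
  {m₀ νin νout : Measure ℝ}

/-- The balance equation, tested with the solutions of the dual problem. -/
theorem dual_balance (hm : IsLineSolution T u L m m₀ νin νout) (hu : IsLineField u K M)
    (hΦ : IsSemiflow u Φ) (hT : 0 ≤ T) {φ η : ℝ → ℝ} (hφ : ContDiff ℝ 1 φ)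
    (hφc : HasCompactSupport φ) (hη : ContDiff ℝ 1 η) (hηc : HasCompactSupport η) :
    ∫ x, η T * φ x ∂(m T) - ∫ x, η 0 * φ (Φ T x) ∂m₀ - ∫ t, η t * φ (Φ (T - t) 0) ∂νin
        + ∫ t, η t * φ (Φ (T - t) L) ∂νout
      = ∫ t in Icc 0 T, ∫ x, deriv η t * φ (Φ (T - t) x) ∂(m t) := by
  obtain ⟨C, f, hf1, hfc, hfb, hfl, hdb, hdl⟩ := hu.exists_dual_approx hΦ T hφ hφc hη hηc
  have := hm.init_finite
  have := hm.in_finite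
  have := hm.out_finite
  have hTfin := hm.finite T ⟨hT, le_rfl⟩
  have hslice : ∀ n t, Continuous fun x => f n x t := fun n t =>
    (hf1 n).continuous.comp (by fun_prop : Continuous fun x : ℝ => (x, t))
  have hslice' : ∀ n x, Continuous fun t => f n x t := fun n x =>
    (hf1 n).continuous.comp (by fun_prop : Continuous fun t : ℝ => (x, t))
  have hsupp : ∀ {ν : Measure ℝ}, ν (Icc 0 T)ᶜ = 0 → ∀ᵐ t ∂ν, t ∈ Icc 0 T := fun h => h
  have l1 : Tendsto (fun n => ∫ x, f n x T ∂(m T)) atTop (𝓝 (∫ x, η T * φ x ∂(m T))) := by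
    refine tendsto_integral_of_dominated_convergence (fun _ => C)
      (fun n => (hslice n T).aestronglyMeasurable) (integrable_const C)
      (fun n => Eventually.of_forall fun x => hfb n x T) (Eventually.of_forall fun x => ?_)
    simpa [hΦ.zero] using hfl x T ⟨hT, le_rfl⟩
  have l2 : Tendsto (fun n => ∫ x, f n x 0 ∂m₀) atTop (𝓝 (∫ x, η 0 * φ (Φ T x) ∂m₀)) := by
    refine tendsto_integral_of_dominated_convergence (fun _ => C)
      (fun n => (hslice n 0).aestronglyMeasurable) (integrable_const C)
      (fun n => Eventually.of_forall fun x => hfb n x 0) (Eventually.of_forall fun x => ?_)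
    simpa using hfl x 0 ⟨le_rfl, hT⟩
  have l3 : ∀ {ν : Measure ℝ} [IsFiniteMeasure ν] (x : ℝ), ν (Icc 0 T)ᶜ = 0 →
      Tendsto (fun n => ∫ t, f n x t ∂ν) atTop (𝓝 (∫ t, η t * φ (Φ (T - t) x) ∂ν)) := by
    intro ν _ x hν
    refine tendsto_integral_of_dominated_convergence (fun _ => C)
      (fun n => (hslice' n x).aestronglyMeasurable) (integrable_const C)
      (fun n => Eventually.of_forall fun t => hfb n x t) ?_
    filter_upwards [hsupp hν] with t ht using hfl x t ht
  have l4 : Tendsto (fun n => ∫ t in Icc 0 T, ∫ x,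
      (deriv (fun s => f n x s) t + u x * deriv (fun y => f n y t) x) ∂(m t)) atTop
      (𝓝 (∫ t in Icc 0 T, ∫ x, deriv η t * φ (Φ (T - t) x) ∂(m t))) := by
    have hcont := fun n => continuous_transport (hf1 n) hu.lipschitz.continuous
    refine tendsto_integral_of_dominated_convergence (fun t => C * (m t).real univ) (fun n => ?_)
      ((integrable_mass hm.measurable hm.mass).const_mul C) (fun n => ?_) ?_
    -- The bound `hdb` holds only for times in `[0, T]`. Clamping the time makes it global without
    -- changing the values there.
    · set F : ℝ → ℝ → ℝ := fun x t => deriv (fun s => f n x s) (max 0 (min t T))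
        + u x * deriv (fun y => f n y (max 0 (min t T))) x with hF
      have hFc : Continuous (fun q : ℝ × ℝ => F q.1 q.2) :=
        (hcont n).comp (by fun_prop : Continuous fun q : ℝ × ℝ => (q.1, max 0 (min q.2 T)))
      refine (aestronglyMeasurable_integral_param hm.measurable hm.finite hFc
        (C := C) fun x t => hdb n x _ ⟨le_max_left _ _, max_le hT (min_le_right _ _)⟩).congr ?_
      filter_upwards [ae_restrict_mem measurableSet_Icc] with t ht
      simp only [hF, min_eq_left ht.2, max_eq_right ht.1]
    · filter_upwards [ae_restrict_mem measurableSet_Icc] with t ht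
      have := hm.finite t ht
      exact abs_integral_le_mass (Eventually.of_forall fun x => hdb n x t ht)
    · filter_upwards [ae_restrict_mem measurableSet_Icc] with t ht
      have := hm.finite t ht
      refine tendsto_integral_of_dominated_convergence (fun _ => C) (fun n => ?_)
        (integrable_const C) (fun n => Eventually.of_forall fun x => hdb n x t ht)
        (Eventually.of_forall fun x => hdl x t ht)
      exact ((hcont n).comp
        (by fun_prop : Continuous fun x : ℝ => (x, t))).aestronglyMeasurable
  have hb : ∀ n, _ = _ := fun n => hm.balance (f n) (hf1 n) (hfc n)
  refine tendsto_nhds_unique (((l1.sub l2).sub (l3 0 hm.in_supported)).add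
    (l3 L hm.out_supported)) ?_
  simp only [hb]
  exact l4

end IsLineSolution

/-! ### The representation formula on a single arc -/

section

/-- The distribution of the positions and times at which mass enters: at time `0` according to
`m₀`, and at the position `0` according to `ν`. -/
noncomputable def entryMeasure (m₀ ν : Measure ℝ) : Measure (ℝ × ℝ) :=
  m₀.map (fun x => (x, 0)) + ν.map (fun s => (0, s))

/-- The positions at time `t` of the mass that has entered up to time `t`. -/
noncomputable def transported (Φ : ℝ → ℝ → ℝ) (lam : Measure (ℝ × ℝ)) (t : ℝ) : Measure ℝ :=
  (lam.restrict {q | q.2 ≤ t}).map (fun q => Φ (t - q.2) q.1)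

instance entryMeasure.isFiniteMeasure (m₀ ν : Measure ℝ) [IsFiniteMeasure m₀]
    [IsFiniteMeasure ν] : IsFiniteMeasure (entryMeasure m₀ ν) := by
  unfold entryMeasure; infer_instance

instance transported.isFiniteMeasure (Φ : ℝ → ℝ → ℝ) (lam : Measure (ℝ × ℝ)) [IsFiniteMeasure lam]
    (t : ℝ) : IsFiniteMeasure (transported Φ lam t) := by
  unfold transported; infer_instance

theorem measurableSet_snd_le (t : ℝ) : MeasurableSet {q : ℝ × ℝ | q.2 ≤ t} :=
  measurableSet_le measurable_snd measurable_const

variable {u : ℝ → ℝ} {K : NNReal} {M : ℝ} {Φ : ℝ → ℝ → ℝ} {T L : ℝ} {m : ℝ → Measure ℝ}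
  {m₀ νin νout : Measure ℝ}

theorem IsSemiflow.measurable_flow_sub (hu : IsLineField u K M) (hΦ : IsSemiflow u Φ) (t : ℝ) :
    Measurable (fun q : ℝ × ℝ => Φ (t - q.2) q.1) :=
  ((hΦ.continuous_uncurry hu).comp
    (by fun_prop : Continuous fun q : ℝ × ℝ => (t - q.2, q.1))).measurable

theorem IsSemiflow.continuous_flow_sub (hu : IsLineField u K M) (hΦ : IsSemiflow u Φ) (t x : ℝ) :
    Continuous (fun s => Φ (t - s) x) :=
  (hΦ.continuous_uncurry hu).comp (by fun_prop : Continuous fun s : ℝ => (t - s, x))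

theorem transported_entryMeasure (hu : IsLineField u K M) (hΦ : IsSemiflow u Φ) {t : ℝ}
    (ht : 0 ≤ t) : transported Φ (entryMeasure m₀ νin) t
      = m₀.map (Φ t) + (νin.restrict (Iic t)).map (fun s => Φ (t - s) 0) := by
  have hm := hΦ.measurable_flow_sub hu t
  have h1 : Measurable fun x : ℝ => (x, (0 : ℝ)) := by fun_prop
  have h2 : Measurable fun s : ℝ => ((0 : ℝ), s) := by fun_prop
  rw [transported, entryMeasure, Measure.restrict_add, Measure.map_add _ _ hm,
    Measure.restrict_map h1 (measurableSet_snd_le t),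
    Measure.restrict_map h2 (measurableSet_snd_le t), Measure.map_map hm h1,
    Measure.map_map hm h2,
    show (fun x : ℝ => (x, (0 : ℝ))) ⁻¹' {q | q.2 ≤ t} = univ from by ext; simp [ht],
    show (fun s : ℝ => ((0 : ℝ), s)) ⁻¹' {q | q.2 ≤ t} = Iic t from rfl, Measure.restrict_univ]
  simp [Function.comp_def]

/-- Fubini's theorem: mass counted from time `s` on collects `∫_s^T η' = η T - η s`. -/
theorem integral_deriv_mul_tail {ν : Measure ℝ} [IsFiniteMeasure ν] (hν : ν (Icc 0 T)ᶜ = 0)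
    {g : ℝ → ℝ} (hg : Continuous g) {C : ℝ} (hC : ∀ s, |g s| ≤ C) {η : ℝ → ℝ}
    (hη : ContDiff ℝ 1 η) (hηc : HasCompactSupport η) :
    Integrable (fun t => deriv η t * ∫ s in Iic t, g s ∂ν) (volume.restrict (Icc 0 T)) ∧
    ∫ t in Icc 0 T, deriv η t * ∫ s in Iic t, g s ∂ν = ∫ s, (η T - η s) * g s ∂ν := by
  obtain ⟨D, hD0, hD⟩ := exists_bound_of_hasCompactSupport (hη.continuous_deriv le_rfl) hηc.deriv
  have hdc := hη.continuous_deriv le_rfl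
  have hC0 : 0 ≤ C := (abs_nonneg _).trans (hC 0)
  set k : ℝ → ℝ → ℝ := fun t s => {q : ℝ × ℝ | q.2 ≤ q.1}.indicator
    (fun q => deriv η q.1 * g q.2) (t, s) with hk
  have hkint : Integrable (Function.uncurry k) ((volume.restrict (Icc 0 T)).prod ν) := by
    refine Integrable.of_bound (C := D * C) ?_ (Eventually.of_forall fun q => ?_)
    · refine AEStronglyMeasurable.indicator ?_ (measurableSet_le measurable_snd measurable_fst)
      exact ((hdc.comp continuous_fst).mul (hg.comp continuous_snd)).aestronglyMeasurable
    · refine (norm_indicator_le_norm_self (s := {q : ℝ × ℝ | q.2 ≤ q.1})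
        (fun q : ℝ × ℝ => deriv η q.1 * g q.2) q).trans ?_
      rw [Real.norm_eq_abs, abs_mul]
      exact mul_le_mul (hD q.1) (hC q.2) (abs_nonneg _) hD0
  have hinner : ∀ t, deriv η t * ∫ s in Iic t, g s ∂ν = ∫ s, k t s ∂ν := by
    intro t
    rw [← integral_const_mul, ← integral_indicator measurableSet_Iic]
    rfl
  simp only [hinner]
  refine ⟨hkint.integral_prod_left, ?_⟩
  rw [integral_integral_swap hkint]
  refine integral_congr_ae ?_
  filter_upwards [show ∀ᵐ s ∂ν, s ∈ Icc 0 T from hν] with s hs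
  have h1 : ∀ t, k t s = (Ici s).indicator (fun t => deriv η t * g s) t := fun t => rfl
  simp only [h1]
  rw [setIntegral_indicator measurableSet_Ici]
  have h2 : Icc 0 T ∩ Ici s = Icc s T := by
    ext t; simp only [mem_inter_iff, mem_Icc, mem_Ici]
    exact ⟨fun h => ⟨h.2, h.1.2⟩, fun h => ⟨⟨hs.1.trans h.1, h.2⟩, h.1⟩⟩
  rw [h2, integral_mul_const, integral_Icc_eq_integral_Ioc, ← intervalIntegral.integral_of_le hs.2,
    intervalIntegral.integral_deriv_eq_sub (fun t _ => hη.differentiable one_ne_zero t)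
      (hdc.intervalIntegrable _ _)]

/-- A primitive multiplied by a cutoff equal to `1` near `[0, T]`. Hence `η'` is an arbitrary
continuous function there, with `η` still compactly supported. -/
theorem exists_primitive_on_Icc (T : ℝ) {g : ℝ → ℝ} (hg : Continuous g) :
    ∃ η : ℝ → ℝ, ContDiff ℝ 1 η ∧ HasCompactSupport η ∧ ∀ t ∈ Icc 0 T, deriv η t = g t := by
  let χ : ContDiffBump (0 : ℝ) := ⟨|T| + 1, |T| + 2, by positivity, by linarith⟩
  have hd : ∀ x, HasDerivAt (fun t => ∫ s in (0 : ℝ)..t, g s) (g x) x := fun x =>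
    (hg.integral_hasStrictDerivAt 0 x).hasDerivAt
  have hG : ContDiff ℝ 1 (fun t => ∫ s in (0 : ℝ)..t, g s) := by
    rw [contDiff_one_iff_deriv]
    exact ⟨fun x => (hd x).differentiableAt, by rwa [show deriv _ = g from
      funext fun x => (hd x).deriv]⟩
  refine ⟨fun t => χ t * ∫ s in (0 : ℝ)..t, g s, χ.contDiff.mul hG, χ.hasCompactSupport.mul_right,
    fun t ht => ?_⟩
  have h1 : (fun t => χ t * ∫ s in (0 : ℝ)..t, g s) =ᶠ[𝓝 t] fun t => ∫ s in (0 : ℝ)..t, g s := by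
    have : t ∈ Metric.ball (0 : ℝ) χ.rIn := by
      rw [mem_ball_zero_iff, Real.norm_of_nonneg ht.1]
      exact (ht.2.trans (le_abs_self T)).trans_lt (lt_add_one |T|)
    filter_upwards [χ.eventuallyEq_one_of_mem_ball this] with s hs
    rw [hs, Pi.one_apply, one_mul]
  rw [h1.deriv_eq, (hd t).deriv]

namespace IsLineSolution

/-- The dual balance with `η = 1` near `[0, T]`, for which the right-hand side vanishes. -/
theorem representation_terminal (hm : IsLineSolution T u L m m₀ νin νout)
    (hu : IsLineField u K M) (hΦ : IsSemiflow u Φ) (hT : 0 ≤ T) {φ : ℝ → ℝ} (hφ : ContDiff ℝ 1 φ)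
    (hφc : HasCompactSupport φ) :
    ∫ x, φ x ∂(m T) + ∫ t, φ (Φ (T - t) L) ∂νout
      = ∫ x, φ (Φ T x) ∂m₀ + ∫ t, φ (Φ (T - t) 0) ∂νin := by
  let χ : ContDiffBump (0 : ℝ) := ⟨T + 1, T + 2, by positivity, by linarith⟩
  have hb : ∀ t ∈ Icc 0 T, t ∈ Metric.ball (0 : ℝ) χ.rIn := fun t ht => by
    rw [mem_ball_zero_iff, Real.norm_of_nonneg ht.1]
    exact ht.2.trans_lt (lt_add_one T)
  have h1 : ∀ t ∈ Icc 0 T, χ t = 1 := fun t ht =>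
    χ.one_of_mem_closedBall (Metric.ball_subset_closedBall (hb t ht))
  have h2 : ∀ t ∈ Icc 0 T, deriv χ t = 0 := fun t ht => by
    rw [(χ.eventuallyEq_one_of_mem_ball (hb t ht)).deriv_eq]
    simp
  have h := hm.dual_balance hu hΦ hT hφ hφc χ.contDiff χ.hasCompactSupport
  rw [h1 0 ⟨le_rfl, hT⟩, h1 T ⟨hT, le_rfl⟩] at h
  have h3 : ∀ {ν : Measure ℝ} (x : ℝ), ν (Icc 0 T)ᶜ = 0 →
      ∫ t, χ t * φ (Φ (T - t) x) ∂ν = ∫ t, φ (Φ (T - t) x) ∂ν := by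
    intro ν x hν
    refine integral_congr_ae ?_
    filter_upwards [show ∀ᵐ s ∂ν, s ∈ Icc 0 T from hν] with s hs
    rw [h1 s hs, one_mul]
  have h4 : ∫ t in Icc 0 T, ∫ x, deriv χ t * φ (Φ (T - t) x) ∂(m t) = 0 := by
    rw [setIntegral_congr_fun (g := fun _ => 0) measurableSet_Icc (fun t ht => by simp [h2 t ht])]
    simp
  rw [h4, h3 0 hm.in_supported, h3 L hm.out_supported] at h
  simp only [one_mul] at h
  linarith

/-- Letting `η'` vary in the dual balance shows that the defect `X` is orthogonal to every smooth
compactly supported function, hence zero almost everywhere. The null set depends on `φ`, which is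
why a countable family of test functions is used later. -/
theorem ae_representation_integral (hm : IsLineSolution T u L m m₀ νin νout)
    (hu : IsLineField u K M) (hΦ : IsSemiflow u Φ) (hT : 0 ≤ T) {φ : ℝ → ℝ} (hφ : ContDiff ℝ 1 φ)
    (hφc : HasCompactSupport φ) :
    ∀ᵐ t ∂(volume.restrict (Icc 0 T)),
      ∫ x, φ (Φ (T - t) x) ∂(m t) + ∫ s in Iic t, φ (Φ (T - s) L) ∂νout
        = ∫ x, φ (Φ T x) ∂m₀ + ∫ s in Iic t, φ (Φ (T - s) 0) ∂νin := by
  have := hm.init_finite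
  have := hm.in_finite
  have := hm.out_finite
  obtain ⟨C, hC0, hC⟩ := exists_bound_of_hasCompactSupport hφ.continuous hφc
  have hterm := hm.representation_terminal hu hΦ hT hφ hφc
  have hflow : ∀ x, Continuous fun s => φ (Φ (T - s) x) := fun x =>
    hφ.continuous.comp (hΦ.continuous_flow_sub hu T x)
  have hcont : Continuous fun q : ℝ × ℝ => φ (Φ (T - q.2) q.1) := hφ.continuous.comp
    ((hΦ.continuous_uncurry hu).comp
      (by fun_prop : Continuous fun q : ℝ × ℝ => (T - q.2, q.1)))
  set X : ℝ → ℝ := fun t => ∫ x, φ (Φ (T - t) x) ∂(m t) + ∫ s in Iic t, φ (Φ (T - s) L) ∂νout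
    - ∫ x, φ (Φ T x) ∂m₀ - ∫ s in Iic t, φ (Φ (T - s) 0) ∂νin with hX
  have hIm := integrable_integral_param hm.measurable hm.finite hm.mass
    (F := fun x t => φ (Φ (T - t) x)) hcont (fun x t => hC _)
  have htail : ∀ {ν : Measure ℝ} [IsFiniteMeasure ν] (x : ℝ), ν (Icc 0 T)ᶜ = 0 →
      Integrable (fun t => ∫ s in Iic t, φ (Φ (T - s) x) ∂ν) (volume.restrict (Icc 0 T)) := by
    intro ν _ x hν
    -- Only the integrability clause of `integral_deriv_mul_tail` is needed, with `η' = 1` on `[0,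
    -- T]`.
    obtain ⟨η, hη, hηc, hd⟩ := exists_primitive_on_Icc T (g := fun _ => 1) continuous_const
    refine (integral_deriv_mul_tail hν (hflow x) (fun s => hC _) hη hηc).1.congr ?_
    filter_upwards [ae_restrict_mem measurableSet_Icc] with t ht
    rw [hd t ht, one_mul]
  have hXint : Integrable X (volume.restrict (Icc 0 T)) :=
    ((hIm.add (htail L hm.out_supported)).sub (integrable_const _)).sub (htail 0 hm.in_supported)
  have hzero : ∀ᵐ t ∂(volume.restrict (Icc 0 T)), X t = 0 := by
    refine ae_eq_zero_of_integral_contDiff_smul_eq_zero hXint.locallyIntegrable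
      fun g hg hgc => ?_
    obtain ⟨η, hη, hηc, hd⟩ := exists_primitive_on_Icc T hg.continuous
    obtain ⟨D, hD0, hD⟩ := exists_bound_of_hasCompactSupport (hη.continuous_deriv le_rfl)
      hηc.deriv
    have e1 := hm.dual_balance hu hΦ hT hφ hφc hη hηc
    have hI1 : Integrable (fun t => ∫ x, deriv η t * φ (Φ (T - t) x) ∂(m t))
        (volume.restrict (Icc 0 T)) := by
      refine integrable_integral_param hm.measurable hm.finite hm.mass
        (F := fun x t => deriv η t * φ (Φ (T - t) x)) (C := D * C)
        (((hη.continuous_deriv le_rfl).comp continuous_snd).mul hcont) (fun x t => ?_)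
      rw [abs_mul]
      exact mul_le_mul (hD _) (hC _) (abs_nonneg _) hD0
    have e2 := integral_deriv_mul_tail hm.out_supported (hflow L) (fun s => hC _) hη hηc
    have e3 := integral_deriv_mul_tail hm.in_supported (hflow 0) (fun s => hC _) hη hηc
    have e4 : Integrable (fun t => deriv η t * ∫ x, φ (Φ T x) ∂m₀)
        (volume.restrict (Icc 0 T)) :=
      ((hη.continuous_deriv le_rfl).mul continuous_const).integrableOn_Icc
    have e5 : ∫ t in Icc 0 T, deriv η t * ∫ x, φ (Φ T x) ∂m₀
        = (η T - η 0) * ∫ x, φ (Φ T x) ∂m₀ := by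
      rw [integral_mul_const, integral_Icc_eq_integral_Ioc, ← intervalIntegral.integral_of_le hT,
        intervalIntegral.integral_deriv_eq_sub (fun t _ => hη.differentiable one_ne_zero t)
          ((hη.continuous_deriv le_rfl).intervalIntegrable _ _)]
    have e6 : ∫ t in Icc 0 T, g t • X t = ∫ t in Icc 0 T,
        ((∫ x, deriv η t * φ (Φ (T - t) x) ∂(m t))
          + deriv η t * (∫ s in Iic t, φ (Φ (T - s) L) ∂νout)
          - deriv η t * (∫ x, φ (Φ T x) ∂m₀)
          - deriv η t * ∫ s in Iic t, φ (Φ (T - s) 0) ∂νin) := by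
      refine setIntegral_congr_fun measurableSet_Icc fun t ht => ?_
      simp only [hX, smul_eq_mul, integral_const_mul, hd t ht]
      ring
    have e7 : ∀ {ν : Measure ℝ} [IsFiniteMeasure ν] (x : ℝ),
        ∫ s, (η T - η s) * φ (Φ (T - s) x) ∂ν
          = η T * ∫ s, φ (Φ (T - s) x) ∂ν - ∫ s, η s * φ (Φ (T - s) x) ∂ν := by
      intro ν _ x
      obtain ⟨E, hE0, hE⟩ := exists_bound_of_hasCompactSupport hη.continuous hηc
      rw [← integral_const_mul, ← integral_sub]
      · simp only [sub_mul]
      · exact (Integrable.of_bound (hflow x).aestronglyMeasurable C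
          (Eventually.of_forall fun s => hC _)).const_mul _
      · refine Integrable.of_bound (hη.continuous.mul (hflow x)).aestronglyMeasurable (E * C)
          (Eventually.of_forall fun s => ?_)
        rw [norm_mul]
        exact mul_le_mul (hE _) (hC _) (norm_nonneg _) hE0
    have J1 := hI1.fun_add e2.1
    have J2 : Integrable (fun t => (∫ x, deriv η t * φ (Φ (T - t) x) ∂(m t))
        + deriv η t * (∫ s in Iic t, φ (Φ (T - s) L) ∂νout)
        - deriv η t * (∫ x, φ (Φ T x) ∂m₀)) (volume.restrict (Icc 0 T)) := J1.sub e4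
    rw [e6, integral_sub J2 e3.1, integral_sub J1 e4,
      integral_add hI1 e2.1, e2.2, e3.2, e5, ← e1, e7 L, e7 0, integral_const_mul,
      integral_const_mul]
    -- The terms with `η 0` and those with `η` under the integrals cancel. What is left is `η T`
    -- times the terminal identity.
    linear_combination η T * hterm
  filter_upwards [hzero] with t ht
  simp only [hX] at ht
  linarith

/-- The hypothesis tests only with functions of `Φ (T - t)`, so it identifies the images of the two
measures under this map. A continuous injection of the line is a measurable embedding, and the
images determine the measures. -/
theorem map_representation (hm : IsLineSolution T u L m m₀ νin νout)
    (hu : IsLineField u K M) (hΦ : IsSemiflow u Φ) {t : ℝ} (ht : t ∈ Icc 0 T)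
    (h : ∀ (a b : ℚ) (n : ℕ),
      ∫ x, intervalBump a b n (Φ (T - t) x) ∂(m t)
          + ∫ s in Iic t, intervalBump a b n (Φ (T - s) L) ∂νout
        = ∫ x, intervalBump a b n (Φ T x) ∂m₀
          + ∫ s in Iic t, intervalBump a b n (Φ (T - s) 0) ∂νin) :
    m t + (νout.restrict (Iic t)).map (fun s => Φ (t - s) L)
      = transported Φ (entryMeasure m₀ νin) t := by
  have := hm.init_finite
  have := hm.in_finite
  have := hm.out_finite
  have := hm.finite t ht
  have hTt := hΦ.continuous_pos hu (T - t)
  have hemb : MeasurableEmbedding (Φ (T - t)) :=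
    hTt.measurableEmbedding (hΦ.injective hu (T - t))
  have hadd : ∀ s ∈ Iic t, ∀ x, Φ (T - t) (Φ (t - s) x) = Φ (T - s) x := by
    intro s hs x
    rw [← hΦ.add hu (sub_nonneg.2 hs) (sub_nonneg.2 ht.2)]
    congr 1; ring
  have hsub : ∀ {ν : Measure ℝ} (x : ℝ) (φ : ℝ → ℝ), Continuous φ →
      ∫ y, φ y ∂(((ν.restrict (Iic t)).map (fun s => Φ (t - s) x)).map (Φ (T - t)))
        = ∫ s in Iic t, φ (Φ (T - s) x) ∂ν := by
    intro ν x φ hφ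
    rw [hemb.integral_map, integral_map (f := fun y => φ (Φ (T - t) y))
      (hΦ.continuous_flow_sub hu t x).aemeasurable (hφ.comp hTt).aestronglyMeasurable]
    refine setIntegral_congr_fun measurableSet_Iic fun s hs => ?_
    simp only [hadd s hs]
  have hint : ∀ (a b : ℚ) (n : ℕ) (μ : Measure ℝ) [IsFiniteMeasure μ],
      Integrable (intervalBump a b n) μ := fun a b n μ _ =>
    (contDiff_intervalBump a b n (k := 0)).continuous.integrable_of_hasCompactSupport
      (hasCompactSupport_intervalBump a b n)
  have key : (m t + (νout.restrict (Iic t)).map (fun s => Φ (t - s) L)).map (Φ (T - t))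
      = (transported Φ (entryMeasure m₀ νin) t).map (Φ (T - t)) := by
    refine measure_ext_intervalBump fun a b n => ?_
    have hc : Continuous (intervalBump a b n) :=
      (contDiff_intervalBump a b n (k := 0)).continuous
    rw [transported_entryMeasure hu hΦ ht.1, Measure.map_add _ _ hemb.measurable,
      Measure.map_add _ _ hemb.measurable, integral_add_measure (hint a b n _) (hint a b n _),
      integral_add_measure (hint a b n _) (hint a b n _), hsub _ _ hc, hsub _ _ hc,
      hemb.integral_map, hemb.integral_map,
      integral_map (f := fun y => intervalBump a b n (Φ (T - t) y))
        (hΦ.continuous_pos hu t).aemeasurable (hc.comp hTt).aestronglyMeasurable,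
      h a b n]
    simp only [← hΦ.add hu ht.1 (sub_nonneg.2 ht.2), sub_add_cancel]
  have := congrArg (Measure.comap (Φ (T - t))) key
  rwa [hemb.comap_map, hemb.comap_map] at this

/-- At almost every time, the mass on the arc together with the mass that has left it (and is
transported further by the extended field) is the transported entry distribution. -/
theorem ae_representation (hm : IsLineSolution T u L m m₀ νin νout)
    (hu : IsLineField u K M) (hΦ : IsSemiflow u Φ) (hT : 0 ≤ T) :
    ∀ᵐ t ∂(volume.restrict (Icc 0 T)),
      m t + (νout.restrict (Iic t)).map (fun s => Φ (t - s) L)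
        = transported Φ (entryMeasure m₀ νin) t := by
  have h : ∀ᵐ t ∂(volume.restrict (Icc 0 T)), ∀ (a b : ℚ) (n : ℕ),
      ∫ x, intervalBump a b n (Φ (T - t) x) ∂(m t)
          + ∫ s in Iic t, intervalBump a b n (Φ (T - s) L) ∂νout
        = ∫ x, intervalBump a b n (Φ T x) ∂m₀
          + ∫ s in Iic t, intervalBump a b n (Φ (T - s) 0) ∂νin := by
    simp only [ae_all_iff]
    exact fun a b n => hm.ae_representation_integral hu hΦ hT (contDiff_intervalBump a b n)
      (hasCompactSupport_intervalBump a b n)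
  filter_upwards [h, ae_restrict_mem measurableSet_Icc] with t h ht
  exact hm.map_representation hu hΦ ht h

/-- The slice `m T` enters the balance equation itself, so the identity holds at `T` and not merely
at almost every time. -/
theorem representation (hm : IsLineSolution T u L m m₀ νin νout)
    (hu : IsLineField u K M) (hΦ : IsSemiflow u Φ) (hT : 0 ≤ T) :
    m T + (νout.restrict (Iic T)).map (fun s => Φ (T - s) L)
      = transported Φ (entryMeasure m₀ νin) T := by
  have hrestr : ∀ {ν : Measure ℝ}, ν (Icc 0 T)ᶜ = 0 → ν.restrict (Iic T) = ν := fun hν =>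
    Measure.restrict_eq_self_of_ae_mem
      ((show ∀ᵐ s ∂_, s ∈ Icc 0 T from hν).mono fun s hs => hs.2)
  refine hm.map_representation hu hΦ ⟨hT, le_rfl⟩ fun a b n => ?_
  rw [hrestr hm.in_supported, hrestr hm.out_supported]
  simpa [hΦ.zero] using hm.representation_terminal hu hΦ hT (contDiff_intervalBump a b n)
    (hasCompactSupport_intervalBump a b n)

end IsLineSolution

end

/-! ### Exit laws and the end of an arc -/

section

/-- The entries `(x, s)` that reach `L` by time `t`. -/
def exitedSet (Φ : ℝ → ℝ → ℝ) (L t : ℝ) : Set (ℝ × ℝ) :=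
  {q | q.2 ≤ t ∧ q.1 ≤ L ∧ L ≤ Φ (t - q.2) q.1}

/-- The distribution of the times, up to time `t`, at which the mass reaches `L`. -/
noncomputable def exitLaw (Φ : ℝ → ℝ → ℝ) (L : ℝ) (lam : Measure (ℝ × ℝ)) (t : ℝ) : Measure ℝ :=
  (lam.restrict (exitedSet Φ L t)).map (fun q => q.2 + hitTime Φ L q.1)

variable {u : ℝ → ℝ} {K : NNReal} {M : ℝ} {Φ : ℝ → ℝ → ℝ} {T L t : ℝ} {lam : Measure (ℝ × ℝ)}
  {μ ν : Measure ℝ}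

namespace IsSemiflow

theorem measurableSet_exitedSet (hu : IsLineField u K M) (hΦ : IsSemiflow u Φ) (L t : ℝ) :
    MeasurableSet (exitedSet Φ L t) :=
  (measurableSet_snd_le t).inter ((measurableSet_le measurable_fst measurable_const).inter
    (measurableSet_le measurable_const (hΦ.measurable_flow_sub hu t)))

theorem measurable_exitTime (hu : IsLineField u K M) (hΦ : IsSemiflow u Φ) (L : ℝ) :
    Measurable (fun q : ℝ × ℝ => q.2 + hitTime Φ L q.1) :=
  measurable_snd.add ((hΦ.measurable_hitTime hu).comp measurable_fst)

theorem mem_exitedSet_iff (hu : IsLineField u K M) (hΦ : IsSemiflow u Φ) {q : ℝ × ℝ}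
    (hq : q.1 ≤ L) : q ∈ exitedSet Φ L t ↔
      q.2 + hitTime Φ L q.1 ≤ t ∧ Φ (hitTime Φ L q.1) q.1 = L := by
  simp only [exitedSet, mem_ofPred_eq, hq, true_and]
  constructor
  · rintro ⟨h1, h2⟩
    have := (hΦ.hit_by_iff hu hq (sub_nonneg.2 h1)).1 h2
    exact ⟨by linarith [this.1], this.2⟩
  · rintro ⟨h1, h2⟩
    have h0 := hitTime_nonneg Φ L q.1
    have h3 : q.2 ≤ t := by linarith
    exact ⟨h3, (hΦ.hit_by_iff hu hq (sub_nonneg.2 h3)).2 ⟨by linarith, h2⟩⟩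

/-- The entries that have reached `L` by time `t` are those that reach it by time `T` with arrival
time at most `t`. -/
theorem restrict_exitLaw (hu : IsLineField u K M) (hΦ : IsSemiflow u Φ) (htT : t ≤ T) :
    (exitLaw Φ L lam T).restrict (Iic t) = exitLaw Φ L lam t := by
  rw [exitLaw, exitLaw, Measure.restrict_map (hΦ.measurable_exitTime hu L) measurableSet_Iic,
    Measure.restrict_restrict (hΦ.measurable_exitTime hu L measurableSet_Iic)]
  congr 2
  ext q
  by_cases hq : q.1 ≤ L
  · rw [mem_inter_iff, hΦ.mem_exitedSet_iff hu hq, hΦ.mem_exitedSet_iff hu hq]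
    simp only [mem_preimage, mem_Iic]
    exact ⟨fun h => ⟨h.1, h.2.2⟩, fun h => ⟨h.1, h.1.trans htT, h.2⟩⟩
  · simp [exitedSet, hq]

theorem preimage_Ici_eq_exitedSet (hle : ∀ᵐ q ∂lam, q.1 ≤ L) :
    ((fun q : ℝ × ℝ => Φ (t - q.2) q.1) ⁻¹' Ici L ∩ {q | q.2 ≤ t} : Set (ℝ × ℝ))
      =ᵐ[lam] exitedSet Φ L t := by
  filter_upwards [hle] with q hq
  refine propext ⟨fun h => ⟨h.2, hq, h.1⟩, fun h => ⟨h.2.2, h.1⟩⟩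

theorem restrict_transported (hu : IsLineField u K M) (hΦ : IsSemiflow u Φ) {s : Set ℝ}
    (hs : MeasurableSet s) : (transported Φ lam t).restrict s
      = (lam.restrict ((fun q : ℝ × ℝ => Φ (t - q.2) q.1) ⁻¹' s ∩ {q | q.2 ≤ t})).map
        (fun q => Φ (t - q.2) q.1) := by
  rw [transported, Measure.restrict_map (hΦ.measurable_flow_sub hu t) hs,
    Measure.restrict_restrict (hΦ.measurable_flow_sub hu t hs)]

theorem restrict_transported_Ici (hu : IsLineField u K M) (hΦ : IsSemiflow u Φ)
    (hle : ∀ᵐ q ∂lam, q.1 ≤ L) : (transported Φ lam t).restrict (Ici L)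
      = (lam.restrict (exitedSet Φ L t)).map (fun q => Φ (t - q.2) q.1) := by
  rw [hΦ.restrict_transported hu measurableSet_Ici,
    Measure.restrict_congr_set (preimage_Ici_eq_exitedSet hle)]

theorem exitedSet_null (hu : IsLineField u K M) (hΦ : IsSemiflow u Φ)
    (hL : ∀ y, L ≤ y → u y = u L) (h0 : u L = 0) (hne : ∀ᵐ q ∂lam, q.1 ≠ L) :
    lam (exitedSet Φ L t) = 0 := by
  refine measure_mono_null (fun q hq => ?_) (ae_iff.1 hne)
  rw [mem_ofPred_eq, not_not]
  exact hΦ.eq_of_flow_eq hu hL h0 ((hΦ.mem_exitedSet_iff hu hq.2.1).1 hq).2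

end IsSemiflow

theorem restrict_Ici_eq_dirac (h : μ (Ioi L) = 0) :
    μ.restrict (Ici L) = μ {L} • Measure.dirac L := by
  rw [← Measure.restrict_singleton]
  refine Measure.restrict_congr_set ?_
  rw [← Ioi_insert, insert_eq]
  have : (Ioi L : Set ℝ) =ᵐ[μ] (∅ : Set ℝ) := ae_eq_empty.2 h
  simpa using (ae_eq_refl ({L} : Set ℝ)).union this

/-- The measure of the mass leaving the arc is the law of the exit times, up to a possible atom at
the terminal time which may be attributed to the mass still on the arc. -/
theorem out_add_dirac_eq_exitLaw (hu : IsLineField u K M) (hΦ : IsSemiflow u Φ)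
    (hL : ∀ y, L ≤ y → u y = u L) (hle : ∀ᵐ q ∂lam, q.1 ≤ L)
    (hne : u L = 0 → ∀ᵐ q ∂lam, q.1 ≠ L) (hμ : μ (Ioi L) = 0) (hν : ∀ᵐ s ∂ν, s ≤ T)
    (hrep : μ + (ν.restrict (Iic T)).map (fun s => Φ (T - s) L) = transported Φ lam T) :
    ν + μ {L} • Measure.dirac T = exitLaw Φ L lam T := by
  rw [Measure.restrict_eq_self_of_ae_mem (s := Iic T) hν] at hrep
  have hflow := (hΦ.continuous_flow_sub hu T L).measurable
  -- Compare on `[L, ∞)`: on one side the mass that has left and the atom of `μ` at `L`, on the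
  -- other the entries that have reached `L`.
  have h1 := congrArg (fun μ : Measure ℝ => μ.restrict (Ici L)) hrep
  simp only [Measure.restrict_add] at h1
  rw [hΦ.restrict_transported_Ici hu hle, restrict_Ici_eq_dirac hμ,
    Measure.restrict_map hflow measurableSet_Ici,
    show (fun s => Φ (T - s) L) ⁻¹' Ici L = univ from
      eq_univ_of_forall fun s => hΦ.self_le hu _ _, Measure.restrict_univ] at h1
  -- If `u L = 0`, nothing reaches `L`, and both `ν` and the atom vanish.
  rcases (hu.nonneg L).eq_or_lt with h0 | hpos
  · have hz := hΦ.exitedSet_null hu hL h0.symm (hne h0.symm) (t := T)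
    have hE : lam.restrict (exitedSet Φ L T) = 0 := Measure.restrict_eq_zero.2 hz
    rw [hE, Measure.map_zero] at h1
    rw [exitLaw, hE, Measure.map_zero]
    have h2 := congrArg (fun μ : Measure ℝ => μ univ) h1
    simp only [Measure.add_apply, Measure.smul_apply, measure_univ, smul_eq_mul, mul_one,
      Measure.coe_zero, Pi.zero_apply, add_eq_zero] at h2
    rw [Measure.map_apply hflow MeasurableSet.univ, preimage_univ, Measure.measure_univ_eq_zero]
      at h2
    rw [h2.1, h2.2]
    simp
  -- Past `L` the speed is constantly `u L`, so this map recovers the crossing time from the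
  -- position at time `T`. It sends `L` to `T`, whence the atom at the terminal time.
  · have hg : Measurable fun y : ℝ => T - (y - L) / u L := by fun_prop
    have h2 := congrArg (Measure.map fun y : ℝ => T - (y - L) / u L) h1
    rw [Measure.map_add _ _ hg, Measure.map_smul, Measure.map_dirac' hg,
      Measure.map_map hg hflow, Measure.map_map hg (hΦ.measurable_flow_sub hu T)] at h2
    simp only [sub_self, zero_div, sub_zero] at h2
    rw [add_comm, exitLaw]
    convert h2 using 1
    · congr 1
      conv_lhs => rw [← Measure.map_id (μ := ν)]
      refine Measure.map_congr ?_
      filter_upwards [hν] with s hs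
      simp only [Function.comp_apply, id]
      rw [hΦ.eq_add_of_const hu hL (sub_nonneg.2 hs)]
      field_simp
      ring
    · refine Measure.map_congr ?_
      filter_upwards [ae_restrict_mem (hΦ.measurableSet_exitedSet hu L T)] with q hq
      have h := (hΦ.mem_exitedSet_iff hu hq.2.1).1 hq
      simp only [Function.comp_apply]
      rw [hΦ.flow_after_hit hu hL (by linarith) h.2]
      field_simp
      ring

/-- The mass that has left is carried to positions at or beyond `L`, so it is not seen to the left
of `L`. -/
theorem eq_restrict_add_dirac (hu : IsLineField u K M) (hΦ : IsSemiflow u Φ)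
    (hμ : μ (Ioi L) = 0)
    (hrep : μ + (ν.restrict (Iic t)).map (fun s => Φ (t - s) L) = transported Φ lam t) :
    μ = (transported Φ lam t).restrict (Iio L) + μ {L} • Measure.dirac L := by
  have hflow := (hΦ.continuous_flow_sub hu t L).measurable
  rw [← hrep, Measure.restrict_add, Measure.restrict_map hflow measurableSet_Iio,
    show (fun s => Φ (t - s) L) ⁻¹' Iio L = ∅ from
      eq_empty_of_forall_notMem fun s hs => not_le.2 hs (hΦ.self_le hu _ _),
    Measure.restrict_empty, Measure.map_zero, add_zero, ← restrict_Ici_eq_dirac hμ,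
    ← compl_Iio, Measure.restrict_add_restrict_compl measurableSet_Iio]

/-- If `u L > 0`, mass at `L` at time `t` has arrival time exactly `t`, and a finite law has only
countably many atoms. If `u L = 0`, no mass is at `L` at any time. -/
theorem ae_apply_singleton_eq_zero [IsFiniteMeasure lam] (hu : IsLineField u K M)
    (hΦ : IsSemiflow u Φ) (hL : ∀ y, L ≤ y → u y = u L) (hne : u L = 0 → ∀ᵐ q ∂lam, q.1 ≠ L) :
    ∀ᵐ t, transported Φ lam t {L} = 0 := by
  have happ : ∀ t, transported Φ lam t {L}
      = lam ((fun q : ℝ × ℝ => Φ (t - q.2) q.1) ⁻¹' {L} ∩ {q | q.2 ≤ t}) := fun t => by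
    rw [transported, Measure.map_apply (hΦ.measurable_flow_sub hu t) (measurableSet_singleton L),
      Measure.restrict_apply (hΦ.measurable_flow_sub hu t (measurableSet_singleton L))]
  rcases (hu.nonneg L).eq_or_lt with h0 | hpos
  · refine Eventually.of_forall fun t => ?_
    rw [happ]
    refine measure_mono_null (fun q hq => ?_) (ae_iff.1 (hne h0.symm))
    rw [mem_ofPred_eq, not_not]
    exact hΦ.eq_of_flow_eq hu hL h0.symm hq.1
  · have hm := hΦ.measurable_exitTime hu L
    have hc : {t | 0 < lam.map (fun q => q.2 + hitTime Φ L q.1) {t}}.Countable :=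
      Measure.countable_meas_pos_of_disjoint_iUnion (fun t => measurableSet_singleton t)
        (fun s t hst => by simpa using hst)
    filter_upwards [hc.ae_notMem volume] with t ht
    simp only [not_lt, nonpos_iff_eq_zero] at ht
    rw [Measure.map_apply hm (measurableSet_singleton t)] at ht
    rw [happ]
    refine measure_mono_null (fun q hq => ?_) ht
    have h1 : Φ (t - q.2) q.1 = L := hq.1
    have h2 : 0 ≤ t - q.2 := sub_nonneg.2 hq.2
    have h3 := hΦ.flow_after_hit hu hL (IsSemiflow.hitTime_le h2 h1) (hΦ.flow_hitTime hu h2 h1)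
    rw [h1] at h3
    have h4 : (t - q.2 - hitTime Φ L q.1) * u L = 0 := by linarith
    have h5 := (mul_eq_zero.1 h4).resolve_right hpos.ne'
    simp only [mem_preimage, mem_singleton_iff]
    linarith

/-- The mass that stays in an open lower set is right continuous in time. -/
theorem tendsto_integral_transported [IsFiniteMeasure lam] (hu : IsLineField u K M)
    (hΦ : IsSemiflow u Φ) {A : Set ℝ} (hA : IsOpen A) (hA' : IsLowerSet A) {ψ : ℝ → ℝ}
    (hψ : Continuous ψ) {C : ℝ} (hC : ∀ x, |ψ x| ≤ C) (t : ℝ) :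
    Tendsto (fun s => ∫ y in A, ψ y ∂(transported Φ lam s)) (𝓝[≥] t)
      (𝓝 (∫ y in A, ψ y ∂(transported Φ lam t))) := by
  have hflow := fun s => hΦ.measurable_flow_sub hu s
  set S : ℝ → Set (ℝ × ℝ) := fun s =>
    (fun q : ℝ × ℝ => Φ (s - q.2) q.1) ⁻¹' A ∩ {q | q.2 ≤ s} with hS
  have hSm : ∀ s, MeasurableSet (S s) := fun s =>
    (hflow s hA.measurableSet).inter (measurableSet_snd_le s)
  have hform : ∀ s, ∫ y in A, ψ y ∂(transported Φ lam s)
      = ∫ q, (S s).indicator (fun q => ψ (Φ (s - q.2) q.1)) q ∂lam := by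
    intro s
    rw [hΦ.restrict_transported hu hA.measurableSet,
      integral_map (hflow s).aemeasurable hψ.aestronglyMeasurable, integral_indicator (hSm s)]
  simp only [hform]
  refine tendsto_integral_filter_of_dominated_convergence (fun _ => C)
    (Eventually.of_forall fun s =>
      ((hψ.measurable.comp (hflow s)).indicator (hSm s)).aestronglyMeasurable)
    (Eventually.of_forall fun s => Eventually.of_forall fun q =>
      (norm_indicator_le_norm_self (fun q : ℝ × ℝ => ψ (Φ (s - q.2) q.1)) q).trans (hC _))
    (integrable_const C) (Eventually.of_forall fun q => ?_)
  have hc : Continuous fun s => Φ (s - q.2) q.1 := (hΦ.continuous_time hu q.1).comp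
    (by fun_prop : Continuous fun s : ℝ => s - q.2)
  -- For each entry there are three cases: it enters after `t`, hence after all nearby times; it is
  -- in the open set `A` at time `t` and stays there for a while; or it is outside the lower set `A`
  -- and, moving to the right, never comes back.
  rcases lt_or_ge t q.2 with h | h
  · have h1 : ∀ s, s < q.2 → (S s).indicator (fun q => ψ (Φ (s - q.2) q.1)) q = 0 := fun s hs =>
      indicator_of_notMem (fun hq => not_le.2 hs hq.2) _
    rw [h1 t h]
    refine tendsto_const_nhds.congr' ?_
    filter_upwards [nhdsWithin_le_nhds (Iio_mem_nhds h)] with s hs using (h1 s hs).symm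
  · by_cases hq : Φ (t - q.2) q.1 ∈ A
    · rw [indicator_of_mem (show q ∈ S t from ⟨hq, h⟩)]
      refine ((hψ.comp hc).continuousWithinAt (s := Ici t) (x := t)).tendsto.congr' ?_
      filter_upwards [nhdsWithin_le_nhds (hc.continuousAt.preimage_mem_nhds (hA.mem_nhds hq)),
        self_mem_nhdsWithin] with s hs hts
      exact (indicator_of_mem (show q ∈ S s from ⟨hs, h.trans hts⟩)
        (fun q : ℝ × ℝ => ψ (Φ (s - q.2) q.1))).symm
    · rw [indicator_of_notMem (fun h' => hq h'.1)]
      refine tendsto_const_nhds.congr' ?_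
      filter_upwards [self_mem_nhdsWithin] with s (hts : t ≤ s)
      have hs : q ∉ S s := fun h' => hq ?_
      · exact (indicator_of_notMem hs (fun q : ℝ × ℝ => ψ (Φ (s - q.2) q.1))).symm
      exact hA' (hΦ.monotoneOn hu q.1 (mem_Ici.2 (sub_nonneg.2 h))
        (mem_Ici.2 (sub_nonneg.2 (h.trans hts))) (by linarith)) h'.1

end

/-! ### Flow maps and exit times on the arcs -/

namespace ArcShape

variable {V : Type*} {a : ArcShape V}

theorem clamp_of_mem {x : ℝ} (hx : x ∈ a.dom) : a.clamp x = x := by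
  cases a with
  | bounded i k L => simp only [clamp, min_eq_left hx.2, max_eq_right hx.1]
  | outRay i => exact max_eq_right hx
  | inRay i => exact min_eq_left hx

theorem measurableSet_dom (a : ArcShape V) : MeasurableSet a.dom := by
  cases a with
  | bounded i k L => exact measurableSet_Icc
  | outRay i => exact measurableSet_Ici
  | inRay i => exact measurableSet_Iic

theorem zero_mem_dom (h : ∀ i k L, a = bounded i k L → 0 < L) : (0 : ℝ) ∈ a.dom := by
  cases a with
  | bounded i k L => exact ⟨le_rfl, (h i k L rfl).le⟩
  | outRay i => exact le_refl (0 : ℝ)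
  | inRay i => exact le_refl (0 : ℝ)

theorem endCoord_mem_dom (h : ∀ i k L, a = bounded i k L → 0 < L) : a.endCoord ∈ a.dom := by
  cases a with
  | bounded i k L => exact ⟨(h i k L rfl).le, le_rfl⟩
  | outRay i => exact le_refl (0 : ℝ)
  | inRay i => exact le_refl (0 : ℝ)

theorem le_endCoord (ht : a.terminus ≠ none) {x : ℝ} (hx : x ∈ a.dom) : x ≤ a.endCoord := by
  cases a with
  | bounded i k L => exact hx.2
  | outRay i => exact absurd rfl ht
  | inRay i => exact hx

theorem clamp_eq_endCoord (h : ∀ i k L, a = bounded i k L → 0 < L) (ht : a.terminus ≠ none)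
    {y : ℝ} (hy : a.endCoord ≤ y) : a.clamp y = a.endCoord := by
  cases a with
  | bounded i k L =>
    simp only [endCoord] at hy
    simp only [clamp, endCoord, min_eq_right hy, max_eq_right (h i k L rfl).le]
  | outRay i => exact absurd rfl ht
  | inRay i => exact min_eq_right hy

theorem endCoord_pos (h : ∀ i k L, a = bounded i k L → 0 < L) (ho : a.origin ≠ none)
    (ht : a.terminus ≠ none) : 0 < a.endCoord := by
  cases a with
  | bounded i k L => exact h i k L rfl
  | outRay i => exact absurd rfl ht
  | inRay i => exact absurd rfl ho

theorem mem_dom_of_le {x y : ℝ} (hx : x ∈ a.dom) (hxy : x ≤ y)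
    (hy : a.terminus ≠ none → y ≤ a.endCoord) : y ∈ a.dom := by
  cases a with
  | bounded i k L => exact ⟨hx.1.trans hxy, hy (by simp [terminus])⟩
  | outRay i => exact le_trans hx hxy
  | inRay i => exact hy (by simp [terminus])

end ArcShape

/-- By uniqueness, the choice made in `arcFlow` is determined and does not depend on the length of
the time interval. -/
theorem Network.IsCurve.eq_of_le {u : ℝ → ℝ} {K : NNReal} (hu : LipschitzWith K u) {x τ τ' : ℝ} {c c' : ℝ → ℝ}
    (hc : Network.IsCurve u x τ c) (hc' : Network.IsCurve u x τ' c') (hτ : 0 ≤ τ) (h : τ ≤ τ') :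
    c τ = c' τ := by
  have hd : ∀ {σ : ℝ} {b : ℝ → ℝ}, Network.IsCurve u x σ b → ∀ r ∈ Ico 0 σ,
      HasDerivWithinAt b (u (b r)) (Ici r) r := fun hb r hr =>
    (hb.2 r ⟨hr.1, hr.2.le⟩).mono_of_mem_nhdsWithin
      (mem_of_superset (Icc_mem_nhdsGE hr.2) (Icc_subset_Icc_left hr.1))
  exact ODE_solution_unique_of_mem_Icc_right (v := fun _ => u) (s := fun _ => univ)
    (fun _ _ => hu.lipschitzOnWith) (fun r hr => (hc.2 r hr).continuousWithinAt)
    (hd hc) (fun _ _ => trivial)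
    (fun r hr => (hc'.2 r ⟨hr.1, hr.2.trans h⟩).continuousWithinAt.mono (Icc_subset_Icc_right h))
    (fun r hr => hd hc' r ⟨hr.1, hr.2.trans_le h⟩) (fun _ _ => trivial)
    (hc.1.trans hc'.1.symm) ⟨hτ, le_rfl⟩

namespace Network

variable {V J : Type*} {d : ℕ} (N : Network V J d) {v : J → ℝ → ℝ}

/-- The semiflow of the extended velocity on the arc `j`. -/
noncomputable def flow (v : J → ℝ → ℝ) (j : J) (r x : ℝ) : ℝ :=
  if 0 ≤ r then N.arcFlow v j x 0 r else x

variable {N}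

theorem IsVelocity.exists_isLineField (hv : N.IsVelocity v) :
    ∃ (K : NNReal) (M : ℝ), ∀ j, IsLineField (N.extVelocity v j) K M := by
  obtain ⟨M, hM, hb⟩ := hv.bounded
  obtain ⟨K, hK⟩ := hv.lipschitz
  have hmem : ∀ j y, (N.arc j).clamp y ∈ (N.arc j).dom := fun j =>
    (N.arc j).clamp_mem (N.length_pos j)
  refine ⟨K, M, fun j => ⟨LipschitzWith.of_dist_le_mul fun y z => ?_,
    fun x => hv.nonneg j _ (hmem j x), fun x => hb j _ (hmem j x)⟩⟩
  refine ((hK j).dist_le_mul _ (hmem j y) _ (hmem j z)).trans ?_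
  rw [Real.dist_eq, Real.dist_eq]
  exact mul_le_mul_of_nonneg_left ((N.arc j).abs_clamp_sub_le y z) K.coe_nonneg

theorem extVelocity_of_mem {j : J} {x : ℝ} (hx : x ∈ (N.arc j).dom) :
    N.extVelocity v j x = v j x := by
  rw [extVelocity, ArcShape.clamp_of_mem hx]

theorem extVelocity_const {j : J} (ht : (N.arc j).terminus ≠ none) {y : ℝ}
    (hy : (N.arc j).endCoord ≤ y) :
    N.extVelocity v j y = N.extVelocity v j (N.arc j).endCoord := by
  rw [extVelocity, extVelocity, ArcShape.clamp_eq_endCoord (N.length_pos j) ht hy,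
    ArcShape.clamp_eq_endCoord (N.length_pos j) ht le_rfl]

theorem IsVelocity.arcFlow_eq_of_isCurve (hv : N.IsVelocity v) {j : J} {x s t τ : ℝ} {c : ℝ → ℝ}
    (hc : IsCurve (N.extVelocity v j) x τ c) (hst : s ≤ t) (ht : t - s ≤ τ) :
    N.arcFlow v j x s t = c (t - s) := by
  obtain ⟨K, M, hu⟩ := hv.exists_isLineField
  obtain ⟨b, hb, hbt⟩ := hv.arcFlow_spec j x hst
  rw [← hbt]
  exact IsCurve.eq_of_le (hu j).lipschitz hb hc (sub_nonneg.2 hst) ht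

/-- For each time, `arcFlow` refers to a curve on its own interval. By uniqueness these values lie
on one curve, defined up to time `r + 1`, which has the required derivative at `r`. -/
theorem IsVelocity.isSemiflow (hv : N.IsVelocity v) (j : J) :
    IsSemiflow (N.extVelocity v j) (N.flow v j) := by
  have hflow : ∀ x τ c, IsCurve (N.extVelocity v j) x τ c → ∀ r ∈ Icc 0 τ,
      N.flow v j r x = c r := by
    intro x τ c hc r hr
    rw [flow, if_pos hr.1, hv.arcFlow_eq_of_isCurve hc hr.1 (by simpa using hr.2), sub_zero]
  refine ⟨fun r hr x => ?_, fun x r hr => ?_⟩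
  · rcases hr.eq_or_lt with rfl | hr
    · obtain ⟨c, hc⟩ := hv.exists_isCurve j x (le_refl 0)
      rw [hflow x 0 c hc 0 ⟨le_rfl, le_rfl⟩, hc.1]
    · rw [flow, if_neg (not_le.2 hr)]
  · obtain ⟨c, hc⟩ := hv.exists_isCurve j x (show 0 ≤ r + 1 by linarith)
    have h := (hc.2 r ⟨hr, by linarith⟩)
    rw [← hflow x _ c hc r ⟨hr, by linarith⟩] at h
    have h2 := h.congr (fun q hq => hflow x _ c hc q hq) (hflow x _ c hc r ⟨hr, by linarith⟩)
    refine h2.mono_of_mem_nhdsWithin ?_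
    rw [← Ici_inter_Iic]
    exact inter_mem_nhdsWithin _ (Iic_mem_nhds (by linarith))

theorem IsVelocity.arcFlow_eq_flow (hv : N.IsVelocity v) {j : J} {x s t : ℝ} (hst : s ≤ t) :
    N.arcFlow v j x s t = N.flow v j (t - s) x := by
  obtain ⟨c, hc⟩ := hv.exists_isCurve j x (sub_nonneg.2 hst)
  rw [flow, if_pos (sub_nonneg.2 hst), hv.arcFlow_eq_of_isCurve hc hst le_rfl,
    hv.arcFlow_eq_of_isCurve hc (sub_nonneg.2 hst) (by simp), sub_zero]

theorem IsVelocity.exitSet_eq (hv : N.IsVelocity v) {j : J} (ht : (N.arc j).terminus ≠ none)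
    (x s : ℝ) : N.exitSet v j x s
      = {r | s ≤ r ∧ N.flow v j (r - s) x = (N.arc j).endCoord} := by
  ext r
  simp only [exitSet, mem_ofPred_eq, ht, ne_eq, not_false_eq_true, true_and]
  exact and_congr_right fun h => by rw [hv.arcFlow_eq_flow h]

/-- An arc without terminal vertex is never left. Otherwise this is the order criterion
`exists_hit_iff`, shifted by the starting time. -/
theorem IsVelocity.exitsBy_iff (hv : N.IsVelocity v) {j : J} {x s t : ℝ} :
    N.ExitsBy v j x s t ↔
      (N.arc j).terminus ≠ none ∧ (x, s) ∈ exitedSet (N.flow v j) (N.arc j).endCoord t := by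
  obtain ⟨K, M, hu⟩ := hv.exists_isLineField
  by_cases ht : (N.arc j).terminus = none
  · simp [ExitsBy, exitSet, ht]
  have hh := (hv.isSemiflow j).exists_hit_iff (hu j) (L := (N.arc j).endCoord) (t := t - s) (x := x)
  rw [ExitsBy, hv.exitSet_eq ht]
  simp only [exitedSet, mem_ofPred_eq, ne_eq, ht, not_false_eq_true, true_and]
  rw [← sub_nonneg, ← hh]
  constructor
  · rintro ⟨r, ⟨h1, h2⟩, h3⟩
    exact ⟨r - s, ⟨sub_nonneg.2 h1, h2⟩, by linarith⟩
  · rintro ⟨r, ⟨h1, h2⟩, h3⟩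
    exact ⟨r + s, ⟨by linarith, by simpa using h2⟩, by linarith⟩

theorem IsVelocity.exitTime_eq (hv : N.IsVelocity v) {j : J} {x s t : ℝ}
    (h : N.ExitsBy v j x s t) :
    N.exitTime v j x s = s + hitTime (N.flow v j) (N.arc j).endCoord x := by
  obtain ⟨K, M, hu⟩ := hv.exists_isLineField
  have hex := hv.exitsBy_iff.1 h
  have hhit := ((hv.isSemiflow j).mem_exitedSet_iff (hu j) hex.2.2.1).1 hex.2
  rw [exitTime, hv.exitSet_eq hex.1]
  refine IsLeast.csInf_eq ⟨⟨?_, by simpa using hhit.2⟩, fun r hr => ?_⟩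
  · linarith [IsSemiflow.hitTime_nonneg (N.flow v j) (N.arc j).endCoord x]
  · have := IsSemiflow.hitTime_le (sub_nonneg.2 hr.1) hr.2
    linarith

/-- The exit time is between the starting time and the present time. -/
theorem IsVelocity.exitTime_mem (hv : N.IsVelocity v) {j : J} {x s t : ℝ}
    (h : N.ExitsBy v j x s t) : N.exitTime v j x s ∈ Icc s t := by
  obtain ⟨K, M, hu⟩ := hv.exists_isLineField
  have hex := hv.exitsBy_iff.1 h
  have hhit := ((hv.isSemiflow j).mem_exitedSet_iff (hu j) hex.2.2.1).1 hex.2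
  rw [hv.exitTime_eq h]
  exact ⟨by linarith [IsSemiflow.hitTime_nonneg (N.flow v j) (N.arc j).endCoord x], hhit.1⟩

theorem IsVelocity.flow_mem_dom (hv : N.IsVelocity v) {j : J} {x s t : ℝ}
    (hx : x ∈ (N.arc j).dom) (hst : s ≤ t) (h : ¬ N.ExitsBy v j x s t) :
    N.flow v j (t - s) x ∈ (N.arc j).dom := by
  obtain ⟨K, M, hu⟩ := hv.exists_isLineField
  refine ArcShape.mem_dom_of_le hx ((hv.isSemiflow j).self_le (hu j) _ _) fun ht => ?_
  by_contra hlt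
  exact h (hv.exitsBy_iff.2 ⟨ht, hst, ArcShape.le_endCoord ht hx, (not_le.1 hlt).le⟩)

theorem Follows.terminus_ne {j k : J} (h : N.Follows j k) : (N.arc j).terminus ≠ none := by
  obtain ⟨i, h1, -⟩ := h
  simp [h1]

/-- The parametrization of an arc, extended by constants. -/
noncomputable def extParam (N : Network V J d) (j : J) (x : ℝ) : EuclideanSpace ℝ (Fin d) :=
  N.param j ((N.arc j).clamp x)

/-- Nothing is known of `param` outside the parameter interval. The extension is continuous on the
whole line, so push-forwards along it need no care. -/
theorem continuous_extParam (j : J) : Continuous (N.extParam j) := by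
  refine (N.param_smooth j).continuousOn.comp_continuous ?_
    ((N.arc j).clamp_mem (N.length_pos j))
  exact (LipschitzWith.of_dist_le_mul (K := 1) fun x y => by
    simpa [Real.dist_eq] using (N.arc j).abs_clamp_sub_le x y).continuous

theorem extParam_of_mem {j : J} {x : ℝ} (hx : x ∈ (N.arc j).dom) :
    N.extParam j x = N.param j x := by
  rw [extParam, ArcShape.clamp_of_mem hx]

/-- This is the only use of bounded variation: a difference of monotone functions is measurable. As
`p` is arbitrary outside `[0, T]`, a measurable function agreeing with it on `[0, T]` is provided.
-/
theorem IsDistribution.exists_measurable [Fintype J] {T : ℝ} {p : ℝ → J → J → ℝ} (hT : 0 ≤ T)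
    (hp : N.IsDistribution T p) (k j : J) :
    ∃ g : ℝ → ℝ, Measurable g ∧ ∀ t ∈ Icc 0 T, g t = p t k j := by
  obtain ⟨f₁, f₂, h1, h2, h3⟩ :=
    (hp.bv k j).locallyBoundedVariationOn.exists_monotoneOn_sub_monotoneOn
  have hext : ∀ f : ℝ → ℝ, MonotoneOn f (Icc 0 T) → ∃ g, Monotone g ∧ EqOn f g (Icc 0 T) :=
    fun f hf => hf.exists_monotone_extension
      ⟨f 0, by rintro _ ⟨x, hx, rfl⟩; exact hf ⟨le_rfl, hT⟩ hx hx.1⟩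
      ⟨f T, by rintro _ ⟨x, hx, rfl⟩; exact hf hx ⟨hT, le_rfl⟩ hx.2⟩
  obtain ⟨g₁, hg1, he1⟩ := hext f₁ h1
  obtain ⟨g₂, hg2, he2⟩ := hext f₂ h2
  refine ⟨g₁ - g₂, hg1.measurable.sub hg2.measurable, fun t ht => ?_⟩
  have := congrFun h3 t
  rw [this, Pi.sub_apply, Pi.sub_apply, ← he1 ht, ← he2 ht]

end Network

/-! ### Sums over paths -/

/-- A path either ends on its starting arc (the empty list) or is split at its first junction. -/
theorem ENNReal.tsum_list {α : Type*} [Fintype α] (f : List α → ENNReal) :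
    ∑' l, f l = f [] + ∑ a, ∑' l, f (a :: l) := by
  classical
  have hinj : Function.Injective fun q : α × List α => q.1 :: q.2 := fun q q' h => by
    simpa [Prod.ext_iff] using h
  rw [tsum_eq_add_tsum_ite [], ← hinj.tsum_eq, ENNReal.tsum_prod', tsum_fintype]
  · simp
  · rintro (_ | ⟨a, l⟩) h
    · simp at h
    · exact ⟨(a, l), rfl⟩

namespace Network

variable {V J : Type*} {d : ℕ} {N : Network V J d} {v : J → ℝ → ℝ}
  {p : ℝ → J → J → ℝ} {T t : ℝ}

open Classical in
/-- The contribution of a single path to `pathSum`. -/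
noncomputable def pathTerm (N : Network V J d) (v : J → ℝ → ℝ) (p : ℝ → J → J → ℝ) (t : ℝ)
    (B : Set (EuclideanSpace ℝ (Fin d))) (j : J) (x s : ℝ) (l : List J) : ENNReal :=
  if N.IsPathUpTo v j x s l t then
    ENNReal.ofReal (N.pathWeight v p j x s l) * B.indicator 1 (N.pathFlow v j x s l t)
  else 0

theorem pathSum_apply {B : Set (EuclideanSpace ℝ (Fin d))} (hB : MeasurableSet B) (j : J)
    (x s : ℝ) : N.pathSum v p j x s t B = ∑' l, N.pathTerm v p t B j x s l := by
  rw [pathSum, Measure.sum_apply _ hB]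
  refine tsum_congr fun l => ?_
  rw [pathTerm]
  split_ifs
  · rw [Measure.smul_apply, Measure.dirac_apply' _ hB, smul_eq_mul]
  · rfl

theorem pathTerm_nil_of_exitsBy {B : Set (EuclideanSpace ℝ (Fin d))} {j : J} {x s : ℝ}
    (h : N.ExitsBy v j x s t) : N.pathTerm v p t B j x s [] = 0 := by
  rw [pathTerm, if_neg]
  simpa [IsPathUpTo] using h

theorem pathTerm_nil {B : Set (EuclideanSpace ℝ (Fin d))} {j : J} {x s : ℝ}
    (h : ¬ N.ExitsBy v j x s t) :
    N.pathTerm v p t B j x s [] = B.indicator 1 (N.param j (N.arcFlow v j x s t)) := by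
  rw [pathTerm, if_pos (by simpa [IsPathUpTo] using h)]
  simp [pathWeight, pathFlow]

theorem pathTerm_cons_of_not_exitsBy {B : Set (EuclideanSpace ℝ (Fin d))} {j k : J} {x s : ℝ}
    {l : List J} (h : ¬ N.ExitsBy v j x s t) : N.pathTerm v p t B j x s (k :: l) = 0 := by
  rw [pathTerm, if_neg]
  simp [IsPathUpTo, h]

/-- The recursion at the first junction. No condition that `k` follows `j` is needed, because the
coefficient vanishes otherwise. -/
theorem pathTerm_cons [Fintype J] (hv : N.IsVelocity v) (hp : N.IsDistribution T p) (htT : t ≤ T)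
    {B : Set (EuclideanSpace ℝ (Fin d))} {j k : J} {x s : ℝ} (hs : 0 ≤ s) {l : List J}
    (h : N.ExitsBy v j x s t) : N.pathTerm v p t B j x s (k :: l)
      = ENNReal.ofReal (p (N.exitTime v j x s) j k)
        * N.pathTerm v p t B k 0 (N.exitTime v j x s) l := by
  have hmem := hv.exitTime_mem h
  have hT : N.exitTime v j x s ∈ Icc 0 T := ⟨hs.trans hmem.1, hmem.2.trans htT⟩
  by_cases hf : N.Follows j k
  · have hiff : N.IsPathUpTo v j x s (k :: l) t
        ↔ N.IsPathUpTo v k 0 (N.exitTime v j x s) l t := by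
      simp only [IsPathUpTo, h, hf, true_and]
    rw [pathTerm, pathTerm]
    by_cases hl : N.IsPathUpTo v k 0 (N.exitTime v j x s) l t
    · rw [if_pos hl, if_pos (hiff.2 hl), pathWeight, pathFlow,
        ENNReal.ofReal_mul (hp.nonneg _ hT j k), mul_assoc]
    · rw [if_neg hl, if_neg (fun h' => hl (hiff.1 h')), mul_zero]
  · rw [hp.eq_zero _ hT j k hf, pathTerm, if_neg (by simp [IsPathUpTo, hf])]
    simp

theorem pathSum_apply_of_not_exitsBy [Fintype J] {B : Set (EuclideanSpace ℝ (Fin d))}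
    (hB : MeasurableSet B) {j : J} {x s : ℝ} (h : ¬ N.ExitsBy v j x s t) :
    N.pathSum v p j x s t B = B.indicator 1 (N.param j (N.arcFlow v j x s t)) := by
  rw [pathSum_apply hB, ENNReal.tsum_list, pathTerm_nil h]
  simp [pathTerm_cons_of_not_exitsBy h]

theorem pathSum_apply_of_exitsBy [Fintype J] (hv : N.IsVelocity v) (hp : N.IsDistribution T p)
    (htT : t ≤ T) {B : Set (EuclideanSpace ℝ (Fin d))} (hB : MeasurableSet B) {j : J} {x s : ℝ}
    (hs : 0 ≤ s) (h : N.ExitsBy v j x s t) :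
    N.pathSum v p j x s t B = ∑ k, ENNReal.ofReal (p (N.exitTime v j x s) j k)
      * N.pathSum v p k 0 (N.exitTime v j x s) t B := by
  rw [pathSum_apply hB, ENNReal.tsum_list, pathTerm_nil_of_exitsBy h, zero_add]
  refine Finset.sum_congr rfl fun k _ => ?_
  simp only [pathTerm_cons hv hp htT hs h, ENNReal.tsum_mul_left, pathSum_apply hB]

theorem IsDistribution.sum_ofReal [Fintype J] (hp : N.IsDistribution T p) (ht : t ∈ Icc 0 T)
    {j : J} (hj : (N.arc j).terminus ≠ none) : ∑ k, ENNReal.ofReal (p t j k) = 1 := by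
  obtain ⟨i, hi⟩ := Option.ne_none_iff_exists'.1 hj
  rw [← ENNReal.ofReal_sum_of_nonneg fun k _ => hp.nonneg t ht j k, hp.sum_eq_one t ht j i hi,
    ENNReal.ofReal_one]

/-- Truncating by length allows an induction on the number of junctions. The coefficients at a
vertex sum to one, so a first step preserves the bound. -/
theorem tsum_pathTerm_length_lt_le [Fintype J] (hv : N.IsVelocity v) (hp : N.IsDistribution T p)
    (htT : t ≤ T) (n : ℕ) : ∀ (j : J) (x s : ℝ), 0 ≤ s →
      ∑' l : List J, (if l.length < n then N.pathTerm v p t univ j x s l else 0) ≤ 1 := by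
  induction n with
  | zero => intro j x s _; simp
  | succ n ih =>
    intro j x s hs
    rw [ENNReal.tsum_list]
    by_cases h : N.ExitsBy v j x s t
    · have hmem := hv.exitTime_mem h
      have hT : N.exitTime v j x s ∈ Icc 0 T := ⟨hs.trans hmem.1, hmem.2.trans htT⟩
      simp only [pathTerm_nil_of_exitsBy h, ite_self, zero_add, List.length_cons,
        Nat.add_lt_add_iff_right, pathTerm_cons hv hp htT hs h]
      calc _ = ∑ k, ENNReal.ofReal (p (N.exitTime v j x s) j k)
            * ∑' l : List J, (if l.length < n then
                N.pathTerm v p t univ k 0 (N.exitTime v j x s) l else 0) := by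
            simp only [← ENNReal.tsum_mul_left, mul_ite, mul_zero]
        _ ≤ ∑ k, ENNReal.ofReal (p (N.exitTime v j x s) j k) * 1 := by
            gcongr with k
            exact ih k 0 _ hT.1
        _ = 1 := by
            simp only [mul_one]
            exact hp.sum_ofReal hT (hv.exitsBy_iff.1 h).1
    · simp [pathTerm_cons_of_not_exitsBy h, pathTerm_nil h]

/-- The paths of a finite set have bounded length, so the truncated bound passes to the supremum of
the finite sums. -/
theorem pathSum_le_one [Fintype J] (hv : N.IsVelocity v) (hp : N.IsDistribution T p)
    (htT : t ≤ T) (B : Set (EuclideanSpace ℝ (Fin d))) (j : J) (x : ℝ) {s : ℝ} (hs : 0 ≤ s) :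
    N.pathSum v p j x s t B ≤ 1 := by
  refine (measure_mono (subset_univ B)).trans ?_
  rw [pathSum_apply MeasurableSet.univ, ENNReal.tsum_eq_iSup_sum]
  refine iSup_le fun F => ?_
  refine le_trans ?_
    (tsum_pathTerm_length_lt_le hv hp htT (F.sup List.length + 1) j x s hs)
  refine le_trans (le_of_eq ?_) (ENNReal.sum_le_tsum F)
  refine Finset.sum_congr rfl fun l hl => ?_
  rw [if_pos (Nat.lt_succ_of_le (Finset.le_sup (f := List.length) hl))]

open Classical in
-- Induction along the path, with the first exit time as the new starting time. Agreement is
-- required only for positions on the arc and times in `[0, t]`, where the parametrizations and `p`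
-- are controlled.
theorem exists_measurable_pathTerm [Fintype J] (hv : N.IsVelocity v) (hp : N.IsDistribution T p)
    (hT : 0 ≤ T) (htT : t ≤ T) {B : Set (EuclideanSpace ℝ (Fin d))} (hB : MeasurableSet B)
    (l : List J) : ∀ j, ∃ h : ℝ × ℝ → ENNReal, Measurable h ∧
      ∀ x ∈ (N.arc j).dom, ∀ s ∈ Icc 0 t, N.pathTerm v p t B j x s l = h (x, s) := by
  obtain ⟨K, M, hu⟩ := hv.exists_isLineField
  induction l with
  | nil =>
    intro j
    refine ⟨fun q => if (N.arc j).terminus ≠ none ∧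
        q ∈ exitedSet (N.flow v j) (N.arc j).endCoord t then 0 else
        B.indicator 1 (N.extParam j (N.flow v j (t - q.2) q.1)), ?_, fun x hx s hs => ?_⟩
    · refine Measurable.ite ?_ measurable_const ?_
      · exact MeasurableSet.inter (MeasurableSet.const _)
          ((hv.isSemiflow j).measurableSet_exitedSet (hu j) _ _)
      · exact (measurable_one.indicator hB).comp ((continuous_extParam j).measurable.comp
          ((hv.isSemiflow j).measurable_flow_sub (hu j) t))
    · simp only [← hv.exitsBy_iff]
      split_ifs with h
      · exact pathTerm_nil_of_exitsBy h
      · rw [pathTerm_nil h, hv.arcFlow_eq_flow hs.2, extParam_of_mem (hv.flow_mem_dom hx hs.2 h)]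
  | cons k l ih =>
    intro j
    obtain ⟨h, hm, hh⟩ := ih k
    obtain ⟨g, hgm, hg⟩ := hp.exists_measurable hT j k
    set θ : ℝ × ℝ → ℝ := fun q => q.2 + hitTime (N.flow v j) (N.arc j).endCoord q.1 with hθ
    have hθm : Measurable θ := (hv.isSemiflow j).measurable_exitTime (hu j) _
    refine ⟨fun q => if N.Follows j k ∧
        q ∈ exitedSet (N.flow v j) (N.arc j).endCoord t then
        ENNReal.ofReal (g (θ q)) * h (0, θ q) else 0, ?_, fun x hx s hs => ?_⟩
    · refine Measurable.ite ?_ ?_ measurable_const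
      · exact MeasurableSet.inter (MeasurableSet.const _)
          ((hv.isSemiflow j).measurableSet_exitedSet (hu j) _ _)
      · exact (hgm.comp hθm).ennreal_ofReal.mul (hm.comp (measurable_const.prodMk hθm))
    · by_cases hf : N.Follows j k
      · simp only [hf, true_and]
        have hex : (x, s) ∈ exitedSet (N.flow v j) (N.arc j).endCoord t ↔ N.ExitsBy v j x s t := by
          rw [hv.exitsBy_iff]
          simp [hf.terminus_ne]
        rw [hex]
        split_ifs with he
        · have hmem := hv.exitTime_mem he
          have hθe : θ (x, s) = N.exitTime v j x s := (hv.exitTime_eq he).symm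
          rw [pathTerm_cons hv hp htT hs.1 he, hθe,
            hg _ ⟨hs.1.trans hmem.1, hmem.2.trans htT⟩,
            hh 0 (ArcShape.zero_mem_dom (N.length_pos k)) _ ⟨hs.1.trans hmem.1, hmem.2⟩]
        · exact pathTerm_cons_of_not_exitsBy he
      · simp only [hf, false_and, if_false]
        rw [pathTerm, if_neg (by simp [IsPathUpTo, hf])]

theorem exists_measurable_pathSum [Fintype J] (hv : N.IsVelocity v) (hp : N.IsDistribution T p)
    (hT : 0 ≤ T) (htT : t ≤ T) {B : Set (EuclideanSpace ℝ (Fin d))} (hB : MeasurableSet B)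
    (j : J) : ∃ h : ℝ × ℝ → ENNReal, Measurable h ∧
      ∀ x ∈ (N.arc j).dom, ∀ s ∈ Icc 0 t, N.pathSum v p j x s t B = h (x, s) := by
  choose h hm hh using fun l => exists_measurable_pathTerm hv hp hT htT hB l j
  refine ⟨fun q => ∑' l, h l q, Measurable.tsum fun l => hm l, fun x hx s hs => ?_⟩
  rw [pathSum_apply hB]
  exact tsum_congr fun l => hh l x hx s hs

/-- The pushed forward measures along a measurable family of entries are integrals. -/
theorem bind_pathSum_apply [Fintype J] (hv : N.IsVelocity v) (hp : N.IsDistribution T p)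
    (hT : 0 ≤ T) (htT : t ≤ T) {B : Set (EuclideanSpace ℝ (Fin d))} (hB : MeasurableSet B)
    (j : J) {μ : Measure ℝ} {e : ℝ → ℝ × ℝ} (he : Measurable e)
    (hμ : ∀ᵐ a ∂μ, (e a).1 ∈ (N.arc j).dom ∧ (e a).2 ∈ Icc 0 t) :
    (μ.bind fun a => N.pathSum v p j (e a).1 (e a).2 t) B
      = ∫⁻ a, N.pathSum v p j (e a).1 (e a).2 t B ∂μ := by
  classical
  refine Measure.bind_apply hB ?_
  -- The kernel is controlled only on admissible entries. Replacing it by `0` elsewhere gives a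
  -- measurable version.
  set S : Set ℝ := {a | (e a).1 ∈ (N.arc j).dom ∧ (e a).2 ∈ Icc 0 t} with hS
  have hSm : MeasurableSet S :=
    ((measurable_fst.comp he) (N.arc j).measurableSet_dom).inter
      ((measurable_snd.comp he) measurableSet_Icc)
  refine ⟨fun a => if a ∈ S then N.pathSum v p j (e a).1 (e a).2 t else 0, ?_, ?_⟩
  · refine Measure.measurable_of_measurable_coe _ fun B hB => ?_
    obtain ⟨h, hm, hh⟩ := exists_measurable_pathSum hv hp hT htT hB j
    have : (fun a => (if a ∈ S then N.pathSum v p j (e a).1 (e a).2 t else 0 :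
        Measure (EuclideanSpace ℝ (Fin d))) B) = fun a => if a ∈ S then h (e a) else 0 := by
      ext a
      split_ifs with ha
      · exact hh _ ha.1 _ ha.2
      · rfl
    rw [this]
    exact Measurable.ite hSm (hm.comp he) measurable_const
  · filter_upwards [hμ] with a ha
    rw [if_pos (show a ∈ S from ha)]

end Network

/-! ### Mass staying on an arc and mass leaving it -/

theorem lintegral_entryMeasure {m₀ ν : Measure ℝ} {w : ℝ × ℝ → ENNReal} (hw : Measurable w) {t : ℝ}
    (ht : 0 ≤ t) : ∫⁻ q in {q | q.2 ≤ t}, w q ∂(entryMeasure m₀ ν)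
      = ∫⁻ x, w (x, 0) ∂m₀ + ∫⁻ s in Iic t, w (0, s) ∂ν := by
  have h1 : Measurable fun x : ℝ => (x, (0 : ℝ)) := by fun_prop
  have h2 : Measurable fun s : ℝ => ((0 : ℝ), s) := by fun_prop
  rw [entryMeasure, Measure.restrict_add, lintegral_add_measure,
    Measure.restrict_map h1 (measurableSet_snd_le t),
    Measure.restrict_map h2 (measurableSet_snd_le t), lintegral_map hw h1, lintegral_map hw h2,
    show (fun x : ℝ => (x, (0 : ℝ))) ⁻¹' {q | q.2 ≤ t} = univ from by ext; simp [ht],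
    show (fun s : ℝ => ((0 : ℝ), s)) ⁻¹' {q | q.2 ≤ t} = Iic t from rfl, Measure.restrict_univ]

theorem ae_entryMeasure {m₀ ν : Measure ℝ} {P : ℝ × ℝ → Prop} (hP : MeasurableSet {q | P q})
    (h0 : ∀ᵐ x ∂m₀, P (x, 0)) (h1 : ∀ᵐ s ∂ν, P (0, s)) : ∀ᵐ q ∂(entryMeasure m₀ ν), P q := by
  rw [entryMeasure, ae_add_measure_iff]
  exact ⟨(ae_map_iff (by fun_prop) hP).2 h0, (ae_map_iff (by fun_prop) hP).2 h1⟩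

namespace Network

variable {V J : Type*} {d : ℕ} {N : Network V J d} {v : J → ℝ → ℝ}
  {p : ℝ → J → J → ℝ} {T t : ℝ} {m₀ : J → Measure ℝ} {σ : V → Measure ℝ}
  {m : ℝ → J → Measure ℝ} {νin νout : J → Measure ℝ}

/-- The extended velocity agrees with `v` on the support of the measures, so the balance on the arc
is a balance on the line. -/
theorem IsSolution.isLineSolution [Fintype V] [Fintype J] (hm₀ : N.IsArcMeasure m₀)
    (hm : N.IsSolution T v p m₀ σ m) (hν : N.AreVertexTraces T v m₀ m νin νout) (j : J) :
    IsLineSolution T (N.extVelocity v j) (N.arc j).endCoord (fun t => m t j) (m₀ j)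
      (νin j) (νout j) := by
  refine ⟨hm₀.finite j, hν.in_finite j, hν.out_finite j, hν.in_supported j, hν.out_supported j,
    fun t ht => (hm.arcMeasure t ht).finite j, hm.measurable j, hm.finite j, fun f hf hfc => ?_⟩
  rw [hν.balance j f ⟨hf, hfc⟩]
  refine setIntegral_congr_fun measurableSet_Icc fun t ht => integral_congr_ae ?_
  filter_upwards [show ∀ᵐ x ∂(m t j), x ∈ (N.arc j).dom from (hm.arcMeasure t ht).supported j]
    with x hx
  rw [transportOp, extVelocity_of_mem hx]

/-- The points of an arc except its terminal vertex. -/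
def arcInterior (N : Network V J d) (j : J) : Set ℝ :=
  {y | (N.arc j).terminus ≠ none → y < (N.arc j).endCoord}

theorem arcInterior_of_eq_none {j : J} (h : (N.arc j).terminus = none) :
    N.arcInterior j = univ := by
  simp [arcInterior, h]

theorem arcInterior_of_ne_none {j : J} (h : (N.arc j).terminus ≠ none) :
    N.arcInterior j = Iio (N.arc j).endCoord := by
  simp [arcInterior, h, Iio]

theorem isOpen_arcInterior (N : Network V J d) (j : J) : IsOpen (N.arcInterior j) := by
  by_cases h : (N.arc j).terminus = none
  · rw [arcInterior_of_eq_none h]; exact isOpen_univ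
  · rw [arcInterior_of_ne_none h]; exact isOpen_Iio

theorem isLowerSet_arcInterior (N : Network V J d) (j : J) : IsLowerSet (N.arcInterior j) :=
  fun _ _ hab ha ht => hab.trans_lt (ha ht)

/-- The mass on the arc `j` at time `t`, when mass enters it according to `m₀` and `νin`. -/
noncomputable def stay (N : Network V J d) (v : J → ℝ → ℝ) (m₀ νin : J → Measure ℝ) (j : J)
    (t : ℝ) : Measure ℝ :=
  (transported (N.flow v j) (entryMeasure (m₀ j) (νin j)) t).restrict (N.arcInterior j)

open Classical in
/-- The distribution of the times, up to `t`, at which mass leaves the arc `j`. -/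
noncomputable def leave (N : Network V J d) (v : J → ℝ → ℝ) (m₀ νin : J → Measure ℝ) (j : J)
    (t : ℝ) : Measure ℝ :=
  if (N.arc j).terminus ≠ none then
    exitLaw (N.flow v j) (N.arc j).endCoord (entryMeasure (m₀ j) (νin j)) t
  else 0

open Classical in
/-- The mass which has arrived at the terminal vertex of the arc `j` at the terminal time, and has
not been attributed to the following arcs. -/
noncomputable def endMass (N : Network V J d) (μ : J → Measure ℝ) (j : J) : ENNReal :=
  if (N.arc j).terminus ≠ none then μ j {(N.arc j).endCoord} else 0

theorem AreVertexTraces.ae_mem_dom (hm₀ : N.IsArcMeasure m₀) (hT : 0 ≤ T)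
    (hν : N.AreVertexTraces T v m₀ m νin νout) (j : J) :
    ∀ᵐ q ∂(entryMeasure (m₀ j) (νin j)), q.1 ∈ (N.arc j).dom ∧ q.2 ∈ Icc 0 T := by
  refine ae_entryMeasure ?_ ?_ ?_
  · exact (measurable_fst (N.arc j).measurableSet_dom).inter (measurable_snd measurableSet_Icc)
  · filter_upwards [show ∀ᵐ x ∂(m₀ j), x ∈ (N.arc j).dom from hm₀.supported j] with x hx
    exact ⟨hx, le_rfl, hT⟩
  · filter_upwards [show ∀ᵐ s ∂(νin j), s ∈ Icc 0 T from hν.in_supported j] with s hs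
    exact ⟨ArcShape.zero_mem_dom (N.length_pos j), hs⟩

/-- For the initial mass this is `hend`. Mass entering through the trace starts at `0`, and an arc
with both end vertices has positive length. -/
theorem AreVertexTraces.ae_ne_endCoord
    (hend : ∀ j, (N.arc j).terminus ≠ none → v j (N.arc j).endCoord = 0 →
      m₀ j {(N.arc j).endCoord} = 0)
    (hν : N.AreVertexTraces T v m₀ m νin νout) {j : J} (ht : (N.arc j).terminus ≠ none)
    (h0 : N.extVelocity v j (N.arc j).endCoord = 0) :
    ∀ᵐ q ∂(entryMeasure (m₀ j) (νin j)), q.1 ≠ (N.arc j).endCoord := by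
  rw [extVelocity_of_mem (ArcShape.endCoord_mem_dom (N.length_pos j))] at h0
  refine ae_entryMeasure ?_ ?_ ?_
  · exact (measurable_fst (measurableSet_singleton (N.arc j).endCoord)).compl
  · rw [ae_iff]
    simpa using hend j ht h0
  · by_cases ho : (N.arc j).origin = none
    · rw [hν.in_eq_zero j ho]; simp
    · exact Eventually.of_forall fun s => (ArcShape.endCoord_pos (N.length_pos j) ho ht).ne

theorem eq_stay_add_of_representation [Fintype V] [Fintype J] (hv : N.IsVelocity v)
    (hm : N.IsSolution T v p m₀ σ m) (hν : N.AreVertexTraces T v m₀ m νin νout)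
    (j : J) (ht : t ∈ Icc 0 T)
    (hrep : m t j + ((νout j).restrict (Iic t)).map
        (fun s => N.flow v j (t - s) (N.arc j).endCoord)
      = transported (N.flow v j) (entryMeasure (m₀ j) (νin j)) t) :
    m t j = N.stay v m₀ νin j t + N.endMass (m t) j • Measure.dirac (N.arc j).endCoord := by
  obtain ⟨K, M, hu⟩ := hv.exists_isLineField
  rw [stay, endMass]
  by_cases hn : (N.arc j).terminus = none
  · rw [hν.out_eq_zero j hn] at hrep
    simp only [Measure.restrict_zero, Measure.map_zero, add_zero] at hrep
    simp [hn, arcInterior_of_eq_none hn, hrep]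
  · rw [arcInterior_of_ne_none hn, if_pos hn]
    refine eq_restrict_add_dirac (hu j) (hv.isSemiflow j) ?_ hrep
    refine measure_mono_null (fun x hx => ?_) ((hm.arcMeasure t ht).supported j)
    exact fun h => not_le.2 hx (ArcShape.le_endCoord hn h)

theorem eq_stay_add_endMass [Fintype V] [Fintype J] (hT : 0 ≤ T) (hv : N.IsVelocity v)
    (hm₀ : N.IsArcMeasure m₀) (hm : N.IsSolution T v p m₀ σ m)
    (hν : N.AreVertexTraces T v m₀ m νin νout)
    (j : J) :
    m T j = N.stay v m₀ νin j T + N.endMass (m T) j • Measure.dirac (N.arc j).endCoord := by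
  obtain ⟨K, M, hu⟩ := hv.exists_isLineField
  exact eq_stay_add_of_representation hv hm hν j ⟨hT, le_rfl⟩
    ((hm.isLineSolution hm₀ hν j).representation (hu j) (hv.isSemiflow j) hT)

theorem out_add_endMass [Fintype V] [Fintype J] (hT : 0 ≤ T) (hv : N.IsVelocity v)
    (hm₀ : N.IsArcMeasure m₀) (hend : ∀ j, (N.arc j).terminus ≠ none →
      v j (N.arc j).endCoord = 0 → m₀ j {(N.arc j).endCoord} = 0)
    (hm : N.IsSolution T v p m₀ σ m) (hν : N.AreVertexTraces T v m₀ m νin νout)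
    (j : J) :
    νout j + N.endMass (m T) j • Measure.dirac T = N.leave v m₀ νin j T := by
  obtain ⟨K, M, hu⟩ := hv.exists_isLineField
  rw [leave, endMass]
  by_cases hn : (N.arc j).terminus = none
  · simp [hn, hν.out_eq_zero j hn]
  · rw [if_pos hn, if_pos hn]
    refine out_add_dirac_eq_exitLaw (hu j) (hv.isSemiflow j)
      (fun y hy => extVelocity_const hn hy)
      ((hν.ae_mem_dom hm₀ hT j).mono fun q hq => ArcShape.le_endCoord hn hq.1)
      (fun h0 => hν.ae_ne_endCoord hend hn h0) ?_ ?_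
      ((hm.isLineSolution hm₀ hν j).representation (hu j) (hv.isSemiflow j) hT)
    · refine measure_mono_null (fun x hx => ?_) ((hm.arcMeasure T ⟨hT, le_rfl⟩).supported j)
      exact fun h => not_le.2 hx (ArcShape.le_endCoord hn h)
    · exact (show ∀ᵐ s ∂(νout j), s ∈ Icc 0 T from hν.out_supported j).mono fun s hs => hs.2

/-- The mass at the terminal vertex is bounded by the transported mass there, which is zero at
almost every time. -/
theorem ae_eq_stay [Fintype V] [Fintype J] (hT : 0 ≤ T) (hv : N.IsVelocity v)
    (hm₀ : N.IsArcMeasure m₀) (hend : ∀ j, (N.arc j).terminus ≠ none →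
      v j (N.arc j).endCoord = 0 → m₀ j {(N.arc j).endCoord} = 0)
    (hm : N.IsSolution T v p m₀ σ m) (hν : N.AreVertexTraces T v m₀ m νin νout) :
    ∀ᵐ t ∂(volume.restrict (Icc 0 T)), ∀ j, m t j = N.stay v m₀ νin j t := by
  obtain ⟨K, M, hu⟩ := hv.exists_isLineField
  rw [ae_all_iff]
  intro j
  have := hm₀.finite j
  have := hν.in_finite j
  have h0 : ∀ᵐ t ∂(volume.restrict (Icc 0 T)), (N.arc j).terminus ≠ none →
      transported (N.flow v j) (entryMeasure (m₀ j) (νin j)) t {(N.arc j).endCoord} = 0 := by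
    by_cases hn : (N.arc j).terminus = none
    · simp [hn]
    · filter_upwards [ae_restrict_of_ae (ae_apply_singleton_eq_zero (hu j) (hv.isSemiflow j)
        (fun y hy => extVelocity_const hn hy) fun h0 => hν.ae_ne_endCoord hend hn h0)] with t ht _
      exact ht
  filter_upwards [h0, (hm.isLineSolution hm₀ hν j).ae_representation (hu j)
    (hv.isSemiflow j) hT, ae_restrict_mem measurableSet_Icc] with t h0 hrep ht
  have h := eq_stay_add_of_representation hv hm hν j ht hrep
  have hz : N.endMass (m t) j = 0 := by
    rw [endMass]
    split_ifs with hn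
    · refine nonpos_iff_eq_zero.1 ?_
      rw [← h0 hn, ← hrep, Measure.add_apply]
      exact le_self_add
    · rfl
  rwa [hz, zero_smul, add_zero] at h

end Network

/-! ### Boundary data, transmission and the first junction -/

namespace Network

variable {V J : Type*} {d : ℕ} {N : Network V J d} {v : J → ℝ → ℝ}
  {p : ℝ → J → J → ℝ} {T t : ℝ} {m₀ : J → Measure ℝ} {σ : V → Measure ℝ}
  {m : ℝ → J → Measure ℝ} {νin νout : J → Measure ℝ}

/-- The trace at the origin of the outgoing arc of a source is the boundary datum. -/
theorem in_eq_boundary [Fintype V] [Fintype J] (hσ : N.IsBoundaryData T σ)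
    (hm : N.IsSolution T v p m₀ σ m) (hν : N.AreVertexTraces T v m₀ m νin νout) {i : V}
    (hi : N.IsSource i) {j : J} (hj : (N.arc j).origin = some i) : νin j = σ i := by
  classical
  have := hν.in_finite j
  have := hσ.finite i hi
  refine measure_ext_of_contDiff fun ψ hψ hψc => ?_
  -- The cutoff has to vanish at the other end of the arc, if there is one. On a ray `endCoord` is
  -- `0`, and any radius will do.
  set R : ℝ := if 0 < (N.arc j).endCoord then (N.arc j).endCoord else 1 with hR
  have hRpos : 0 < R := by rw [hR]; split_ifs with h; exacts [h, one_pos]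
  let χ : ContDiffBump (0 : ℝ) := ⟨R / 2, R, by linarith, by linarith⟩
  have hχ0 : χ 0 = 1 := χ.one_of_mem_closedBall (Metric.mem_closedBall_self χ.rIn_pos.le)
  have hχL : (N.arc j).terminus ≠ none → χ (N.arc j).endCoord = 0 := fun hn => by
    have hL := ArcShape.endCoord_pos (N.length_pos j) (by simp [hj]) hn
    refine χ.zero_of_le_dist ?_
    simp [χ, hR, hL, abs_of_pos hL]
  -- Vanishing on all other arcs is compatible with continuity at the source, which has no incoming
  -- arc and only this outgoing one.
  set f : J → ℝ → ℝ → ℝ := fun k x t => if k = j then χ x * ψ t else 0 with hf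
  set g : V → ℝ → ℝ := fun k t => if k = i then ψ t else 0 with hg
  have hfj : ∀ x t, f j x t = χ x * ψ t := fun x t => if_pos rfl
  have hfk : ∀ k ≠ j, f k = 0 := fun k hk => by ext x t; exact if_neg hk
  have harc : IsArcTest (fun x t => χ x * ψ t) := by
    refine ⟨(χ.contDiff.comp contDiff_fst).mul (hψ.comp contDiff_snd), ?_⟩
    refine HasCompactSupport.of_support_subset_isCompact
      (χ.hasCompactSupport.isCompact.prod hψc.isCompact) ?_
    rintro ⟨x, t⟩ h
    simp only [Function.mem_support, ne_eq, mul_eq_zero, not_or] at h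
    exact ⟨subset_tsupport _ h.1, subset_tsupport _ h.2⟩
  have htest : N.IsTest f g := by
    refine ⟨fun k => ?_, fun k i' hk t => ?_, fun k i' hk t => ?_⟩
    · by_cases hkj : k = j
      · subst hkj; simpa only [hf, if_true] using harc
      · rw [hfk k hkj]
        exact ⟨contDiff_const, HasCompactSupport.zero⟩
    · by_cases hkj : k = j
      · subst hkj
        have : i' = i := by rw [hj] at hk; exact (Option.some_injective _ hk).symm
        simp [hf, hg, this, hχ0]
      · rw [hfk k hkj]
        have : i' ≠ i := fun h => hkj (N.source_unique i hi k j (h ▸ hk) hj)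
        simp [hg, this]
    · have hii : i' ≠ i := fun h => hi k (h ▸ hk)
      by_cases hkj : k = j
      · subst hkj
        simp [hf, hg, hii, hχL (by simp [hk])]
      · rw [hfk k hkj]
        simp [hg, hii]
  have h1 := hm.balance f g htest
  have h2 := hν.balance j _ harc
  have htr : ∀ k ≠ j, ∀ x t, transportOp v k (f k) x t = 0 := fun k hk x t => by
    rw [hfk k hk]; simp [transportOp]
  have e1 : ∀ t s, ∑ k, ∫ x, f k x s ∂(m t k) = ∫ x, χ x * ψ s ∂(m t j) := fun t s => by
    rw [Finset.sum_eq_single j (fun k _ hk => by simp [hfk k hk]) (by simp)]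
    simp only [hfj]
  have e2 : ∑ k, ∫ x, f k x 0 ∂(m₀ k) = ∫ x, χ x * ψ 0 ∂(m₀ j) := by
    rw [Finset.sum_eq_single j (fun k _ hk => by simp [hfk k hk]) (by simp)]
    simp only [hfj]
  have e3 : ∀ t, ∑ k, ∫ x, transportOp v k (f k) x t ∂(m t k)
      = ∫ x, transportOp v j (fun x t => χ x * ψ t) x t ∂(m t j) := fun t => by
    rw [Finset.sum_eq_single j (fun k _ hk => by simp [htr k hk]) (by simp)]
    simp only [hf, if_true]
  have e4 : ∑ k with N.IsSource k, ∫ t, g k t ∂(σ k) = ∫ t, ψ t ∂(σ i) := by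
    rw [Finset.sum_eq_single i (fun k _ hk => by simp [hg, hk]) (by simp [hi])]
    simp [hg]
  have e5 : ∫ t, χ (N.arc j).endCoord * ψ t ∂(νout j) = 0 := by
    by_cases hn : (N.arc j).terminus = none
    · rw [hν.out_eq_zero j hn]; simp
    · simp [hχL hn]
  simp only [e1, e2, e3] at h1
  rw [e4, ← h2, e5] at h1
  simp only [hχ0, one_mul] at h1
  linarith

/-- The transmission condition at a vertex which is not a source, as an equality of measures. -/
theorem lintegral_in_eq [Fintype J] (hp : N.IsDistribution T p)
    (hν : N.AreVertexTraces T v m₀ m νin νout) {g : J → J → ℝ → ℝ}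
    (hg : ∀ j k, Measurable (g j k)) (hgp : ∀ j k, ∀ t ∈ Icc 0 T, g j k t = p t j k)
    {k : J} {i : V} (hk : (N.arc k).origin = some i) {S : Finset J}
    (hS : ∀ j, j ∈ S ↔ (N.arc j).terminus = some i)
    (htrans : ∀ f : ℝ → ℝ, Continuous f →
      ∫ t, f t ∂(νin k) = ∑ j ∈ S, ∫ t, p t j k * f t ∂(νout j))
    {w : ℝ → ENNReal} (hw : Measurable w) :
    ∫⁻ s, w s ∂(νin k) = ∑ j, ∫⁻ s, ENNReal.ofReal (g j k s) * w s ∂(νout j) := by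
  classical
  have hsupp : ∀ j, ∀ᵐ s ∂(νout j), s ∈ Icc 0 T := fun j => hν.out_supported j
  have hgm : ∀ j, Measurable fun s => ENNReal.ofReal (g j k s) := fun j =>
    (hg j k).ennreal_ofReal
  have hfin : ∀ j, IsFiniteMeasure ((νout j).withDensity fun s => ENNReal.ofReal (g j k s)) := by
    intro j
    have := hν.out_finite j
    refine isFiniteMeasure_withDensity (ne_of_lt ?_)
    calc ∫⁻ s, ENNReal.ofReal (g j k s) ∂(νout j) ≤ ∫⁻ _, 1 ∂(νout j) := by
          refine lintegral_mono_ae ?_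
          filter_upwards [hsupp j] with s hs
          rw [hgp j k s hs]
          exact ENNReal.ofReal_le_one.2 (hp.le_one s hs j k)
      _ < ⊤ := by simp [measure_lt_top]
  have := hν.in_finite k
  have hmeas : νin k = ∑ j ∈ S, (νout j).withDensity fun s => ENNReal.ofReal (g j k s) := by
    refine measure_ext_of_contDiff fun φ hφ hφc => ?_
    rw [htrans φ hφ.continuous, integral_finsetSum_measure fun j _ =>
      hφ.continuous.integrable_of_hasCompactSupport hφc]
    refine Finset.sum_congr rfl fun j _ => ?_
    rw [integral_withDensity_eq_integral_toReal_smul (hgm j)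
      (Eventually.of_forall fun s => ENNReal.ofReal_lt_top)]
    refine integral_congr_ae ?_
    filter_upwards [hsupp j] with s hs
    rw [hgp j k s hs, ENNReal.toReal_ofReal (hp.nonneg s hs j k), smul_eq_mul]
  rw [hmeas, lintegral_finsetSum_measure, ← Finset.sum_subset (Finset.subset_univ S)]
  · refine Finset.sum_congr rfl fun j _ => ?_
    rw [lintegral_withDensity_eq_lintegral_mul _ (hgm j) hw]
    rfl
  -- An arc that does not terminate at `x_i` sends nothing to `k`, so the sum may run over all arcs.
  -- Later this allows the two sums over arcs to be exchanged.
  · intro j _ hjS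
    refine (lintegral_congr_ae (g := fun _ => 0) ?_).trans lintegral_zero
    filter_upwards [hsupp j] with s hs
    rw [hgp j k s hs, hp.eq_zero s hs j k]
    · simp
    · rintro ⟨i', h1, h2⟩
      rw [hk, Option.some.injEq] at h2
      exact hjS ((hS j).2 (h2 ▸ h1))

/-- The mass entering an arc is either still on it or has left it and follows the next arcs. -/
theorem lintegral_pathSum_split [Fintype J] (hv : N.IsVelocity v) (hp : N.IsDistribution T p)
    (ht : t ∈ Icc 0 T) {B : Set (EuclideanSpace ℝ (Fin d))} (hB : MeasurableSet B)
    {g : J → J → ℝ → ℝ} (hg : ∀ j k, Measurable (g j k))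
    (hgp : ∀ j k, ∀ t ∈ Icc 0 T, g j k t = p t j k) {h : J → ℝ × ℝ → ENNReal}
    (hh : ∀ j, Measurable (h j))
    (hhp : ∀ j, ∀ x ∈ (N.arc j).dom, ∀ s ∈ Icc 0 t, N.pathSum v p j x s t B = h j (x, s))
    (hlam : ∀ j, ∀ᵐ q ∂(entryMeasure (m₀ j) (νin j)), q.1 ∈ (N.arc j).dom ∧ q.2 ∈ Icc 0 T)
    (j : J) :
    ∫⁻ q in {q | q.2 ≤ t}, h j q ∂(entryMeasure (m₀ j) (νin j))
      = (N.stay v m₀ νin j t).map (N.extParam j) B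
        + ∑ k, ∫⁻ θ in Iic t, ENNReal.ofReal (g j k θ) * h k (0, θ) ∂(N.leave v m₀ νin j T) := by
  classical
  obtain ⟨K, M, hu⟩ := hv.exists_isLineField
  have hΦ := hv.isSemiflow j
  set lam := entryMeasure (m₀ j) (νin j) with hlamdef
  set Φ := N.flow v j with hΦdef
  set L := (N.arc j).endCoord with hLdef
  -- The entries that leave the arc by time `t`. The complementary entries account for `stay`.
  set E : Set (ℝ × ℝ) := if (N.arc j).terminus ≠ none then exitedSet Φ L t else ∅ with hE
  have hEm : MeasurableSet E := by
    rw [hE]; split_ifs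
    exacts [hΦ.measurableSet_exitedSet (hu j) L t, MeasurableSet.empty]
  have hEiff : ∀ q : ℝ × ℝ, q ∈ E ↔ N.ExitsBy v j q.1 q.2 t := fun q => by
    rw [hv.exitsBy_iff, hE]; split_ifs with hn <;> simp [hn, ← hΦdef, ← hLdef]
  have hEsub : E ⊆ {q | q.2 ≤ t} := fun q hq => ((hv.exitsBy_iff).1 ((hEiff q).1 hq)).2.1
  have hmap : (N.stay v m₀ νin j t).map (N.extParam j) B
      = ∫⁻ q in {q | q.2 ≤ t} \ E, h j q ∂lam := by
    have hpm := (continuous_extParam (N := N) j).measurable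
    have hfm := hΦ.measurable_flow_sub (hu j) t
    have hset : ((fun q : ℝ × ℝ => Φ (t - q.2) q.1) ⁻¹' N.arcInterior j ∩ {q | q.2 ≤ t} :
        Set (ℝ × ℝ)) =ᵐ[lam] ({q | q.2 ≤ t} \ E : Set (ℝ × ℝ)) := by
      filter_upwards [hlam j] with q hq
      refine propext ⟨fun h => ⟨h.2, fun hqE => ?_⟩, fun h => ⟨fun hn => ?_, h.1⟩⟩
      · have := hv.exitsBy_iff.1 ((hEiff q).1 hqE)
        exact not_le.2 (h.1 this.1) this.2.2.2
      · refine not_le.1 fun hle => h.2 ((hEiff q).2 (hv.exitsBy_iff.2 ⟨hn, h.1, ?_, hle⟩))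
        exact ArcShape.le_endCoord hn hq.1
    rw [stay, hΦ.restrict_transported (hu j) (N.isOpen_arcInterior j).measurableSet,
      Measure.restrict_congr_set hset, Measure.map_map hpm hfm,
      ← lintegral_indicator_one hB, lintegral_map (measurable_one.indicator hB) (hpm.comp hfm)]
    refine setLIntegral_congr_fun_ae ((measurableSet_snd_le t).diff hEm) ?_
    filter_upwards [hlam j] with q hq hqE
    have hex : ¬ N.ExitsBy v j q.1 q.2 t := fun h => hqE.2 ((hEiff q).2 h)
    rw [← hhp j q.1 hq.1 q.2 ⟨hq.2.1, hqE.1⟩, pathSum_apply_of_not_exitsBy hB hex,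
      hv.arcFlow_eq_flow hqE.1, Function.comp_apply,
      extParam_of_mem (hv.flow_mem_dom hq.1 hqE.1 hex)]
  have hwm : ∀ k, Measurable fun θ => ENNReal.ofReal (g j k θ) * h k (0, θ) := fun k =>
    (hg j k).ennreal_ofReal.mul ((hh k).comp (by fun_prop))
  have hleave : ∀ k, ∫⁻ θ in Iic t, ENNReal.ofReal (g j k θ) * h k (0, θ)
        ∂(N.leave v m₀ νin j T)
      = ∫⁻ q in E, ENNReal.ofReal (g j k (q.2 + hitTime Φ L q.1))
          * h k (0, q.2 + hitTime Φ L q.1) ∂lam := by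
    intro k
    by_cases hn : (N.arc j).terminus = none
    · simp [leave, hn, hE]
    · rw [leave, if_pos hn, hΦ.restrict_exitLaw (hu j) ht.2, exitLaw,
        lintegral_map (hwm k) (hΦ.measurable_exitTime (hu j) L), hE, if_pos hn]
  -- The recursion of the path sum at the first junction, with the exit time as integration
  -- variable.
  have hexit : ∫⁻ q in E, h j q ∂lam
      = ∑ k, ∫⁻ θ in Iic t, ENNReal.ofReal (g j k θ) * h k (0, θ) ∂(N.leave v m₀ νin j T) := by
    simp only [hleave]
    have hwm' : ∀ k, Measurable fun q : ℝ × ℝ => ENNReal.ofReal (g j k (q.2 + hitTime Φ L q.1))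
        * h k (0, q.2 + hitTime Φ L q.1) := fun k =>
      (hwm k).comp (hΦ.measurable_exitTime (hu j) L)
    rw [← lintegral_finsetSum _ fun k _ => hwm' k]
    refine setLIntegral_congr_fun_ae hEm ?_
    filter_upwards [hlam j] with q hq hqE
    have hex := (hEiff q).1 hqE
    have hmem := hv.exitTime_mem hex
    rw [← hhp j q.1 hq.1 q.2 ⟨hq.2.1, hEsub hqE⟩,
      pathSum_apply_of_exitsBy hv hp ht.2 hB hq.2.1 hex]
    refine Finset.sum_congr rfl fun k _ => ?_
    rw [hhp k 0 (ArcShape.zero_mem_dom (N.length_pos k)) _ ⟨hq.2.1.trans hmem.1, hmem.2⟩,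
      ← hgp j k _ ⟨hq.2.1.trans hmem.1, hmem.2.trans ht.2⟩, hv.exitTime_eq hex]
  rw [hmap, ← hexit, add_comm, ← lintegral_union ((measurableSet_snd_le t).diff hEm)
    disjoint_sdiff_right, union_sdiff_cancel hEsub]

end Network

/-! ### Summation over the network -/

namespace Network

variable {V J : Type*} {d : ℕ} {N : Network V J d} {v : J → ℝ → ℝ}
  {p : ℝ → J → J → ℝ} {T t : ℝ} {m₀ : J → Measure ℝ} {σ : V → Measure ℝ}
  {m : ℝ → J → Measure ℝ} {νin νout : J → Measure ℝ}

open Classical in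
-- The source data are traded for the entering traces, so that all the entries are described by `m₀`
-- and `νin`.
theorem pushForward_apply [Fintype V] [Fintype J] (hv : N.IsVelocity v)
    (hp : N.IsDistribution T p) (hm₀ : N.IsArcMeasure m₀) (hσ : N.IsBoundaryData T σ)
    (hm : N.IsSolution T v p m₀ σ m) (hν : N.AreVertexTraces T v m₀ m νin νout)
    (ht : t ∈ Icc 0 T) {B : Set (EuclideanSpace ℝ (Fin d))} (hB : MeasurableSet B)
    {h : J → ℝ × ℝ → ENNReal}
    (hhp : ∀ j, ∀ x ∈ (N.arc j).dom, ∀ s ∈ Icc 0 t, N.pathSum v p j x s t B = h j (x, s)) :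
    N.pushForward v p m₀ σ t B = ∑ j, ∫⁻ x, h j (x, 0) ∂(m₀ j)
      + ∑ i with N.IsSource i, ∑ j with (N.arc j).origin = some i,
          ∫⁻ s in Iic t, h j (0, s) ∂(νin j) := by
  have hT : 0 ≤ T := ht.1.trans ht.2
  rw [pushForward, Measure.add_apply, Measure.finsetSum_apply, Measure.finsetSum_apply]
  congr 1
  · refine Finset.sum_congr rfl fun j _ => ?_
    have hdom : ∀ᵐ x ∂(m₀ j), x ∈ (N.arc j).dom := hm₀.supported j
    rw [bind_pathSum_apply hv hp hT ht.2 hB j (e := fun x => (x, 0)) (by fun_prop)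
      (hdom.mono fun x hx => ⟨hx, le_rfl, ht.1⟩)]
    refine lintegral_congr_ae ?_
    filter_upwards [hdom] with x hx using hhp j x hx 0 ⟨le_rfl, ht.1⟩
  · refine Finset.sum_congr rfl fun i hi => ?_
    rw [Measure.finsetSum_apply]
    refine Finset.sum_congr rfl fun j hj => ?_
    rw [Finset.mem_filter_univ] at hi hj
    have h0 := ArcShape.zero_mem_dom (N.length_pos j)
    rw [bind_pathSum_apply hv hp hT ht.2 hB j (e := fun s => (0, s)) (by fun_prop)
      ((ae_restrict_mem measurableSet_Icc).mono fun s hs => ⟨h0, hs⟩),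
      in_eq_boundary hσ hm hν hi hj]
    have hset : (Iic t : Set ℝ) =ᵐ[σ i] Icc 0 t := by
      filter_upwards [show ∀ᵐ s ∂(σ i), s ∈ Icc 0 T from hσ.supported i hi] with s hs
      exact propext ⟨fun h => ⟨hs.1, h⟩, fun h => h.2⟩
    rw [Measure.restrict_congr_set hset]
    exact setLIntegral_congr_fun measurableSet_Icc fun s hs => hhp j 0 h0 s hs

/-- Mass which arrives at a vertex at the terminal time is seen at this vertex. -/
theorem sum_pathSum_terminal [Fintype J] (hv : N.IsVelocity v) (hp : N.IsDistribution T p)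
    (hT : 0 ≤ T) {B : Set (EuclideanSpace ℝ (Fin d))} (hB : MeasurableSet B) {j : J}
    (hj : (N.arc j).terminus ≠ none) :
    ∑ k, ENNReal.ofReal (p T j k) * N.pathSum v p k 0 T T B
      = B.indicator 1 (N.extParam j (N.arc j).endCoord) := by
  obtain ⟨i, hi⟩ := Option.ne_none_iff_exists'.1 hj
  rw [extParam_of_mem (ArcShape.endCoord_mem_dom (N.length_pos j)), N.param_terminus j i hi]
  calc ∑ k, ENNReal.ofReal (p T j k) * N.pathSum v p k 0 T T B
      = ∑ k, ENNReal.ofReal (p T j k) * B.indicator 1 (N.pos i) := by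
        refine Finset.sum_congr rfl fun k _ => ?_
        by_cases hf : N.Follows j k
        · have ho : (N.arc k).origin = some i := by
            obtain ⟨i', h1, h2⟩ := hf
            rw [hi] at h1
            rw [h2, ← h1]
          have hex : ¬ N.ExitsBy v k 0 T T := fun hex => by
            obtain ⟨h1, h2, -, h3⟩ := hv.exitsBy_iff.1 hex
            have := ArcShape.endCoord_pos (N.length_pos k) (by simp [ho]) h1
            simp only [sub_self, (hv.isSemiflow k).zero] at h3
            linarith
          rw [pathSum_apply_of_not_exitsBy hB hex, hv.arcFlow_eq_flow le_rfl, sub_self,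
            (hv.isSemiflow k).zero, N.param_origin k i ho]
        · rw [hp.eq_zero T ⟨hT, le_rfl⟩ j k hf]; simp
    _ = B.indicator 1 (N.pos i) := by
        rw [← Finset.sum_mul, hp.sum_ofReal ⟨hT, le_rfl⟩ hj, one_mul]

open Classical in
/-- The push-forward along the paths is the mass present on the arcs, including at the terminal
time the mass that has just arrived at the vertices. -/
theorem pushForward_apply_eq [Fintype V] [Fintype J] (hv : N.IsVelocity v)
    (hp : N.IsDistribution T p) (hm₀ : N.IsArcMeasure m₀)
    (hend : ∀ j, (N.arc j).terminus ≠ none → v j (N.arc j).endCoord = 0 →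
      m₀ j {(N.arc j).endCoord} = 0) (hσ : N.IsBoundaryData T σ)
    (hm : N.IsSolution T v p m₀ σ m) (hν : N.AreVertexTraces T v m₀ m νin νout)
    (htrans : ∀ i, ¬ N.IsSource i → ∀ j, (N.arc j).origin = some i → ∀ f : ℝ → ℝ, Continuous f →
      ∫ t, f t ∂(νin j) = ∑ k with (N.arc k).terminus = some i, ∫ t, p t k j * f t ∂(νout k))
    (ht : t ∈ Icc 0 T) {B : Set (EuclideanSpace ℝ (Fin d))} (hB : MeasurableSet B) :
    N.pushForward v p m₀ σ t B = ∑ j, (N.stay v m₀ νin j t).map (N.extParam j) B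
      + if t = T then ∑ j, N.endMass (m T) j * B.indicator 1 (N.extParam j (N.arc j).endCoord)
        else 0 := by
  have hT : 0 ≤ T := ht.1.trans ht.2
  choose g hg hgp using fun j k => hp.exists_measurable hT j k
  choose h hh hhp using exists_measurable_pathSum hv hp hT ht.2 hB
  have h0 := fun k => ArcShape.zero_mem_dom (N.length_pos k)
  have hhm : ∀ k, Measurable fun s => h k (0, s) := fun k => (hh k).comp (by fun_prop)
  -- The contribution of the trace entering arc `k`. It is finite because the path sum is at most
  -- `1`, so it may be cancelled at the end.
  set Y : J → ENNReal := fun k => ∫⁻ s in Iic t, h k (0, s) ∂(νin k) with hY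
  have hYtop : ∀ k, Y k < ⊤ := fun k => by
    have := hν.in_finite k
    calc Y k ≤ ∫⁻ s in Iic t, 1 ∂(νin k) := by
          refine lintegral_mono_ae ?_
          filter_upwards [ae_restrict_mem measurableSet_Iic, ae_restrict_of_ae
            (show ∀ᵐ s ∂(νin k), s ∈ Icc 0 T from hν.in_supported k)] with s hst hs
          rw [← hhp k 0 (h0 k) s ⟨hs.1, hst⟩]
          exact pathSum_le_one hv hp ht.2 B k 0 hs.1
      _ < ⊤ := by simp [measure_lt_top]
  have hsplit : ∀ j, ∫⁻ x, h j (x, 0) ∂(m₀ j) + Y j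
      = (N.stay v m₀ νin j t).map (N.extParam j) B
        + (∑ k, ∫⁻ θ in Iic t, ENNReal.ofReal (g j k θ) * h k (0, θ) ∂(νout j)
          + ∑ k, ∫⁻ θ in Iic t, ENNReal.ofReal (g j k θ) * h k (0, θ)
            ∂(N.endMass (m T) j • Measure.dirac T)) := fun j => by
    rw [hY, ← lintegral_entryMeasure (hh j) ht.1,
      lintegral_pathSum_split hv hp ht hB hg hgp hh hhp (hν.ae_mem_dom hm₀ hT) j,
      ← out_add_endMass hT hv hm₀ hend hm hν j]
    simp only [Measure.restrict_add, lintegral_add_measure, Finset.sum_add_distrib]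
  set inner : J → Prop := fun k => ∃ i, ¬ N.IsSource i ∧ (N.arc k).origin = some i with hinner
  -- By the transmission conditions, what all arcs send to `k` is exactly what enters `k`. If `k`
  -- starts at a source or has no origin, the coefficients towards it vanish.
  have hout : ∀ k, ∑ j, ∫⁻ θ in Iic t, ENNReal.ofReal (g j k θ) * h k (0, θ) ∂(νout j)
      = if inner k then Y k else 0 := fun k => by
    by_cases hk : inner k
    · obtain ⟨i, hi, ho⟩ := hk
      rw [if_pos ⟨i, hi, ho⟩, hY]
      simp only
      rw [← lintegral_indicator measurableSet_Iic,
        lintegral_in_eq hp hν hg hgp ho (S := {j | (N.arc j).terminus = some i}) (by simp)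
          (htrans i hi k ho) ((hhm k).indicator measurableSet_Iic)]
      refine Finset.sum_congr rfl fun j _ => ?_
      rw [← lintegral_indicator measurableSet_Iic]
      refine lintegral_congr fun s => ?_
      by_cases hs : s ∈ Iic t <;> simp [hs]
    · rw [if_neg hk]
      refine Finset.sum_eq_zero fun j _ => ?_
      refine (lintegral_congr_ae (g := fun _ => 0) ?_).trans lintegral_zero
      filter_upwards [ae_restrict_of_ae
        (show ∀ᵐ s ∂(νout j), s ∈ Icc 0 T from hν.out_supported j)] with s hs
      rw [hgp j k s hs, hp.eq_zero s hs j k]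
      · simp
      · rintro ⟨i, h1, h2⟩
        exact hk ⟨i, fun hi => hi j h1, h2⟩
  -- The atom sits at time `T`, so it is outside `Iic t` unless `t = T`.
  have hterm : ∀ j, ∑ k, ∫⁻ θ in Iic t, ENNReal.ofReal (g j k θ) * h k (0, θ)
        ∂(N.endMass (m T) j • Measure.dirac T)
      = if t = T then N.endMass (m T) j * B.indicator 1 (N.extParam j (N.arc j).endCoord)
        else 0 := fun j => by
    split_ifs with htT
    · subst htT
      have hc : ∀ k, ∫⁻ θ in Iic t, ENNReal.ofReal (g j k θ) * h k (0, θ)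
            ∂(N.endMass (m t) j • Measure.dirac t)
          = N.endMass (m t) j * (ENNReal.ofReal (p t j k) * N.pathSum v p k 0 t t B) := fun k => by
        have hw : Measurable fun θ => ENNReal.ofReal (g j k θ) * h k (0, θ) :=
          (hg j k).ennreal_ofReal.mul (hhm k)
        rw [Measure.restrict_smul, lintegral_smul_measure, restrict_dirac' measurableSet_Iic,
          if_pos (mem_Iic.2 le_rfl), lintegral_dirac' _ hw, hgp j k t ht,
          hhp k 0 (h0 k) t ⟨ht.1, le_rfl⟩, smul_eq_mul]
      simp only [hc]
      rw [← Finset.mul_sum]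
      by_cases hj : (N.arc j).terminus = none
      · simp [endMass, hj]
      · rw [sum_pathSum_terminal hv hp hT hB hj]
    · refine Finset.sum_eq_zero fun k _ => ?_
      rw [Measure.restrict_smul, lintegral_smul_measure, restrict_dirac' measurableSet_Iic,
        if_neg (show T ∉ Iic t from fun hle => htT (le_antisymm ht.2 hle)), lintegral_zero_measure, smul_zero]
  -- Each entering trace is counted once: at an inner vertex, or at a source, or not at all if the
  -- arc has no origin and the trace is zero.
  have hpart : ∀ k, Y k = (if inner k then Y k else 0)
      + ∑ i with N.IsSource i, if (N.arc k).origin = some i then Y k else 0 := fun k => by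
    obtain ho | ⟨i, ho⟩ : (N.arc k).origin = none ∨ ∃ i, (N.arc k).origin = some i :=
      Option.eq_none_or_eq_some _
    · have hz : Y k = 0 := by
        simp only [hY, hν.in_eq_zero k ho, Measure.restrict_zero, lintegral_zero_measure]
      simp [hz]
    · by_cases hi : N.IsSource i
      · have hk : ¬ inner k := by
          rintro ⟨i', hi', ho'⟩
          rw [ho, Option.some.injEq] at ho'
          exact hi' (ho' ▸ hi)
        rw [if_neg hk, zero_add, Finset.sum_eq_single i]
        · simp [ho]
        · intro i' _ hne
          rw [if_neg]
          simpa [ho] using hne.symm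
        · intro hni
          simp [hi] at hni
      · rw [if_pos ⟨i, hi, ho⟩, Finset.sum_eq_zero, add_zero]
        intro i' hi'
        rw [Finset.mem_filter_univ] at hi'
        rw [if_neg]
        intro h
        rw [ho, Option.some.injEq] at h
        exact hi (h ▸ hi')
  have hsum := Finset.sum_congr (s₁ := Finset.univ) rfl fun j _ => hsplit j
  simp only [Finset.sum_add_distrib, hterm] at hsum
  rw [Finset.sum_comm (f := fun j k => ∫⁻ θ in Iic t, ENNReal.ofReal (g j k θ) * h k (0, θ)
    ∂(νout j))] at hsum
  simp only [hout] at hsum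
  have hYsum : ∑ k, Y k = (∑ k, if inner k then Y k else 0)
      + ∑ i with N.IsSource i, ∑ j with (N.arc j).origin = some i, Y j := by
    rw [Finset.sum_congr rfl fun k _ => hpart k, Finset.sum_add_distrib, Finset.sum_comm]
    simp only [Finset.sum_filter]
  rw [hYsum] at hsum
  rw [pushForward_apply hv hp hm₀ hσ hm hν ht hB hhp]
  have hfin : (∑ k, if inner k then Y k else 0) ≠ ⊤ :=
    (ENNReal.sum_lt_top.2 fun k _ => by split_ifs; exacts [hYtop k, ENNReal.zero_lt_top]).ne
  -- The contributions entering at inner vertices stand on both sides and are cancelled. In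
  -- `ENNReal` this requires their finiteness.
  refine (ENNReal.add_right_inj hfin).1 ?_
  have hite : (∑ j, if t = T then
      N.endMass (m T) j * B.indicator 1 (N.extParam j (N.arc j).endCoord) else 0)
      = if t = T then ∑ j, N.endMass (m T) j * B.indicator 1 (N.extParam j (N.arc j).endCoord)
        else 0 := by split_ifs <;> simp
  rw [hite] at hsum
  rw [← add_left_comm, hsum, add_left_comm]

theorem toNetwork_eq_sum_extParam [Fintype J] {μ : J → Measure ℝ} (hμ : N.IsArcMeasure μ) :
    N.toNetwork μ = ∑ j, (μ j).map (N.extParam j) := by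
  refine Finset.sum_congr rfl fun j _ => Measure.map_congr ?_
  filter_upwards [show ∀ᵐ x ∂(μ j), x ∈ (N.arc j).dom from hμ.supported j] with x hx
  exact (extParam_of_mem hx).symm

end Network

/-! ### Traces in time and the conclusion -/

/-- The averages over shrinking intervals to the right of `t` of a function which agrees almost
everywhere with a right continuous function. -/
theorem tendsto_average_right {T t : ℝ} (ht : t ∈ Ico 0 T) {g G : ℝ → ℝ}
    (hg : IntegrableOn g (Icc 0 T)) (hgG : ∀ᵐ s ∂(volume.restrict (Icc 0 T)), g s = G s)
    (hG : Tendsto G (𝓝[≥] t) (𝓝 (G t))) :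
    Tendsto (fun h : ℝ => h⁻¹ * ∫ s in Icc t (t + h), g s) (𝓝[>] 0) (𝓝 (G t)) := by
  rw [Metric.tendsto_nhds]
  intro ε hε
  have h1 := Metric.tendsto_nhds.1 hG (ε / 2) (half_pos hε)
  obtain ⟨b, hb, hb'⟩ := mem_nhdsGE_iff_exists_Ico_subset.1 h1
  have hmem : Ioo 0 (min (b - t) (T - t)) ∈ 𝓝[>] (0 : ℝ) :=
    Ioo_mem_nhdsGT (lt_min (sub_pos.2 hb) (sub_pos.2 ht.2))
  filter_upwards [hmem] with h hh
  have hh1 := hh.2.trans_le (min_le_left _ _)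
  have hh2 := hh.2.trans_le (min_le_right _ _)
  have hsub : Icc t (t + h) ⊆ Icc 0 T := Icc_subset_Icc ht.1 (by linarith)
  have hint : IntegrableOn g (Icc t (t + h)) := hg.mono_set hsub
  have hvol : volume.real (Icc t (t + h)) = h := by
    rw [Real.volume_real_Icc_of_le (by linarith [hh.1])]; ring
  have hae : ∀ᵐ s ∂(volume.restrict (Icc t (t + h))), ‖g s - G t‖ ≤ ε / 2 := by
    filter_upwards [ae_restrict_of_ae_restrict_of_subset hsub hgG,
      ae_restrict_mem measurableSet_Icc] with s hs hst
    have : dist (G s) (G t) < ε / 2 := hb' ⟨hst.1, by linarith [hst.2]⟩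
    rw [hs, ← dist_eq_norm]
    exact this.le
  have hnorm : ‖∫ s in Icc t (t + h), (g s - G t)‖ ≤ ε / 2 * h := by
    have := norm_setIntegral_le_of_norm_le_const_ae' (s := Icc t (t + h)) (μ := volume)
      (f := fun s => g s - G t) (C := ε / 2) (by simp)
      ((ae_restrict_iff' measurableSet_Icc).1 hae)
    rwa [hvol] at this
  have hconst : IntegrableOn (fun _ : ℝ => G t) (Icc t (t + h)) :=
    integrableOn_const (by simp)
  rw [integral_sub hint hconst, setIntegral_const, hvol, smul_eq_mul] at hnorm
  rw [dist_eq_norm]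
  have hne : h ≠ 0 := hh.1.ne'
  have e : h⁻¹ * (∫ s in Icc t (t + h), g s) - G t
      = h⁻¹ * ((∫ s in Icc t (t + h), g s) - h * G t) := by field_simp
  rw [e, norm_mul, norm_inv, Real.norm_of_nonneg hh.1.le]
  calc h⁻¹ * _ ≤ h⁻¹ * (ε / 2 * h) :=
        mul_le_mul_of_nonneg_left hnorm (inv_nonneg.2 hh.1.le)
    _ = ε / 2 := by field_simp
    _ < ε := half_lt_self hε

theorem theorem3p2 {V J : Type*} [Fintype V] [Fintype J] {d : ℕ} (N : Network V J d)
    {T : ℝ} (hT : 0 < T)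
    {v : J → ℝ → ℝ} (hv : N.IsVelocity v)
    {p : ℝ → J → J → ℝ} (hp : N.IsDistribution T p)
    {m₀ : J → Measure ℝ} (hm₀ : N.IsArcMeasure m₀)
    (hend : ∀ j, (N.arc j).terminus ≠ none → v j (N.arc j).endCoord = 0 →
      m₀ j {(N.arc j).endCoord} = 0)
    {σ : V → Measure ℝ} (hσ : N.IsBoundaryData T σ)
    {m : ℝ → J → Measure ℝ} (hm : N.IsSolution T v p m₀ σ m) :
    (∀ᵐ t ∂(volume.restrict (Icc 0 T)), N.toNetwork (m t) = N.pushForward v p m₀ σ t) ∧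
    (∀ t ∈ Ico 0 T, N.IsTimeTrace m t (N.pushForward v p m₀ σ t)) ∧
    N.toNetwork (m T) = N.pushForward v p m₀ σ T := by
  obtain ⟨νin, νout, hν, htrans⟩ := hm.transmission
  obtain ⟨K, M, hu⟩ := hv.exists_isLineField
  have hfin₀ := hm₀.finite
  have hfin_in := hν.in_finite
  have hpm : ∀ j, Measurable (N.extParam j) := fun j => (Network.continuous_extParam j).measurable
  have hstay : ∀ j t, IsFiniteMeasure (N.stay v m₀ νin j t) := fun j t => by
    unfold Network.stay; infer_instance
  have hae := Network.ae_eq_stay hT.le hv hm₀ hend hm hν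
  have hF : ∀ t ∈ Ico 0 T, N.pushForward v p m₀ σ t
      = ∑ j, (N.stay v m₀ νin j t).map (N.extParam j) := by
    intro t ht
    ext B hB
    rw [Network.pushForward_apply_eq hv hp hm₀ hend hσ hm hν htrans ⟨ht.1, ht.2.le⟩ hB,
      if_neg ht.2.ne, add_zero, Measure.finsetSum_apply]
  refine ⟨?_, fun t ht => ?_, ?_⟩
  -- The time `T`, at which the push-forward has the additional vertex term, is negligible here.
  · have hne : ∀ᵐ t ∂(volume.restrict (Icc 0 T)), t ≠ T :=
      ae_restrict_of_ae (Measure.ae_ne volume T)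
    filter_upwards [hae, hne, ae_restrict_mem measurableSet_Icc] with t hst hne ht
    rw [hF t ⟨ht.1, lt_of_le_of_ne ht.2 hne⟩,
      Network.toNetwork_eq_sum_extParam (hm.arcMeasure t ht)]
    exact Finset.sum_congr rfl fun j _ => by rw [hst j]
  · rw [hF t ht]
    refine ⟨inferInstance, fun φ hφ hφc => ?_⟩
    obtain ⟨C, hC⟩ := hφc.exists_bound_of_continuous hφ
    have hψ : ∀ j, Continuous fun x => φ (N.extParam j x) := fun j =>
      hφ.comp (Network.continuous_extParam j)
    have hint : ∀ μ : J → Measure ℝ, (∀ j, IsFiniteMeasure (μ j)) →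
        ∫ y, φ y ∂(∑ j, (μ j).map (N.extParam j)) = ∑ j, ∫ x, φ (N.extParam j x) ∂(μ j) := by
      intro μ hμ
      rw [integral_finsetSum_measure fun j _ => hφ.integrable_of_hasCompactSupport hφc]
      exact Finset.sum_congr rfl fun j _ =>
        integral_map (hpm j).aemeasurable hφ.aestronglyMeasurable
    rw [hint _ fun j => hstay j t]
    -- The solution itself is known only at almost every time. Its right continuous version `stay`
    -- fixes the limit of the averages at every `t < T`.
    refine tendsto_average_right ht (G := fun s =>
      ∑ j, ∫ x, φ (N.extParam j x) ∂(N.stay v m₀ νin j s)) ?_ ?_ ?_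
    · have h1 : IntegrableOn (fun s => ∑ j, ∫ x, φ (N.extParam j x) ∂(m s j)) (Icc 0 T) :=
        integrable_finsetSum _ fun j _ => integrable_integral_param (hm.measurable j)
          (fun s hs => (hm.arcMeasure s hs).finite j) (hm.finite j)
          (F := fun x _ => φ (N.extParam j x)) ((hψ j).comp continuous_fst) (fun x _ => hC _)
      refine h1.congr ?_
      filter_upwards [ae_restrict_mem measurableSet_Icc] with s hs
      rw [Network.toNetwork_eq_sum_extParam (hm.arcMeasure s hs),
        hint _ (hm.arcMeasure s hs).finite]
    · filter_upwards [hae, ae_restrict_mem measurableSet_Icc] with s hst hs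
      rw [Network.toNetwork_eq_sum_extParam (hm.arcMeasure s hs),
        hint _ (hm.arcMeasure s hs).finite]
      exact Finset.sum_congr rfl fun j _ => by rw [hst j]
    · refine tendsto_finsetSum _ fun j _ => ?_
      exact tendsto_integral_transported (hu j) (hv.isSemiflow j) (N.isOpen_arcInterior j)
        (N.isLowerSet_arcInterior j) (hψ j) (fun x => hC _) t
  · ext B hB
    rw [Network.pushForward_apply_eq hv hp hm₀ hend hσ hm hν htrans ⟨hT.le, le_rfl⟩ hB,
      if_pos rfl, Network.toNetwork_eq_sum_extParam (hm.arcMeasure T ⟨hT.le, le_rfl⟩),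
      Measure.finsetSum_apply, ← Finset.sum_add_distrib]
    refine Finset.sum_congr rfl fun j _ => ?_
    -- The parametrization maps the atom of `m T j` at `endCoord` to the terminal vertex of `j`,
    -- which is where the push-forward puts it.
    conv_lhs => rw [Network.eq_stay_add_endMass hT.le hv hm₀ hm hν j]
    rw [Measure.map_add _ _ (hpm j), Measure.map_smul, Measure.map_dirac' (hpm j),
      Measure.add_apply, Measure.smul_apply, Measure.dirac_apply' _ hB, smul_eq_mul]
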